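/- Let $d\ge 1$, $p\ge 0$, $\nu>0$. For $\theta,\alpha,\tau>0$, $\beta\in\mathbb R^p$ let $\mathbb P_{(\theta,\alpha,\tau,\beta)}$ be the law of the Gaussian process $Y$ on $[0,1]^d$ with mean $\beta^{\mathsf T}\mathrm f(\mathbf s)$ and covariance $\theta K_{\alpha,\nu}(\mathbf s-\mathbf t)+\tau\,1\{\mathbf s=\mathbf t\}$, where $K_{\alpha,\nu}(x)=\frac{2^{1-\nu}}{\Gamma(\nu)}(\|x\|/\alpha)^{\nu}\mathcal K_\nu(\alpha\|x\|)$ is the isotropic Matérn kernel ($K_{\alpha,\nu}(0)=\alpha^{-2\nu}$), $\mathcal K_\nu$ is the modified Bessel function of the second kind, and $\mathrm f_1,\dots,\mathrm f_p:[0,1]^d\to\mathbb R$ have bounded partial derivatives of all orders $\le\lceil\nu+d/2\rceil$. Fix true parameters $\theta_0,\alpha_0,\tau_0>0$, $\beta_0\in\mathbb R^p$. Design. Let $n=m^d$; for $\mathbf i\in\{1,\dots,m\}^d$ the sampling point $\mathbf s(\mathbf i)$ has coordinates $s_k(\mathbf i)=(i_k-1)/m+\delta_{\mathbf i;k}/m$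 with arbitrary $\delta_{\mathbf i;k}\in[0,1)$. Let $\max\{1-d/(4\nu),0\}<\gamma<1$, $\omega_m=\lfloor m^\gamma\rfloor$, $\ell_\star=\lceil\nu+d/2\rceil$. Differencing constants. Write $\mathbf k=(k_1,\dots,k_d)$, $0\le k_j\le\ell_\star$. There exist constants $c_{\mathbf i}^{\mathbf k}$ (depending on $m$ and the design) and $m$-independent constants $c^{\mathbf k}$ such that, for all large $m$, all designs and all $\mathbf i\in\{1,\dots,m-\ell_\star\omega_m\}^d$: $\sum_{\mathbf k}c_{\mathbf i}^{\mathbf k}s_d(\mathbf i+\mathbf k\omega_m)^{\ell_\star}=\ell_\star!(\omega_m/m)^{\ell_\star}$; $\sum_{\mathbf k}c_{\mathbf i}^{\mathbf k}\prod_j s_j(\mathbf i+\mathbf k\omega_m)^{l_j}=0$ for all $l\in\mathbb N^d$ with $l_d\le\ell_\star-1$, $\sum_j l_j\le\ell_\star$; and $c_{\mathbf i}^{\mathbf k}=c^{\mathbf k}+O(\omega_m^{-1})$ uniformly in $\mathbf i$, $\mathbf k$ and the design. Fix any such constants and put $\nabla Y(\mathbf s(\mathbf i))=\sum_{\mathbf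 k}c_{\mathbf i}^{\mathbf k}Y(\mathbf s(\mathbf i+\mathbf k\omega_m))$, $\Xi_{u,m}=\{\mathbf i:1\le i_1+u,i_1,\dots,i_d\le m-2\ell_\star\omega_m\}$, $V_u=\sum_{\mathbf i\in\Xi_{u,m}}\nabla Y(\mathbf s(\mathbf i))\,\nabla Y(\mathbf s(\mathbf i+u\mathbf e_1))$ for $u\in\{0,1\}$, and $$\hat\theta_n=\frac{V_1}{(\omega_m/m)^{2\nu}\,|\Xi_{1,m}|\,\xi^*_\nu H},\qquad \hat\tau_n=\frac{V_0}{\sum_{\mathbf i\in\Xi_{0,m}}\sum_{\mathbf k}(c_{\mathbf i}^{\mathbf k})^2},\qquad H=\sum_{\mathbf k,\mathbf k'}c^{\mathbf k}c^{\mathbf k'}G_\nu(\|\mathbf k-\mathbf k'\|),$$ where $G_\nu(t)=t^{2\nu}$, $\xi^*_\nu=-\pi/\{2^{2\nu}\Gamma(\nu+1)\Gamma(\nu)\sin(\nu\pi)\}$ if $\nu\notin\mathbb Z$, and $G_\nu(t)=t^{2\nu}\log t$ (with $G_\nu(0)=0$), $\xi^*_\nu=(-1)^{\nu+1}/\{2^{2\nu-1}\nu!(\nu-1)!\}$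 if $\nu\in\mathbb Z$. Sieve. Let $0<\rho_1<1-\gamma$, $0<\rho_{21}<2\nu(1-\gamma)/d$, $0<\rho_{22}<\frac12-2(1-\gamma)\nu/d$, $\rho_{31}>0$, $0<\rho_{32}<(1-\gamma)/d$ and $$\mathcal E_n=\{(\theta,\alpha,\tau,\beta)\in(0,\infty)^3\times\mathbb R^p:\ \|\beta\|^2/\theta\le n^{\rho_1},\ \tau/\theta\in[n^{-\rho_{21}},n^{\rho_{22}}],\ \alpha\in[n^{-\rho_{31}},n^{\rho_{32}}]\}.$$ Theorem. For every sufficiently small $\varsigma>0$ the numbers $$b_1=\min\Big\{\tfrac12-\tfrac{2(1-\gamma)\nu}{d}-\rho_{22},\ \tfrac{1-\gamma}2-\varsigma,\ \tfrac14+\tfrac{(1-\gamma)(\ell_\star-2\nu)}{d}-\tfrac{\rho_1+\rho_{22}}2,\ \tfrac{1-\gamma}4+\tfrac{(1-\gamma)(\ell_\star-\nu)}{d}-\tfrac{\rho_1}2-\varsigma\Big\},$$ $$b_2=\min\Big\{\tfrac12,\ \tfrac{(1-\gamma)(4\nu+d)}{2d}-\rho_{21}-\varsigma,\ \tfrac14+\tfrac{(1-\gamma)\ell_\star}{d}-\tfrac{\rho_1+\rho_{21}}2,\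 \tfrac{(1-\gamma)(4\nu+d+4\ell_\star)}{4d}-\tfrac{\rho_1+2\rho_{21}}2-\varsigma\Big\}$$ are positive, and, with $\varphi(x)=\min(x^2,x)$, there are constants $c_1,c_2>0$ such that for all $\epsilon_1,\epsilon_2\in(0,1/2)$ there is $n_0$ (depending on $\epsilon_1,\epsilon_2$ but not on the perturbations $\delta_{\mathbf i;k}$) such that for all $n=m^d>n_0$ with $\omega_m$ even and all $\delta_{\mathbf i;k}\in[0,1)$: (i) $\mathbb P_{(\theta_0,\alpha_0,\tau_0,\beta_0)}(|\hat\theta_n/\theta_0-1|\ge\epsilon_1/2)\le\exp\{-c_1\varphi(n^{b_1}\epsilon_1)\}$ and $$\sup_{(\theta,\alpha,\tau,\beta)\in\mathcal E_n,\ |\theta/\theta_0-1|\ge\epsilon_1}\mathbb P_{(\theta,\alpha,\tau,\beta)}(|\hat\theta_n/\theta_0-1|\le\epsilon_1/2)\le\exp\{-c_1\varphi(n^{b_1}\epsilon_1)\};$$ (ii) $\mathbb P_{(\theta_0,\alpha_0,\tau_0,\beta_0)}(|\hat\tau_n/\tau_0-1|\ge\epsilon_2/2)\le\exp\{-c_2\varphi(n^{b_2}\epsilon_2)\}$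 and $$\sup_{(\theta,\alpha,\tau,\beta)\in\mathcal E_n,\ |\tau/\tau_0-1|\ge\epsilon_2}\mathbb P_{(\theta,\alpha,\tau,\beta)}(|\hat\tau_n/\tau_0-1|\le\epsilon_2/2)\le\exp\{-c_2\varphi(n^{b_2}\epsilon_2)\}.$$ -/

import Mathlib

open MeasureTheory ProbabilityTheory Set
open scoped BigOperators

noncomputable section

namespace MaternNugget

/-- Spatial locations. -/
abbrev Loc (d : ℕ) : Type := EuclideanSpace ℝ (Fin d)

/-- The spatial domain `[0,1]^d`. -/
def cube (d : ℕ) : Set (Loc d) := {s | ∀ k, s k ∈ Icc (0 : ℝ) 1}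

/-! ### The model -/

/-- The modified Bessel function of the second kind `𝒦_ν(x)`, for `x > 0`. -/
def besselK (ν x : ℝ) : ℝ :=
  ∫ t in Ioi (0 : ℝ), Real.exp (-(x * Real.cosh t)) * Real.cosh (ν * t)

/-- The isotropic Matérn kernel `K_{α,ν}` as a function of the distance `r = ‖s - t‖`; the value
at `r = 0` is the limit as `r → 0`. The covariance function is `θ K_{α,ν}`, `θ = σ² α^{2ν}`. -/
def maternK (ν α r : ℝ) : ℝ :=
  if r = 0 then α ^ (-(2 * ν))
  else 2 ^ (1 - ν) / Real.Gamma ν * (r / α) ^ ν * besselK ν (α * r)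

/-- The parameter vector `(θ, α, τ, β)`. -/
structure Param (p : ℕ) where
  /-- microergodic parameter -/
  θ : ℝ
  /-- inverse range parameter -/
  α : ℝ
  /-- nugget parameter -/
  τ : ℝ
  /-- regression coefficients -/
  β : EuclideanSpace ℝ (Fin p)

/-- Under `P`, the process `(Y(s))_{s ∈ [0,1]^d}` is the Gaussian process
`GP(βᵀ f, θ K_{α,ν} + τ δ₀)`. -/
structure IsModel {d p : ℕ} (ν : ℝ) (f : Fin p → Loc d → ℝ) (q : Param p)
    {Ω : Type*} [MeasurableSpace Ω] (P : Measure Ω) (Y : Loc d → Ω → ℝ) : Prop where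
  gaussian : IsGaussianProcess (fun s : cube d => Y s) P
  mean : ∀ s ∈ cube d, ∫ o, Y s o ∂P = ∑ l, q.β l * f l s
  cov : ∀ s ∈ cube d, ∀ t ∈ cube d,
    covariance (Y s) (Y t) P = q.θ * maternK ν q.α ‖s - t‖ + (if s = t then q.τ else 0)

/-- All partial derivatives `D^j f` of order `|j| ≤ N` exist on `[0,1]^d` (one-sided on the
boundary) and are bounded by `C`. -/
def HasBoundedPartials {d : ℕ} (N : ℕ) (C : ℝ) (f : Loc d → ℝ) : Prop :=
  ∃ D : (Fin d → ℕ) → Loc d → ℝ,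
    (∀ s ∈ cube d, D 0 s = f s) ∧
    (∀ j, ∑ k, j k < N → ∀ k, ∀ s ∈ cube d,
      HasLineDerivWithinAt ℝ (D j) (D (j + Pi.single k 1) s) (cube d) s
        (EuclideanSpace.single k 1)) ∧
    ∀ j, ∑ k, j k ≤ N → ∀ s ∈ cube d, |D j s| ≤ C

/-! ### The stratified sampling design -/

/-- The perturbations `δ_{i;k}` all lie in `[0,1)`. -/
def IsDesign {d : ℕ} (δ : (Fin d → ℕ) → Fin d → ℝ) : Prop := ∀ i k, δ i k ∈ Ico (0 : ℝ) 1

/-- The sampling point `s(i)`, with coordinates `(i_k - 1)/m + δ_{i;k}/m`, for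
`i ∈ {1, …, m}^d`. -/
def site {d : ℕ} (m : ℕ) (δ : (Fin d → ℕ) → Fin d → ℝ) (i : Fin d → ℕ) : Loc d :=
  WithLp.toLp 2 fun k => ((i k : ℝ) - 1) / m + δ i k / m

/-! ### Higher-order quadratic variation -/

/-- `ω_m = ⌊m^γ⌋`. -/
def omega (γ : ℝ) (m : ℕ) : ℕ := ⌊(m : ℝ) ^ γ⌋₊

/-- `ℓ_⋆ = ⌈ν + d/2⌉`. -/
def ellStar (d : ℕ) (ν : ℝ) : ℕ := ⌈ν + (d : ℝ) / 2⌉₊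

/-- The multi-indices `(k_1, …, k_d)` with `0 ≤ k_1, …, k_d ≤ ℓ`. -/
def multiIdx (d ℓ : ℕ) : Finset (Fin d → ℕ) := Fintype.piFinset fun _ => Finset.range (ℓ + 1)

/-- The last coordinate index. -/
def lastIdx (d : ℕ) [NeZero d] : Fin d := ⟨d - 1, Nat.sub_lt (NeZero.pos d) Nat.one_pos⟩

/-- `c` is an array of `ℓ`-th order differencing constants `c_{i,d,ℓ}^{(k)}` (depending on `m` and
on the design `δ`), with `m`-independent limits `c_{d,ℓ}^{(k)}`: for all large `m`, every design
and every `i ∈ {1, …, m - ℓ ω_m}^d` the differences kill all monomials of degree at most `ℓ` except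
`s_d^ℓ`, which is mapped to `ℓ! (ω_m/m)^ℓ`, and `c_{i,d,ℓ}^{(k)} = c_{d,ℓ}^{(k)} + O(ω_m⁻¹)`
uniformly. -/
def IsDifferencing (d : ℕ) [NeZero d] (ℓ : ℕ) (γ : ℝ)
    (c : ℕ → ((Fin d → ℕ) → Fin d → ℝ) → (Fin d → ℕ) → (Fin d → ℕ) → ℝ)
    (cLim : (Fin d → ℕ) → ℝ) : Prop :=
  ∃ (C : ℝ) (m₀ : ℕ), ∀ m, m₀ ≤ m → ∀ δ, IsDesign δ → ∀ i : Fin d → ℕ,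
    (∀ k, i k ∈ Finset.Icc 1 (m - ℓ * omega γ m)) →
      (∑ k ∈ multiIdx d ℓ,
          c m δ i k * site m δ (fun j => i j + k j * omega γ m) (lastIdx d) ^ ℓ
        = (Nat.factorial ℓ : ℝ) * ((omega γ m : ℝ) / m) ^ ℓ) ∧
      (∀ l : Fin d → ℕ, l (lastIdx d) < ℓ → ∑ j, l j ≤ ℓ →
        ∑ k ∈ multiIdx d ℓ,
          c m δ i k * ∏ j, site m δ (fun j' => i j' + k j' * omega γ m) j ^ l j = 0) ∧
      ∀ k ∈ multiIdx d ℓ, |c m δ i k - cLim k| ≤ C / omega γ m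

/-- The differencing operator `∇_{d,ℓ} Y(s(i))`; here `a i k` is the constant
`c_{i,d,ℓ}^{(k)}` and `y i` is the observation `Y(s(i))`. -/
def nabla {d : ℕ} (ℓ w : ℕ) (a : (Fin d → ℕ) → (Fin d → ℕ) → ℝ) (y : (Fin d → ℕ) → ℝ)
    (i : Fin d → ℕ) : ℝ :=
  ∑ k ∈ multiIdx d ℓ, a i k * y (fun j => i j + k j * w)

/-- The index set `Ξ_{u,m} = {i : 1 ≤ i_1 + u, i_1, …, i_d ≤ m - 2 ℓ ω_m}`. -/
def Xi (d : ℕ) [NeZero d] (ℓ w m u : ℕ) : Finset (Fin d → ℕ) :=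
  (Fintype.piFinset fun _ => Finset.Icc 1 (m - 2 * ℓ * w)).filter
    fun i => i 0 + u ≤ m - 2 * ℓ * w

/-- The `ℓ`-th order quadratic variation `V_{u,d,ℓ}`. -/
def quadVar {d : ℕ} [NeZero d] (ℓ w m u : ℕ) (a : (Fin d → ℕ) → (Fin d → ℕ) → ℝ)
    (y : (Fin d → ℕ) → ℝ) : ℝ :=
  ∑ i ∈ Xi d ℓ w m u, nabla ℓ w a y i * nabla ℓ w a y (i + Pi.single 0 u)

/-- `C_{V,0} = ∑_{i ∈ Ξ_{0,m}} ∑_k (c_{i,d,ℓ}^{(k)})²`. -/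
def CV0 {d : ℕ} [NeZero d] (ℓ w m : ℕ) (a : (Fin d → ℕ) → (Fin d → ℕ) → ℝ) : ℝ :=
  ∑ i ∈ Xi d ℓ w m 0, ∑ k ∈ multiIdx d ℓ, a i k ^ 2

/-- `ν` is a (positive) integer. -/
def IsPosInt (ν : ℝ) : Prop := ∃ j : ℕ, 0 < j ∧ ν = j

open Classical in
/-- `G_ν(t) = t^{2ν} log t` for integer `ν`, and `t^{2ν}` otherwise. -/
def G (ν t : ℝ) : ℝ := if IsPosInt ν then t ^ (2 * ν) * Real.log t else t ^ (2 * ν)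

open Classical in
/-- The constant `ξ*_ν`; for integer `ν`, `Γ(ν + 1) = ν!` and `Γ(ν) = (ν - 1)!`. -/
def xiStar (ν : ℝ) : ℝ :=
  if IsPosInt ν then
    (-1) ^ (⌊ν⌋₊ + 1) / (2 ^ (2 * ν - 1) * Real.Gamma (ν + 1) * Real.Gamma ν)
  else
    -Real.pi / (2 ^ (2 * ν) * Real.Gamma (ν + 1) * Real.Gamma ν * Real.sin (ν * Real.pi))

/-- `H_{ℓ,ν}`. -/
def H {d : ℕ} (ℓ : ℕ) (ν : ℝ) (cLim : (Fin d → ℕ) → ℝ) : ℝ :=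
  ∑ k ∈ multiIdx d ℓ, ∑ k' ∈ multiIdx d ℓ,
    cLim k * cLim k' * G ν (Real.sqrt (∑ j, ((k j : ℝ) - (k' j : ℝ)) ^ 2))

/-- `g_{ℓ,ν} = (ω_m/m)^{2ν} |Ξ_{1,m}| ξ*_ν H_{ℓ,ν}`. -/
def gNorm {d : ℕ} [NeZero d] (ℓ w m : ℕ) (ν : ℝ) (cLim : (Fin d → ℕ) → ℝ) : ℝ :=
  ((w : ℝ) / m) ^ (2 * ν) * ((Xi d ℓ w m 1).card : ℝ) * xiStar ν * H ℓ ν cLim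

/-- The estimator `θ̂_n = V_{1,d,ℓ⋆} / g_{ℓ⋆,ν}`, a function of the data `y i = Y(s(i))`. -/
def thetaHat {d : ℕ} [NeZero d] (ν γ : ℝ) (m : ℕ) (a : (Fin d → ℕ) → (Fin d → ℕ) → ℝ)
    (cLim : (Fin d → ℕ) → ℝ) (y : (Fin d → ℕ) → ℝ) : ℝ :=
  quadVar (ellStar d ν) (omega γ m) m 1 a y / gNorm (ellStar d ν) (omega γ m) m ν cLim

/-- The estimator `τ̂_n = V_{0,d,ℓ⋆} / C_{V,0}`, a function of the data `y i = Y(s(i))`. -/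
def tauHat {d : ℕ} [NeZero d] (ν γ : ℝ) (m : ℕ) (a : (Fin d → ℕ) → (Fin d → ℕ) → ℝ)
    (y : (Fin d → ℕ) → ℝ) : ℝ :=
  quadVar (ellStar d ν) (omega γ m) m 0 a y / CV0 (ellStar d ν) (omega γ m) m a

/-! ### The sieve, the rate function and the exponents -/

/-- The sieve `ℰ_n`. -/
def sieve (p : ℕ) (ρ₁ ρ₂₁ ρ₂₂ ρ₃₁ ρ₃₂ : ℝ) (n : ℕ) : Set (Param p) :=
  {q | 0 < q.θ ∧ 0 < q.α ∧ 0 < q.τ ∧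
    ‖q.β‖ ^ 2 / q.θ ≤ (n : ℝ) ^ ρ₁ ∧
    q.τ / q.θ ∈ Icc ((n : ℝ) ^ (-ρ₂₁)) ((n : ℝ) ^ ρ₂₂) ∧
    q.α ∈ Icc ((n : ℝ) ^ (-ρ₃₁)) ((n : ℝ) ^ ρ₃₂)}

/-- `φ(x) = min(x², x)`. -/
def phi (x : ℝ) : ℝ := min (x ^ 2) x

/-- The exponent `b₁`. -/
def b₁ (d : ℕ) (ν γ ρ₁ ρ₂₂ ς : ℝ) : ℝ :=
  min (min (1 / 2 - 2 * (1 - γ) * ν / d - ρ₂₂) ((1 - γ) / 2 - ς))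
    (min (1 / 4 + (1 - γ) * ((ellStar d ν : ℝ) - 2 * ν) / d - (ρ₁ + ρ₂₂) / 2)
      ((1 - γ) / 4 + (1 - γ) * ((ellStar d ν : ℝ) - ν) / d - ρ₁ / 2 - ς))

/-- The exponent `b₂`. -/
def b₂ (d : ℕ) (ν γ ρ₁ ρ₂₁ ς : ℝ) : ℝ :=
  min (min (1 / 2) ((1 - γ) * (4 * ν + d) / (2 * d) - ρ₂₁ - ς))
    (min (1 / 4 + (1 - γ) * (ellStar d ν : ℝ) / d - (ρ₁ + ρ₂₁) / 2)
      ((1 - γ) * (4 * ν + d + 4 * (ellStar d ν : ℝ)) / (4 * d) - (ρ₁ + 2 * ρ₂₁) / 2 - ς))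

end MaternNugget

end

/-!
Both estimators are ratios `V / A` of a quadratic variation of Gaussian differences to a
normalisation, so the theorem follows from one concentration statement, uniform over the sieve
and over the designs: under `(θ, α, τ, β)` the ratio of the estimator to its own target `θ`
(or `τ`) is within `ε / 3` of one, except with probability `8 exp (-2 c n^b ε)`. For large `n` this
is at most `exp (-c n^b ε)`, and `φ(x) ≤ x`; the true parameter eventually lies in the sieve, and an
estimate within the factor `1 ± ε / 2` of `θ₀` is off by at least `ε / 3` relative to any `θ` with
`|θ / θ₀ - 1| ≥ ε` (`le_abs_div_sub_one`).

*Concentration.* If the covariance matrix of a Gaussian vector has Frobenius norm at most `F`, its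
mean `μ` satisfies `|μ|² F ≤ s²`, and `F ≤ s`, then the sum of its squares deviates from its
expectation by `t` with probability at most `4 exp (-t / (8 s))` (`measure_abs_sum_sq_sub_le`,
through the moment generating function in an orthonormal eigenbasis). Polarisation extends this
to the products of lag one (`measure_abs_sum_mul_sub_le`).

*Covariances of differences.* The Matérn kernel is a mixture of Gaussian kernels,
`K_{α,ν}(r) = Γ(ν)⁻¹ ∫₀^∞ v^(ν - 1) e^(-α² v) e^(-r² / (4 v)) dv`
(`maternK_eq_mixture`), and it scales: lengths may be measured in units of the mesh size
`h = ω_m / m` at the price of a factor `h^(2 ν)` and of replacing `α` by `α h` (`maternK_mul`). A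
Gaussian kernel is an average of complex exponentials, and a weight vector that annihilates the
polynomials of degree less than `ℓ` maps the exponential of frequency `y` to `O(|y|^ℓ)`. Integrating
over `v` bounds the double difference of two configurations at rescaled positions `p`, `q` by
`C ∏ⱼ (1 + |pⱼ - qⱼ|)⁻¹`, uniformly in `α`; this is where `ℓ⋆ ≥ ν + d / 2` enters
(`exists_abs_maternDiff_le`). The product is square summable, so the `n × n` covariance matrix has
Frobenius norm `O(√n (θ h^(2 ν) ω_m^(d / 2) + τ))` (`exists_sum_sq_covDiff_le`): the Matérn part
correlates blocks of `ω_m^d` indices, the nugget boundedly many. Taylor's formula gives means of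
order `‖β‖ h^ℓ` (`HasBoundedPartials.abs_sum_le`).

*Expectations.* At lag one no site is shared, the nugget disappears, and the rescaled covariance
tends, as `α h → 0`, to the double difference of the mixture at `α = 0`
(`exists_abs_maternDiff_lag_sub_lt`). The Mellin transform of an exponential sum with vanishing
moments identifies this limit with `ξ*_ν H` (`mixtureDiff_zero_eq_sum`; at integer `ν` a
Frullani integral produces the logarithm in `G_ν`), and as an integral of positive semidefinite
forms that do not all vanish it is positive (`mixtureDiff_zero_pos`). At lag zero the nugget
dominates, and `E V₀` is `τ ∑ c²` up to a relative error `O(h^(2 ν) θ / τ)`.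

Comparing powers of `n` (`scale_le`) turns these sizes into the exponents `b₁` and `b₂`.
-/

noncomputable section

namespace MaternNugget

/-! ### Concentration of sums of squares of a Gaussian vector -/

lemma exp_neg_add_sq_le {x : ℝ} (hx : |x| ≤ 1 / 2) : Real.exp (-(x + x ^ 2)) ≤ 1 - x := by
  have h := abs_le.1 hx
  have h1 : 0 < 1 - x := by linarith
  rw [Real.exp_neg, inv_le_comm₀ (Real.exp_pos _) h1]
  rw [inv_le_iff_one_le_mul₀ h1]
  rcases le_total 0 x with h0 | h0
  · have := Real.quadratic_le_exp_of_nonneg (x := x + x ^ 2) (by positivity)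
    refine le_trans ?_ (mul_le_mul_of_nonneg_right this h1.le)
    nlinarith [mul_nonneg h0 h0, mul_nonneg (mul_nonneg h0 h0) (sub_nonneg.2 h.2),
      mul_nonneg (mul_nonneg (mul_nonneg h0 h0) h0) (sub_nonneg.2 h.2)]
  · have := Real.add_one_le_exp (x + x ^ 2)
    refine le_trans ?_ (mul_le_mul_of_nonneg_right this h1.le)
    nlinarith [mul_nonneg (neg_nonneg.2 h0) (sq_nonneg x)]

lemma integrable_and_integral_exp_sq_gaussianReal (m : ℝ) (v : NNReal) {t : ℝ}
    (ht : 2 * t * v < 1) :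
    Integrable (fun x => Real.exp (t * x ^ 2)) (gaussianReal m v) ∧
      ∫ x, Real.exp (t * x ^ 2) ∂gaussianReal m v =
        (√(1 - 2 * t * v))⁻¹ * Real.exp (t * m ^ 2 / (1 - 2 * t * v)) := by
  rcases eq_or_ne v 0 with rfl | hv
  · simp [gaussianReal_zero_var, integrable_dirac]
  have hv0 : (0 : ℝ) < v := by positivity
  set a : ℝ := 1 - 2 * t * v with ha
  have ha0 : 0 < a := by linarith
  set b : ℝ := a / (2 * v) with hb
  have hb0 : 0 < b := by positivity
  have key : ∀ x : ℝ, gaussianPDFReal m v x * Real.exp (t * x ^ 2) =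
      (√(2 * Real.pi * v))⁻¹ * Real.exp (t * m ^ 2 / a) * Real.exp (-b * (x - m / a) ^ 2) := by
    intro x
    rw [gaussianPDFReal, mul_assoc, mul_assoc (√(2 * Real.pi * v))⁻¹, ← Real.exp_add,
      ← Real.exp_add]
    congr 2
    have : t = (1 - a) / (2 * v) := by rw [ha]; field_simp; ring
    rw [hb, this]
    field_simp
    ring
  have hint : Integrable (fun x : ℝ => Real.exp (-b * (x - m / a) ^ 2)) :=
    (integrable_exp_neg_mul_sq hb0).comp_sub_right (m / a)
  constructor
  · rw [gaussianReal_of_var_ne_zero _ hv, gaussianPDF_def,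
      integrable_withDensity_iff_integrable_smul' (by fun_prop) (by simp)]
    refine (hint.const_mul ((√(2 * Real.pi * v))⁻¹ * Real.exp (t * m ^ 2 / a))).congr
      (Filter.Eventually.of_forall fun x => ?_)
    simp only [smul_eq_mul]
    rw [ENNReal.toReal_ofReal (gaussianPDFReal_nonneg _ _ _), key]
  · rw [integral_gaussianReal_eq_integral_smul hv]
    simp only [smul_eq_mul, key]
    rw [integral_const_mul, integral_sub_right_eq_self (fun x => Real.exp (-b * x ^ 2)),
      integral_gaussian, mul_right_comm]
    congr 1
    rw [← Real.sqrt_inv, ← Real.sqrt_inv, ← Real.sqrt_mul (by positivity)]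
    congr 1
    rw [hb]; field_simp

lemma mgf_sq_gaussianReal_le (m : ℝ) (v : NNReal) {t : ℝ} (ht : |2 * t * v| ≤ 1 / 2) :
    ∫ x, Real.exp (t * x ^ 2) ∂gaussianReal m v ≤
      Real.exp (t * (v + m ^ 2) + (2 * t ^ 2 * v ^ 2 + 4 * t ^ 2 * (m ^ 2 * v))) := by
  have h := abs_le.1 ht
  rw [(integrable_and_integral_exp_sq_gaussianReal m v (t := t) (by linarith)).2]
  set x : ℝ := 2 * t * v with hx
  have h1 : 0 < 1 - x := by linarith
  have e1 : (√(1 - x))⁻¹ ≤ Real.exp ((x + x ^ 2) / 2) := by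
    rw [inv_le_comm₀ (Real.sqrt_pos.2 h1) (Real.exp_pos _), ← Real.exp_neg]
    apply Real.le_sqrt_of_sq_le
    rw [← Real.exp_nat_mul]
    convert exp_neg_add_sq_le ht using 2
    push_cast; ring
  have e2 : t * m ^ 2 / (1 - x) ≤ t * m ^ 2 + 4 * t ^ 2 * (m ^ 2 * v) := by
    rw [div_le_iff₀ h1]
    have : t * m ^ 2 + 4 * t ^ 2 * (m ^ 2 * v) = m ^ 2 * (t + 2 * t * x) := by rw [hx]; ring
    rw [this]
    have : m ^ 2 * (t + 2 * t * x) * (1 - x) - t * m ^ 2 = m ^ 2 * (t * x) * (1 - 2 * x) := by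
      ring
    have h3 : 0 ≤ t * x := by rw [hx]; have : 0 ≤ t ^ 2 * (v : ℝ) := by positivity
                              linarith
    have h4 : 0 ≤ m ^ 2 * (t * x) * (1 - 2 * x) :=
      mul_nonneg (by positivity) (by linarith)
    linarith
  calc _ ≤ Real.exp ((x + x ^ 2) / 2) * Real.exp (t * m ^ 2 + 4 * t ^ 2 * (m ^ 2 * v)) := by
        gcongr
    _ = _ := by rw [← Real.exp_add]; congr 1; rw [hx]; ring

section Vector

variable {Ω : Type*} [MeasurableSpace Ω] {P : Measure Ω} {ι : Type*} [Fintype ι]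
  {W : ι → Ω → ℝ}

/-- Diagonalising the covariance matrix turns a Gaussian vector into independent Gaussian
coordinates; the sum of squares is unchanged. -/
lemma exists_independent_coordinates (hW : HasGaussianLaw (fun ω i => W i ω) P) :
    ∃ (Z : ι → Ω → ℝ) (m : ι → ℝ) (v : ι → NNReal), iIndepFun Z P ∧
      (∀ j, HasLaw (Z j) (gaussianReal (m j) (v j)) P) ∧
      (∀ ω, ∑ j, Z j ω ^ 2 = ∑ i, W i ω ^ 2) ∧
      (∑ j, m j ^ 2 = ∑ i, (∫ ω, W i ω ∂P) ^ 2) ∧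
      (∑ j, (v j : ℝ) ^ 2 = ∑ i, ∑ i', cov[W i, W i'; P] ^ 2) ∧
      (∑ j, (v j : ℝ) = ∑ i, cov[W i, W i; P]) := by
  classical
  have := hW.isProbabilityMeasure
  have hmem : ∀ i, MemLp (W i) 2 P := fun i => (hW.eval i).memLp_two
  let S : Matrix ι ι ℝ := Matrix.of fun i j => cov[W i, W j; P]
  have hS : S.IsHermitian := by
    ext i j; simp [S, covariance_comm]
  let e := hS.eigenvectorBasis
  have pars : ∀ y : EuclideanSpace ℝ ι, ∑ j, (∑ i, e j i * y i) ^ 2 = ∑ i, y i ^ 2 := by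
    intro y
    have h := e.sum_sq_norm_inner_right y
    rw [EuclideanSpace.norm_sq_eq] at h
    simpa [PiLp.inner_apply, mul_comm] using h
  have eig : ∀ j i, ∑ i', S i i' * e j i' = hS.eigenvalues j * e j i := by
    intro j i
    have := congrFun (hS.mulVec_eigenvectorBasis j) i
    simpa [Matrix.mulVec, dotProduct] using this
  have orth : ∀ j k, ∑ i, e j i * e k i = if j = k then 1 else 0 := by
    intro j k
    have := orthonormal_iff_ite.1 e.orthonormal j k
    simpa [PiLp.inner_apply, mul_comm] using this
  let Z : ι → Ω → ℝ := fun j ω => ∑ i, e j i * W i ω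
  let L : (ι → ℝ) →L[ℝ] (ι → ℝ) := ContinuousLinearMap.pi fun j =>
    ∑ i, (e j i) • ContinuousLinearMap.proj i
  have hZ : HasGaussianLaw (fun ω j => Z j ω) P := by
    have h : (fun ω j => Z j ω) = fun ω => L fun i => W i ω := by
      ext ω j; simp [L, Z]
    rw [h]
    exact hW.map_fun L
  have hcov : ∀ j k, cov[Z j, Z k; P] = if j = k then hS.eigenvalues k else 0 := by
    intro j k
    have : cov[Z j, Z k; P] = ∑ i, ∑ i', e j i * (e k i' * S i i') := by
      rw [show Z j = fun ω => ∑ i, e j i * W i ω from rfl,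
        show Z k = fun ω => ∑ i, e k i * W i ω from rfl, covariance_fun_sum_fun_sum]
      · simp only [covariance_const_mul_left, covariance_const_mul_right]
        exact Finset.sum_congr rfl fun _ _ => Finset.sum_congr rfl fun _ _ => mul_left_comm _ _ _
      · exact fun i => (hmem i).const_mul _
      · exact fun i => (hmem i).const_mul _
    rw [this]
    have : ∀ i, ∑ i', e j i * (e k i' * S i i') = hS.eigenvalues k * (e j i * e k i) := by
      intro i
      rw [← Finset.mul_sum, mul_left_comm, ← eig]
      congr 1
      exact Finset.sum_congr rfl fun _ _ => mul_comm _ _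
    simp only [this, ← Finset.mul_sum, orth]
    simp
  have hnn : ∀ j, 0 ≤ hS.eigenvalues j := by
    intro j
    have := hcov j j
    rw [if_pos rfl, covariance_self (hZ.eval j).aemeasurable] at this
    rw [← this]; exact variance_nonneg _ _
  have hmean : ∀ j, ∫ ω, Z j ω ∂P = ∑ i, e j i * ∫ ω, W i ω ∂P := by
    intro j
    simp only [Z]
    rw [integral_finsetSum _ fun i _ => ((hW.eval i).integrable.const_mul _)]
    simp [integral_const_mul]
  refine ⟨Z, fun j => ∫ ω, Z j ω ∂P, fun j => Var[Z j; P].toNNReal, ?_, ?_, ?_, ?_, ?_, ?_⟩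
  · exact hZ.iIndepFun_of_covariance_eq_zero fun j k hjk => by rw [hcov, if_neg hjk]
  · intro j
    exact ⟨(hZ.eval j).aemeasurable, (hZ.eval j).map_eq_gaussianReal⟩
  · intro ω
    exact pars (WithLp.toLp 2 fun i => W i ω)
  · simp only [hmean]
    exact pars (WithLp.toLp 2 fun i => ∫ ω, W i ω ∂P)
  · have hv : ∀ j, ((Var[Z j; P].toNNReal : NNReal) : ℝ) = hS.eigenvalues j := by
      intro j
      rw [Real.coe_toNNReal _ (variance_nonneg _ _), ← covariance_self (hZ.eval j).aemeasurable,
        hcov, if_pos rfl]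
    simp only [hv]
    have h1 : ∀ j, hS.eigenvalues j ^ 2 = ∑ i, (∑ i', e j i' * S i i') ^ 2 := by
      intro j
      have : ∀ i, ∑ i', e j i' * S i i' = hS.eigenvalues j * e j i := by
        intro i; rw [← eig]; exact Finset.sum_congr rfl fun _ _ => mul_comm _ _
      simp only [this, mul_pow, ← Finset.mul_sum]
      have := orth j j
      simp only [if_true, ← pow_two] at this
      rw [this, mul_one]
    simp only [h1]
    rw [Finset.sum_comm]
    exact Finset.sum_congr rfl fun i _ => pars (WithLp.toLp 2 (S i))
  · have hv : ∀ j, ((Var[Z j; P].toNNReal : NNReal) : ℝ) = hS.eigenvalues j := by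
      intro j
      rw [Real.coe_toNNReal _ (variance_nonneg _ _), ← covariance_self (hZ.eval j).aemeasurable,
        hcov, if_pos rfl]
    simp only [hv]
    have := hS.trace_eq_sum_eigenvalues
    simpa [Matrix.trace, S] using this.symm

/-- Subexponential tail of `∑ W_i²` around its mean, at the scale `s` which dominates both
the Frobenius norm `F` of the covariance matrix and the fluctuation `‖E W‖ √F` of the
linear term. -/
theorem measure_abs_sum_sq_sub_le (hW : HasGaussianLaw (fun ω i => W i ω) P) {F s : ℝ}
    (hF : 0 ≤ F) (hs : 0 < s)
    (hcov : ∑ i, ∑ i', cov[W i, W i'; P] ^ 2 ≤ F ^ 2) (hFs : F ≤ s)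
    (hmean : (∑ i, (∫ ω, W i ω ∂P) ^ 2) * F ≤ s ^ 2) (t : ℝ) :
    P.real {ω | t ≤ |∑ i, W i ω ^ 2 - ∑ i, (cov[W i, W i; P] + (∫ ω, W i ω ∂P) ^ 2)|} ≤
      4 * Real.exp (-(t / (8 * s))) := by
  have := hW.isProbabilityMeasure
  obtain ⟨Z, m, v, hind, hlaw, hsq, hm, hv2, hv1⟩ := exists_independent_coordinates hW
  set E := ∑ i, (cov[W i, W i; P] + (∫ ω, W i ω ∂P) ^ 2) with hE
  have hE' : E = ∑ j, ((v j : ℝ) + m j ^ 2) := by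
    rw [hE, Finset.sum_add_distrib, Finset.sum_add_distrib, hv1, hm]
  have hvF : ∀ j, (v j : ℝ) ≤ F := by
    intro j
    refine abs_le_of_sq_le_sq' ?_ hF |>.2
    exact (Finset.single_le_sum (f := fun j => (v j : ℝ) ^ 2) (fun _ _ => sq_nonneg _)
      (Finset.mem_univ j)).trans (hv2.trans_le hcov)
  -- the two-sided moment generating function bound at `t = ± 1 / (8 s)`
  have main : ∀ r : ℝ, |r| = 1 / (8 * s) →
      Integrable (fun ω => Real.exp (r * (∑ j, fun ω => Z j ω ^ 2) ω)) P ∧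
      mgf (∑ j, fun ω => Z j ω ^ 2) P r ≤ Real.exp (r * E) * 2 := by
    intro r hr
    have hsmall : ∀ j, |2 * r * v j| ≤ 1 / 2 := by
      intro j
      rw [abs_mul, abs_mul, hr, abs_of_nonneg (v j).coe_nonneg, abs_of_pos (by norm_num : (0 : ℝ) < 2)]
      have := (hvF j).trans hFs
      calc 2 * (1 / (8 * s)) * (v j : ℝ) ≤ 2 * (1 / (8 * s)) * s := by gcongr
        _ ≤ 1 / 2 := by field_simp; norm_num
    have hmeas : ∀ j, AEMeasurable (fun ω => Z j ω ^ 2) P :=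
      fun j => (hlaw j).aemeasurable.pow_const 2
    have hind2 : iIndepFun (fun j ω => Z j ω ^ 2) P :=
      hind.comp (fun _ x => x ^ 2) (fun _ => by fun_prop)
    have hint : ∀ j, Integrable (fun ω => Real.exp (r * Z j ω ^ 2)) P := by
      intro j
      have h1 := (integrable_and_integral_exp_sq_gaussianReal (m j) (v j) (t := r)
        (by linarith [(abs_le.1 (hsmall j)).2])).1
      rw [← (hlaw j).map_eq] at h1
      exact h1.comp_aemeasurable (hlaw j).aemeasurable
    have hprod : Integrable (fun ω => Real.exp (r * (∑ j, fun ω => Z j ω ^ 2) ω)) P := by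
      have hae : ∀ j, (fun ω => Z j ω ^ 2) =ᵐ[P] (hmeas j).mk := fun j => (hmeas j).ae_eq_mk
      have h1 := (hind2.congr hae).integrable_exp_mul_sum (t := r) (s := Finset.univ)
        (fun j => (hmeas j).measurable_mk)
        (fun j _ => (hint j).congr ((hae j).mono fun ω h => by simp only [← h]))
      refine h1.congr ?_
      filter_upwards [ae_all_iff.2 hae] with ω h
      simp only [Finset.sum_apply, ← h]
    refine ⟨hprod, ?_⟩
    rw [hind2.mgf_sum₀ hmeas]
    have hb : ∀ j, mgf (fun ω => Z j ω ^ 2) P r ≤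
        Real.exp (r * (v j + m j ^ 2) + (2 * r ^ 2 * v j ^ 2 + 4 * r ^ 2 * (m j ^ 2 * v j))) := by
      intro j
      refine le_trans (le_of_eq ?_) (mgf_sq_gaussianReal_le (m j) (v j) (hsmall j))
      rw [← (hlaw j).map_eq, integral_map (hlaw j).aemeasurable (by fun_prop)]
      rfl
    refine (Finset.prod_le_prod (fun j _ => mgf_nonneg) fun j _ => hb j).trans ?_
    rw [← Real.exp_sum, Finset.sum_add_distrib, ← Finset.mul_sum, ← hE', Real.exp_add]
    refine mul_le_mul_of_nonneg_left ?_ (Real.exp_pos _).le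
    have hr2 : r ^ 2 = 1 / (64 * s ^ 2) := by
      rw [← sq_abs, hr]; ring
    have h2 : ∑ j, (2 * r ^ 2 * (v j : ℝ) ^ 2 + 4 * r ^ 2 * (m j ^ 2 * v j)) ≤ 6 / 64 := by
      rw [Finset.sum_add_distrib, ← Finset.mul_sum, ← Finset.mul_sum]
      have a1 : ∑ j, (v j : ℝ) ^ 2 ≤ s ^ 2 := by
        rw [hv2]; exact hcov.trans (by gcongr)
      have a2 : ∑ j, m j ^ 2 * (v j : ℝ) ≤ s ^ 2 := by
        refine le_trans ?_ hmean
        rw [← hm, Finset.sum_mul]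
        exact Finset.sum_le_sum fun j _ => mul_le_mul_of_nonneg_left (hvF j) (sq_nonneg _)
      calc _ ≤ 2 * r ^ 2 * s ^ 2 + 4 * r ^ 2 * s ^ 2 := by gcongr
        _ = 6 / 64 := by rw [hr2]; field_simp; norm_num
    calc _ ≤ Real.exp (6 / 64) := Real.exp_le_exp.2 h2
      _ ≤ Real.exp (Real.log 2) := by
        apply Real.exp_le_exp.2; linarith [Real.log_two_gt_d9]
      _ = 2 := Real.exp_log (by norm_num)
  have hs8 : 0 < 1 / (8 * s) := by positivity
  have hsumeq : ∀ ω, (∑ j, fun ω => Z j ω ^ 2) ω = ∑ i, W i ω ^ 2 := by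
    intro ω; rw [Finset.sum_apply, hsq]
  obtain ⟨i1, b1⟩ := main (1 / (8 * s)) (abs_of_pos hs8)
  obtain ⟨i2, b2⟩ := main (-(1 / (8 * s))) (by rw [abs_neg, abs_of_pos hs8])
  have up := measure_ge_le_exp_mul_mgf (E + t) hs8.le i1
  have lo := measure_le_le_exp_mul_mgf (E - t) (by linarith) i2
  have hsub : {ω | t ≤ |∑ i, W i ω ^ 2 - E|} ⊆
      {ω | E + t ≤ (∑ j, fun ω => Z j ω ^ 2) ω} ∪ {ω | (∑ j, fun ω => Z j ω ^ 2) ω ≤ E - t} := by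
    intro ω hω
    simp only [mem_ofPred_eq, mem_union, hsumeq] at hω ⊢
    rcases le_abs.1 hω with h | h
    · left; linarith
    · right; linarith
  have h3 : ∀ x y : ℝ, Real.exp x * (Real.exp y * 2) = 2 * Real.exp (x + y) := by
    intro x y; rw [Real.exp_add]; ring
  calc _ ≤ P.real _ := measureReal_mono hsub
    _ ≤ P.real _ + P.real _ := measureReal_union_le _ _
    _ ≤ 2 * Real.exp (-(t / (8 * s))) + 2 * Real.exp (-(t / (8 * s))) := by
        refine add_le_add (up.trans ?_) (lo.trans ?_)
        · refine (mul_le_mul_of_nonneg_left b1 (Real.exp_pos _).le).trans (le_of_eq ?_)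
          rw [h3]; congr 2; ring
        · refine (mul_le_mul_of_nonneg_left b2 (Real.exp_pos _).le).trans (le_of_eq ?_)
          rw [h3]; congr 2; ring
    _ = _ := by ring

end Vector

/-! ### The Matérn kernel as a scale mixture of Gaussian kernels -/

lemma integrableOn_rpow_mul_exp_neg_mul {ν c : ℝ} (hν : 0 < ν) (hc : 0 < c) :
    IntegrableOn (fun v : ℝ => v ^ (ν - 1) * Real.exp (-(c * v))) (Ioi 0) := by
  have := integrableOn_rpow_mul_exp_neg_mul_rpow (p := 1) (s := ν - 1) (b := c) (by linarith)
    one_pos hc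
  simpa [neg_mul] using this

lemma integrableOn_matern_mixture {ν κ : ℝ} (hν : 0 < ν) (hκ : 0 < κ) (r : ℝ) :
    IntegrableOn (fun v : ℝ => v ^ (ν - 1) * Real.exp (-(κ ^ 2 * v)) *
      Real.exp (-(r ^ 2 / (4 * v)))) (Ioi 0) := by
  refine (integrableOn_rpow_mul_exp_neg_mul hν (pow_pos hκ 2)).mono' ?_ ?_
  · exact Measurable.aestronglyMeasurable (by fun_prop)
  · filter_upwards [ae_restrict_mem measurableSet_Ioi] with v hv
    have hv : (0 : ℝ) < v := hv
    rw [Real.norm_of_nonneg (by positivity)]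
    refine mul_le_of_le_one_right (by positivity) (Real.exp_le_one_iff.2 ?_)
    have : 0 ≤ r ^ 2 / (4 * v) := by positivity
    linarith

/-- The Matérn kernel is a Gamma mixture of Gaussian kernels; the substitution
`v = (r / 2κ) eᵗ` turns the mixture into the integral which defines `𝒦_ν`. -/
theorem maternK_eq_mixture {ν κ r : ℝ} (hν : 0 < ν) (hκ : 0 < κ) (hr : 0 ≤ r) :
    maternK ν κ r = (Real.Gamma ν)⁻¹ * ∫ v in Ioi (0 : ℝ),
      v ^ (ν - 1) * Real.exp (-(κ ^ 2 * v)) * Real.exp (-(r ^ 2 / (4 * v))) := by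
  have hΓ := Real.Gamma_pos_of_pos hν
  rcases hr.eq_or_lt with rfl | hr
  · simp only [maternK, if_true]
    have h := Real.integral_rpow_mul_exp_neg_mul_Ioi hν (pow_pos hκ 2)
    simp only [ne_eq, OfNat.ofNat_ne_zero, not_false_eq_true, zero_pow, zero_div, neg_zero,
      Real.exp_zero, mul_one]
    rw [h, mul_comm _ (Real.Gamma ν), inv_mul_cancel_left₀ hΓ.ne', one_div, Real.inv_rpow
      (by positivity), ← Real.rpow_natCast, ← Real.rpow_mul hκ.le, ← Real.rpow_neg hκ.le]
    norm_num
  set a : ℝ := r / (2 * κ) with ha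
  have ha0 : 0 < a := by positivity
  set F : ℝ → ℝ := fun v => v ^ (ν - 1) * Real.exp (-(κ ^ 2 * v)) * Real.exp (-(r ^ 2 / (4 * v)))
  set g : ℝ → ℝ := fun t => a ^ ν * (Real.exp (ν * t) * Real.exp (-(κ * r * Real.cosh t))) with hg
  have himg : (fun t : ℝ => a * Real.exp t) '' univ = Ioi 0 := by
    rw [image_univ]
    ext v
    constructor
    · rintro ⟨t, rfl⟩
      exact mul_pos ha0 (Real.exp_pos t)
    · intro (hv : 0 < v)
      exact ⟨Real.log (v / a), by simp only; rw [Real.exp_log (by positivity)]; field_simp⟩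
  have hder : ∀ t ∈ (univ : Set ℝ), HasDerivWithinAt (fun t : ℝ => a * Real.exp t)
      (a * Real.exp t) univ t := fun t _ => ((Real.hasDerivAt_exp t).const_mul a).hasDerivWithinAt
  have hinj : InjOn (fun t : ℝ => a * Real.exp t) univ := fun x _ y _ h =>
    Real.exp_injective (mul_left_cancel₀ ha0.ne' h)
  have hgF : ∀ t, |a * Real.exp t| • F (a * Real.exp t) = g t := by
    intro t
    have he := Real.exp_pos t
    rw [abs_of_pos (by positivity), smul_eq_mul]
    simp only [F, g]
    rw [Real.mul_rpow ha0.le he.le, ← Real.exp_mul, mul_assoc (_ * _) (Real.exp _) (Real.exp _),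
      ← Real.exp_add, Real.rpow_sub_one ha0.ne']
    have h1 : -(κ ^ 2 * (a * Real.exp t)) + -(r ^ 2 / (4 * (a * Real.exp t))) =
        -(κ * r * Real.cosh t) := by
      rw [Real.cosh_eq, Real.exp_neg, ha]; field_simp; ring
    have h2 : Real.exp (t * (ν - 1)) = Real.exp (ν * t) / Real.exp t := by
      rw [← Real.exp_sub]; ring_nf
    rw [h1, h2]
    field_simp
  have hFint : IntegrableOn F (Ioi 0) := integrableOn_matern_mixture hν hκ r
  have hgint : Integrable g := by
    have := (integrableOn_image_iff_integrableOn_abs_deriv_smul MeasurableSet.univ hder hinj F).1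
      (by rw [himg]; exact hFint)
    simpa only [hgF, integrableOn_univ] using this
  have hch : ∫ v in Ioi (0 : ℝ), F v = ∫ t, g t := by
    rw [← himg, integral_image_eq_integral_abs_deriv_smul MeasurableSet.univ hder hinj]
    simp only [hgF, Measure.restrict_univ]
  have hsplit : ∫ t, g t = 2 * a ^ ν * besselK ν (κ * r) := by
    rw [← intervalIntegral.integral_Iic_add_Ioi (b := 0) hgint.integrableOn hgint.integrableOn,
      ← neg_zero, ← integral_comp_neg_Ioi, neg_zero, ← integral_add
        hgint.comp_neg.integrableOn hgint.integrableOn, besselK,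
        ← integral_const_mul]
    refine integral_congr_ae (Filter.Eventually.of_forall fun t => ?_)
    simp only [hg, Real.cosh_neg, Real.cosh_eq (ν * t)]
    rw [mul_neg]
    ring
  rw [hch, hsplit, maternK, if_neg hr.ne', ha]
  have h3 : (2 : ℝ) ^ (1 - ν) * (r / κ) ^ ν = 2 * (r / (2 * κ)) ^ ν := by
    rw [Real.rpow_sub two_pos, Real.rpow_one, show r / (2 * κ) = (r / κ) / 2 by field_simp,
      Real.div_rpow (by positivity) two_pos.le]
    ring
  calc _ = (Real.Gamma ν)⁻¹ * ((2 : ℝ) ^ (1 - ν) * (r / κ) ^ ν * besselK ν (κ * r)) := by ring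
    _ = _ := by rw [h3]

lemma maternK_mul (ν : ℝ) {α h : ℝ} (hα : 0 < α) (hh : 0 < h) {r : ℝ} (hr : 0 ≤ r) :
    maternK ν α (h * r) = h ^ (2 * ν) * maternK ν (α * h) r := by
  unfold maternK
  rcases hr.eq_or_lt with rfl | hr
  · simp only [mul_zero, if_true]
    rw [Real.mul_rpow hα.le hh.le, mul_left_comm, ← Real.rpow_add hh]
    simp
  · rw [if_neg (by positivity), if_neg hr.ne', show h * r / α = h ^ 2 * (r / (α * h)) by
      field_simp, Real.mul_rpow (by positivity) (by positivity), ← Real.rpow_natCast,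
      ← Real.rpow_mul hh.le]
    push_cast
    rw [show α * (h * r) = α * h * r by ring]
    ring

/-! ### Weights annihilating polynomials of low degree -/

/-- The weighted point configuration `(w k, x k)_{k ∈ K}` annihilates every polynomial in `d`
variables of total degree less than `n` (tested on monomials). -/
def Annihilates {κ : Type*} {d : ℕ} (n : ℕ) (K : Finset κ) (w : κ → ℝ) (x : κ → Fin d → ℝ) : Prop :=
  ∀ l : Fin d → ℕ, ∑ j, l j < n → ∑ k ∈ K, w k * ∏ j, x k j ^ l j = 0

section Annihilates

variable {κ : Type*} {d n : ℕ} {K : Finset κ} {w : κ → ℝ} {x : κ → Fin d → ℝ}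

lemma prod_affine_pow_eq_sum (h : ℝ) (b y : Fin d → ℝ) (l : Fin d → ℕ) :
    ∏ j, (h * y j + b j) ^ l j = ∑ a ∈ Fintype.piFinset fun j => Finset.range (l j + 1),
      (∏ j, h ^ a j * b j ^ (l j - a j) * (l j).choose (a j)) * ∏ j, y j ^ a j := by
  simp_rw [add_pow]
  rw [Finset.prod_univ_sum]
  refine Finset.sum_congr rfl fun a _ => ?_
  rw [← Finset.prod_mul_distrib]
  exact Finset.prod_congr rfl fun j _ => by rw [mul_pow]; ring

lemma Annihilates.affine (hx : Annihilates n K w x) (h : ℝ) (b : Fin d → ℝ) :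
    Annihilates n K w (fun k j => h * x k j + b j) := by
  intro l hl
  simp_rw [prod_affine_pow_eq_sum, Finset.mul_sum]
  rw [Finset.sum_comm]
  refine Finset.sum_eq_zero fun a ha => ?_
  have ha' : ∀ j, a j ≤ l j := fun j => by
    have := Fintype.mem_piFinset.1 ha j
    simp at this; omega
  have := hx a (lt_of_le_of_lt (Finset.sum_le_sum fun j _ => ha' j) hl)
  simp_rw [mul_left_comm (w _)]
  rw [← Finset.mul_sum, this, mul_zero]

lemma Annihilates.sub (hx : Annihilates n K w x) (b : Fin d → ℝ) :
    Annihilates n K w (fun k j => x k j - b j) := by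
  simpa [sub_eq_add_neg] using hx.affine 1 (fun j => - b j)

lemma Annihilates.sum_linear_pow (hx : Annihilates n K w x) (z : Fin d → ℂ) {j : ℕ} (hj : j < n) :
    ∑ k ∈ K, (w k : ℂ) * (∑ i, z i * x k i) ^ j = 0 := by
  simp_rw [Finset.sum_pow_eq_sum_piAntidiag, Finset.mul_sum]
  rw [Finset.sum_comm]
  refine Finset.sum_eq_zero fun a ha => ?_
  have hs : ∑ i, a i = j := (Finset.mem_piAntidiag.1 ha).1
  have := hx a (hs ▸ hj)
  have h2 : ∑ k ∈ K, (w k : ℂ) * ∏ i, (x k i : ℂ) ^ a i = 0 := by exact_mod_cast this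
  simp_rw [mul_pow, Finset.prod_mul_distrib, mul_left_comm (w _ : ℂ)]
  rw [← Finset.mul_sum, ← Finset.mul_sum, h2, mul_zero, mul_zero]

end Annihilates

/-! ### Double differences of the Gaussian kernel -/

/-- Taylor remainder of the complex exponential, with the growth `exp (Re z)⁺` instead of
`exp ‖z‖`. -/
lemma norm_exp_sub_sum_le_exp_re (n : ℕ) (z : ℂ) :
    ‖Complex.exp z - ∑ j ∈ Finset.range n, z ^ j / (j.factorial : ℂ)‖ ≤
      ‖z‖ ^ n * Real.exp (max 0 z.re) := by
  induction n generalizing z with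
  | zero => simp [Complex.norm_exp]
  | succ n ih =>
    let f : ℝ → ℂ := fun t => Complex.exp (t * z) -
      ∑ j ∈ Finset.range (n + 1), (t * z) ^ j / (j.factorial : ℂ)
    let f' : ℝ → ℂ := fun t => z * (Complex.exp (t * z) -
      ∑ j ∈ Finset.range n, (t * z) ^ j / (j.factorial : ℂ))
    have hf : ∀ t : ℝ, HasDerivAt f (f' t) t := by
      intro t
      have hlin : HasDerivAt (fun t : ℝ => (t : ℂ) * z) z t := by
        simpa using (Complex.ofRealCLM.hasDerivAt (x := t)).mul_const z
      have he : HasDerivAt (fun t : ℝ => Complex.exp (t * z)) (Complex.exp (t * z) * z) t :=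
        hlin.cexp
      have hs : HasDerivAt (fun t : ℝ => ∑ j ∈ Finset.range (n + 1),
          (t * z) ^ j / (j.factorial : ℂ))
          (∑ j ∈ Finset.range n, z * ((t * z) ^ j / (j.factorial : ℂ))) t := by
        simp only [Finset.sum_range_succ']
        have := HasDerivAt.fun_sum (u := Finset.range n)
          (A := fun j (t : ℝ) => (t * z) ^ (j + 1) / ((j + 1).factorial : ℂ))
          (A' := fun j => z * ((t * z) ^ j / (j.factorial : ℂ))) (x := t) (fun j _ => by
            have h := (hlin.pow (j + 1)).div_const ((j + 1).factorial : ℂ)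
            refine h.congr_deriv ?_
            have h1 : (j.factorial : ℂ) ≠ 0 := by exact_mod_cast j.factorial_ne_zero
            have h2 : (j + 1 : ℂ) ≠ 0 := by exact_mod_cast j.succ_ne_zero
            rw [Nat.factorial_succ]; push_cast; field_simp)
        simpa using this.add_const (1 : ℂ)
      refine (he.sub hs).congr_deriv ?_
      simp only [f', mul_sub, Finset.mul_sum, mul_comm z (Complex.exp _)]
    have hb : ∀ t ∈ Ico (0 : ℝ) 1, ‖f' t‖ ≤ ‖z‖ ^ (n + 1) * Real.exp (max 0 z.re) := by
      intro t ht
      simp only [f', norm_mul]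
      rw [pow_succ', mul_assoc]
      refine mul_le_mul_of_nonneg_left ((ih _).trans ?_) (norm_nonneg _)
      have h1 : ‖(t : ℂ) * z‖ ≤ ‖z‖ := by
        rw [norm_mul, Complex.norm_real, Real.norm_of_nonneg ht.1]
        exact mul_le_of_le_one_left (norm_nonneg _) ht.2.le
      have h2 : max 0 ((t : ℂ) * z).re ≤ max 0 z.re := by
        rw [Complex.re_ofReal_mul]
        refine max_le (le_max_left _ _) ?_
        rcases le_total 0 z.re with h | h
        · exact le_max_of_le_right (mul_le_of_le_one_left h ht.2.le)
        · exact le_max_of_le_left (mul_nonpos_of_nonneg_of_nonpos ht.1 h)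
      gcongr
    have := norm_image_sub_le_of_norm_deriv_le_segment_01'
      (fun t _ => (hf t).hasDerivWithinAt) hb
    have f0 : f 0 = 0 := by simp [f, Finset.sum_range_succ']
    rw [f0, sub_zero] at this
    simpa [f] using this

section Kernel

variable {κ : Type*} {d n : ℕ} {K : Finset κ} {w w' : κ → ℝ} {x y : κ → Loc d}

lemma Annihilates.norm_sum_exp_le {x : κ → Fin d → ℝ} (hx : Annihilates n K w x) (z : Fin d → ℂ)
    {A ρ : ℝ} (hρ : 0 ≤ ρ) (hA : ∀ k ∈ K, ‖∑ i, z i * x k i‖ ≤ A)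
    (hre : ∀ k ∈ K, (∑ i, z i * x k i).re ≤ ρ) :
    ‖∑ k ∈ K, (w k : ℂ) * Complex.exp (∑ i, z i * x k i)‖ ≤
      (∑ k ∈ K, |w k|) * (A ^ n * Real.exp ρ) := by
  have : ∑ k ∈ K, (w k : ℂ) * Complex.exp (∑ i, z i * x k i) =
      ∑ k ∈ K, (w k : ℂ) * (Complex.exp (∑ i, z i * x k i) -
        ∑ j ∈ Finset.range n, (∑ i, z i * x k i) ^ j / (j.factorial : ℂ)) := by
    simp_rw [mul_sub, Finset.sum_sub_distrib, Finset.mul_sum]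
    rw [Finset.sum_comm, Finset.sum_eq_zero (s := Finset.range n), sub_zero]
    intro j hj
    have := hx.sum_linear_pow z (Finset.mem_range.1 hj)
    simp_rw [← mul_div_assoc]
    rw [← Finset.sum_div, this, zero_div]
  rw [this, Finset.sum_mul]
  refine (norm_sum_le _ _).trans (Finset.sum_le_sum fun k hk => ?_)
  rw [norm_mul, Complex.norm_real, Real.norm_eq_abs]
  refine mul_le_mul_of_nonneg_left ((norm_exp_sub_sum_le_exp_re n _).trans ?_) (abs_nonneg _)
  have := hA k hk
  have hA0 : 0 ≤ A := (norm_nonneg _).trans this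
  gcongr
  exact max_le hρ (hre k hk)

/-- The double difference `∑ₖ ∑ₖ' wₖ w'ₖ' exp (-‖xₖ - yₖ'‖² / 4v)` of a Gaussian kernel. -/
def gaussDiff (K : Finset κ) (w w' : κ → ℝ) (x y : κ → Loc d) (v : ℝ) : ℝ :=
  ∑ k ∈ K, ∑ k' ∈ K, w k * w' k' * Real.exp (-(‖x k - y k'‖ ^ 2 / (4 * v)))

lemma integral_cexp_inner_stdGaussian (t : Loc d) :
    ∫ Z, Complex.exp ((inner ℝ Z t : ℝ) * Complex.I) ∂(stdGaussian (Loc d)) =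
      Real.exp (-(‖t‖ ^ 2 / 2)) := by
  rw [← charFun_apply, charFun_stdGaussian]
  push_cast
  congr 1
  ring

/-- The complex frequency `-x₀ / 2v + i Z / √(2v)`; shifting the contour by `-x₀ / 2v` extracts the
Gaussian decay `exp (-‖x₀‖² / 4v)` from the Fourier representation of the Gaussian kernel. -/
def shiftedFreq (x₀ Z : Loc d) (v : ℝ) (i : Fin d) : ℂ :=
  -(x₀ i / (2 * v) : ℝ) + (Z i / √(2 * v) : ℝ) * Complex.I

lemma sum_shiftedFreq (x₀ Z a : Loc d) (v : ℝ) :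
    ∑ i, shiftedFreq x₀ Z v i * (a i : ℂ) =
      -((inner ℝ x₀ a / (2 * v) : ℝ) : ℂ) + ((inner ℝ Z a / √(2 * v) : ℝ) : ℂ) * Complex.I := by
  simp only [shiftedFreq, PiLp.inner_apply, RCLike.inner_apply, conj_trivial, Finset.sum_div,
    Complex.ofReal_sum, Finset.sum_mul, ← Finset.sum_neg_distrib, ← Finset.sum_add_distrib]
  refine Finset.sum_congr rfl fun i _ => ?_
  push_cast
  ring

lemma exp_neg_sq_eq_integral (x₀ a b : Loc d) {v : ℝ} (hv : 0 < v) :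
    ((Real.exp (-(‖x₀ + a - b‖ ^ 2 / (4 * v))) : ℝ) : ℂ) =
      Real.exp (-(‖x₀‖ ^ 2 / (4 * v))) * ∫ Z, Complex.exp (∑ i, shiftedFreq x₀ Z v i * (a i : ℂ)) *
        Complex.exp (∑ i, -shiftedFreq x₀ Z v i * (b i : ℂ)) ∂(stdGaussian (Loc d)) := by
  have hs : 0 < √(2 * v) := Real.sqrt_pos.2 (by positivity)
  have h1 : ∀ Z : Loc d, Complex.exp (∑ i, shiftedFreq x₀ Z v i * (a i : ℂ)) *
      Complex.exp (∑ i, -shiftedFreq x₀ Z v i * (b i : ℂ)) =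
      (Real.exp (-(inner ℝ x₀ (a - b) / (2 * v))) : ℝ) *
        Complex.exp ((inner ℝ Z ((√(2 * v))⁻¹ • (a - b)) : ℝ) * Complex.I) := by
    intro Z
    simp only [neg_mul, Finset.sum_neg_distrib, sum_shiftedFreq, Complex.ofReal_exp]
    rw [← Complex.exp_add, ← Complex.exp_add, inner_smul_right, inner_sub_right, inner_sub_right]
    congr 1
    push_cast
    ring
  simp_rw [h1]
  rw [integral_const_mul, integral_cexp_inner_stdGaussian]
  norm_cast
  rw [← Real.exp_add, ← Real.exp_add]
  congr 1
  rw [add_sub_assoc, norm_add_sq_real, norm_smul, mul_pow, norm_inv, inv_pow, Real.norm_of_nonneg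
    hs.le, Real.sq_sqrt (by positivity)]
  field_simp
  ring

/-- `∫ ‖Z‖^(2n)` for a standard Gaussian vector. -/
def gaussMoment (d n : ℕ) : ℝ := ∫ Z : Loc d, ‖Z‖ ^ (2 * n) ∂(stdGaussian (Loc d))

lemma gaussMoment_nonneg (d n : ℕ) : 0 ≤ gaussMoment d n :=
  integral_nonneg fun _ => by positivity

lemma integrable_norm_pow_stdGaussian (d n : ℕ) :
    Integrable (fun Z : Loc d => ‖Z‖ ^ (2 * n)) (stdGaussian (Loc d)) := by
  have := (IsGaussian.memLp_id (stdGaussian (Loc d)) ((2 * n : ℕ) : ENNReal)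
    (ENNReal.natCast_ne_top _))
  exact this.integrable_norm_pow'

/-- Each of the two differences gains a factor `R ‖ζ‖` per order, `ζ` being the shifted
frequency. -/
lemma abs_gaussDiff_le_of_base (hx : Annihilates n K w (fun k => x k))
    (hy : Annihilates n K w' (fun k => y k)) {B R v : ℝ} (hB : ∑ k ∈ K, |w k| ≤ B)
    (hB' : ∑ k ∈ K, |w' k| ≤ B) (hv : 0 < v) (p q : Loc d)
    (hp : ∀ k ∈ K, ‖x k - p‖ ≤ R) (hq : ∀ k ∈ K, ‖y k - q‖ ≤ R) (hR : 0 ≤ R) :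
    |gaussDiff K w w' x y v| ≤ Real.exp (‖p - q‖ * R / v - ‖p - q‖ ^ 2 / (4 * v)) *
      (B ^ 2 * R ^ (2 * n) * (2 ^ (2 * n) * ((‖p - q‖ / (2 * v)) ^ (2 * n) +
        gaussMoment d n / (2 * v) ^ n))) := by
  set x₀ := p - q with hx₀
  have hs : 0 < √(2 * v) := Real.sqrt_pos.2 (by positivity)
  set a : κ → Loc d := fun k => x k - p
  set b : κ → Loc d := fun k => y k - q
  have ha : Annihilates n K w (fun k => a k) := hx.sub p
  have hb : Annihilates n K w' (fun k => b k) := hy.sub q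
  let Φ : Loc d → ℂ := fun Z => ∑ k ∈ K, (w k : ℂ) *
    Complex.exp (∑ i, shiftedFreq x₀ Z v i * (a k i : ℂ))
  let Ψ : Loc d → ℂ := fun Z => ∑ k ∈ K, (w' k : ℂ) *
    Complex.exp (∑ i, -shiftedFreq x₀ Z v i * (b k i : ℂ))
  have hcont : ∀ c : Loc d, Continuous fun Z : Loc d =>
      ∑ i, shiftedFreq x₀ Z v i * (c i : ℂ) := by
    intro c; unfold shiftedFreq; fun_prop
  have hbdd : ∀ c e : Loc d, Integrable (fun Z : Loc d =>
      Complex.exp (∑ i, shiftedFreq x₀ Z v i * (c i : ℂ)) *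
        Complex.exp (∑ i, -shiftedFreq x₀ Z v i * (e i : ℂ))) (stdGaussian (Loc d)) := by
    intro c e
    refine Integrable.of_bound (C := Real.exp (-(inner ℝ x₀ c / (2 * v))) *
      Real.exp (inner ℝ x₀ e / (2 * v))) ?_ (Filter.Eventually.of_forall fun Z => ?_)
    · simp only [neg_mul, Finset.sum_neg_distrib]
      exact Continuous.aestronglyMeasurable
        ((Complex.continuous_exp.comp (hcont c)).mul (Complex.continuous_exp.comp (hcont e).neg))
    · simp only [neg_mul, Finset.sum_neg_distrib, sum_shiftedFreq, norm_mul, Complex.norm_exp,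
        Complex.add_re, Complex.neg_re, Complex.ofReal_re, Complex.mul_re, Complex.I_re,
        Complex.ofReal_im, Complex.I_im, mul_zero, zero_mul, sub_zero, add_zero, neg_neg]
      exact le_rfl
  have key : ((gaussDiff K w w' x y v : ℝ) : ℂ) =
      Real.exp (-(‖x₀‖ ^ 2 / (4 * v))) * ∫ Z, Φ Z * Ψ Z ∂(stdGaussian (Loc d)) := by
    have h1 : ∀ Z, Φ Z * Ψ Z = ∑ k ∈ K, ∑ k' ∈ K, ((w k : ℂ) * w' k') *
        (Complex.exp (∑ i, shiftedFreq x₀ Z v i * (a k i : ℂ)) *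
          Complex.exp (∑ i, -shiftedFreq x₀ Z v i * (b k' i : ℂ))) := by
      intro Z
      simp only [Φ, Ψ, Finset.sum_mul_sum]
      exact Finset.sum_congr rfl fun k _ => Finset.sum_congr rfl fun k' _ => by ring
    simp_rw [h1]
    rw [integral_finsetSum _ fun k _ => integrable_finsetSum _ fun k' _ => (hbdd _ _).const_mul _]
    simp_rw [integral_finsetSum K fun k' _ => (hbdd _ _).const_mul _, integral_const_mul]
    unfold gaussDiff
    rw [Complex.ofReal_sum, Finset.mul_sum]
    refine Finset.sum_congr rfl fun k _ => ?_
    rw [Complex.ofReal_sum, Finset.mul_sum]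
    refine Finset.sum_congr rfl fun k' _ => ?_
    have := exp_neg_sq_eq_integral x₀ (a k) (b k') hv
    rw [show x₀ + a k - b k' = x k - y k' by simp only [hx₀, a, b]; abel] at this
    rw [mul_left_comm, ← this]
    push_cast; ring
  have hA : ∀ (Z c : Loc d), ‖c‖ ≤ R → ‖∑ i, shiftedFreq x₀ Z v i * (c i : ℂ)‖ ≤
      R * (‖x₀‖ / (2 * v) + ‖Z‖ / √(2 * v)) := by
    intro Z c hc
    rw [sum_shiftedFreq]
    refine (norm_add_le _ _).trans ?_
    rw [norm_neg, norm_mul, Complex.norm_I, mul_one, Complex.norm_real, Complex.norm_real, norm_div,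
      norm_div, Real.norm_of_nonneg hs.le, Real.norm_of_nonneg (by positivity : 0 ≤ 2 * v),
      mul_add, mul_div_assoc', mul_div_assoc', mul_comm R, mul_comm R]
    have h1 := (norm_inner_le_norm (𝕜 := ℝ) x₀ c).trans
      (mul_le_mul_of_nonneg_left hc (norm_nonneg x₀))
    have h2 := (norm_inner_le_norm (𝕜 := ℝ) Z c).trans
      (mul_le_mul_of_nonneg_left hc (norm_nonneg Z))
    gcongr
  have hre : ∀ (Z c : Loc d), ‖c‖ ≤ R →
      |(∑ i, shiftedFreq x₀ Z v i * (c i : ℂ)).re| ≤ ‖x₀‖ * R / (2 * v) := by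
    intro Z c hc
    rw [sum_shiftedFreq]
    simp only [Complex.add_re, Complex.neg_re, Complex.ofReal_re, Complex.mul_re, Complex.I_re,
      Complex.ofReal_im, Complex.I_im, mul_zero, zero_mul, sub_zero, add_zero, abs_neg, abs_div]
    rw [abs_of_pos (by positivity : 0 < 2 * v)]
    have h1 := (abs_real_inner_le_norm x₀ c).trans
      (mul_le_mul_of_nonneg_left hc (norm_nonneg x₀))
    gcongr
  have hB0 : 0 ≤ B := (Finset.sum_nonneg fun _ _ => abs_nonneg _).trans hB
  set ρ : ℝ := ‖x₀‖ * R / (2 * v) with hρ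
  have hρ0 : 0 ≤ ρ := by positivity
  have hpt : ∀ Z, ‖Φ Z * Ψ Z‖ ≤ B ^ 2 * R ^ (2 * n) * Real.exp (2 * ρ) * (2 ^ (2 * n) *
      ((‖x₀‖ / (2 * v)) ^ (2 * n) + ‖Z‖ ^ (2 * n) / (2 * v) ^ n)) := by
    intro Z
    have e1 := ha.norm_sum_exp_le (shiftedFreq x₀ Z v) hρ0 (fun k hk => hA Z _ (hp k hk))
      (fun k hk => (abs_le.1 (hre Z _ (hp k hk))).2)
    have e2 := hb.norm_sum_exp_le (fun i => -shiftedFreq x₀ Z v i) hρ0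
      (A := R * (‖x₀‖ / (2 * v) + ‖Z‖ / √(2 * v)))
      (fun k hk => by
        simp only [neg_mul, Finset.sum_neg_distrib, norm_neg]; exact hA Z _ (hq k hk))
      (fun k hk => by
        simp only [neg_mul, Finset.sum_neg_distrib, Complex.neg_re]
        linarith [(abs_le.1 (hre Z _ (hq k hk))).1])
    set A := R * (‖x₀‖ / (2 * v) + ‖Z‖ / √(2 * v)) with hAdef
    have hA0 : 0 ≤ A := by positivity
    rw [norm_mul]
    calc _ ≤ (B * (A ^ n * Real.exp ρ)) * (B * (A ^ n * Real.exp ρ)) := by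
          refine mul_le_mul (e1.trans ?_) (e2.trans ?_) (norm_nonneg _) (by positivity)
          · gcongr
          · gcongr
      _ = B ^ 2 * R ^ (2 * n) * Real.exp (2 * ρ) *
          (‖x₀‖ / (2 * v) + ‖Z‖ / √(2 * v)) ^ (2 * n) := by
          rw [two_mul ρ, Real.exp_add, hAdef, mul_pow, two_mul n, pow_add, pow_add]; ring
      _ ≤ _ := by
          refine mul_le_mul_of_nonneg_left ?_ (by positivity)
          refine (add_pow_le (by positivity) (by positivity) _).trans ?_
          have h3 : (‖Z‖ / √(2 * v)) ^ (2 * n) = ‖Z‖ ^ (2 * n) / (2 * v) ^ n := by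
            rw [div_pow, pow_mul √(2 * v), Real.sq_sqrt (by positivity)]
          rw [h3]
          gcongr
          · norm_num
          · omega
  have hint : Integrable (fun Z : Loc d => B ^ 2 * R ^ (2 * n) * Real.exp (2 * ρ) * (2 ^ (2 * n) *
      ((‖x₀‖ / (2 * v)) ^ (2 * n) + ‖Z‖ ^ (2 * n) / (2 * v) ^ n))) (stdGaussian (Loc d)) :=
    (((integrable_const _).add
      ((integrable_norm_pow_stdGaussian d n).div_const _)).const_mul _).const_mul _
  have hfin := norm_integral_le_of_norm_le hint (Filter.Eventually.of_forall hpt)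
  rw [integral_const_mul, integral_const_mul, integral_add (integrable_const _)
    ((integrable_norm_pow_stdGaussian d n).div_const _), integral_div] at hfin
  simp only [integral_const, probReal_univ, one_smul] at hfin
  have : |gaussDiff K w w' x y v| = ‖((gaussDiff K w w' x y v : ℝ) : ℂ)‖ := by
    rw [Complex.norm_real, Real.norm_eq_abs]
  rw [this, key, norm_mul, Complex.norm_real, Real.norm_of_nonneg (Real.exp_pos _).le]
  refine (mul_le_mul_of_nonneg_left hfin (Real.exp_pos _).le).trans (le_of_eq ?_)
  have : ‖x₀‖ * R / v - ‖x₀‖ ^ 2 / (4 * v) = -(‖x₀‖ ^ 2 / (4 * v)) + 2 * ρ := by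
    rw [hρ]; field_simp; ring
  rw [this, Real.exp_add, gaussMoment]
  ring

lemma abs_gaussDiff_le_sq {B : ℝ} (hB : ∑ k ∈ K, |w k| ≤ B) (hB' : ∑ k ∈ K, |w' k| ≤ B)
    {v : ℝ} (hv : 0 < v) : |gaussDiff K w w' x y v| ≤ B ^ 2 := by
  have h0 : (0 : ℝ) ≤ ∑ k ∈ K, |w' k| := Finset.sum_nonneg fun _ _ => abs_nonneg _
  calc |gaussDiff K w w' x y v| ≤ ∑ k ∈ K, ∑ k' ∈ K, |w k| * |w' k'| := by
        refine (Finset.abs_sum_le_sum_abs _ _).trans (Finset.sum_le_sum fun k _ => ?_)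
        refine (Finset.abs_sum_le_sum_abs _ _).trans (Finset.sum_le_sum fun k' _ => ?_)
        rw [abs_mul, abs_mul, abs_of_pos (Real.exp_pos _)]
        refine mul_le_of_le_one_right (by positivity) (Real.exp_le_one_iff.2 ?_)
        have : 0 ≤ ‖x k - y k'‖ ^ 2 / (4 * v) := by positivity
        linarith
    _ = (∑ k ∈ K, |w k|) * ∑ k' ∈ K, |w' k'| := (Finset.sum_mul_sum _ _ _ _).symm
    _ ≤ B * B := mul_le_mul hB hB' h0 (h0.trans hB')
    _ = B ^ 2 := (sq B).symm

/-- Two configurations near a common point: polynomial decay in the scale `v`. -/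
lemma exists_abs_gaussDiff_le_near (d n : ℕ) (B R : ℝ) (hR : 0 ≤ R) :
    ∃ C : ℝ, 0 < C ∧ ∀ (K : Finset κ) (w w' : κ → ℝ) (x y : κ → Loc d) (p : Loc d),
      Annihilates n K w (fun k => x k) → Annihilates n K w' (fun k => y k) →
      ∑ k ∈ K, |w k| ≤ B → ∑ k ∈ K, |w' k| ≤ B →
      (∀ k ∈ K, ‖x k - p‖ ≤ R) → (∀ k ∈ K, ‖y k - p‖ ≤ R) → ∀ v : ℝ, 0 < v →
      |gaussDiff K w w' x y v| ≤ C * min 1 (v ^ (-(n : ℝ))) := by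
  have hm := gaussMoment_nonneg d n
  refine ⟨B ^ 2 + B ^ 2 * R ^ (2 * n) * (2 ^ (2 * n) * (1 + gaussMoment d n)) + 1, by positivity,
    fun K w w' x y p hx hy hB hB' hp hq v hv => ?_⟩
  have hvn : v ^ (-(n : ℝ)) = (v ^ n)⁻¹ := by rw [Real.rpow_neg hv.le, Real.rpow_natCast]
  rcases le_total 1 (v ^ (-(n : ℝ))) with h | h
  · rw [min_eq_left h, mul_one]
    have h0 : 0 ≤ B ^ 2 * R ^ (2 * n) * (2 ^ (2 * n) * (1 + gaussMoment d n)) := by positivity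
    linarith [abs_gaussDiff_le_sq (x := x) (y := y) hB hB' hv]
  · rw [min_eq_right h, hvn]
    rcases Nat.eq_zero_or_pos n with hn | hn
    · subst hn
      have := abs_gaussDiff_le_sq (x := x) (y := y) hB hB' hv
      simp only [pow_zero, inv_one, mul_one, mul_zero]
      nlinarith [mul_nonneg (sq_nonneg B) hm, sq_nonneg B]
    · have := abs_gaussDiff_le_of_base hx hy hB hB' hv p p hp hq hR
      rw [sub_self, norm_zero, zero_mul, zero_div, zero_div, zero_pow (by omega),
        zero_pow (by omega), zero_div, sub_zero, Real.exp_zero, one_mul, zero_add] at this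
      refine this.trans ?_
      rw [mul_pow, ← div_eq_mul_inv]
      have h2 : gaussMoment d n / (2 ^ n * v ^ n) ≤ (1 + gaussMoment d n) / v ^ n := by
        rw [div_le_div_iff₀ (by positivity) (by positivity)]
        have : (1 : ℝ) ≤ 2 ^ n := one_le_pow₀ (by norm_num)
        have hvn0 : 0 < v ^ n := by positivity
        nlinarith [mul_le_mul_of_nonneg_right (mul_le_mul_of_nonneg_left this
          (by positivity : 0 ≤ 1 + gaussMoment d n)) hvn0.le]
      calc _ ≤ B ^ 2 * R ^ (2 * n) * (2 ^ (2 * n) * ((1 + gaussMoment d n) / v ^ n)) := by gcongr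
        _ = (B ^ 2 * R ^ (2 * n) * (2 ^ (2 * n) * (1 + gaussMoment d n))) / v ^ n := by ring
        _ ≤ _ := by gcongr; nlinarith [sq_nonneg B]

lemma pow_le_const_mul_exp (n : ℕ) {T : ℝ} (hT : 0 ≤ T) :
    T ^ n ≤ 16 ^ n * n.factorial * Real.exp (T / 16) := by
  have := Real.pow_div_factorial_le_exp (T / 16) (by positivity) n
  rw [div_le_iff₀ (by positivity), div_pow, div_le_iff₀ (by positivity)] at this
  linarith

/-- Two configurations at distance much larger than their diameter: Gaussian decay in the
distance. -/
lemma exists_abs_gaussDiff_le_far (d n : ℕ) (B R : ℝ) (hR : 0 ≤ R) :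
    ∃ C : ℝ, 0 < C ∧ ∀ (K : Finset κ) (w w' : κ → ℝ) (x y : κ → Loc d) (p q : Loc d),
      Annihilates n K w (fun k => x k) → Annihilates n K w' (fun k => y k) →
      ∑ k ∈ K, |w k| ≤ B → ∑ k ∈ K, |w' k| ≤ B →
      (∀ k ∈ K, ‖x k - p‖ ≤ R) → (∀ k ∈ K, ‖y k - q‖ ≤ R) → 8 * R ≤ ‖p - q‖ →
      ∀ v : ℝ, 0 < v →
      |gaussDiff K w w' x y v| ≤ C * (v ^ (-(n : ℝ)) * Real.exp (-(‖p - q‖ ^ 2 / 16 / v))) := by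
  have hm := gaussMoment_nonneg d n
  set M : ℝ := 16 ^ n * n.factorial with hM
  have hM0 : 0 < M := by positivity
  refine ⟨B ^ 2 * R ^ (2 * n) * 2 ^ (2 * n) * (M + gaussMoment d n) + 1, by positivity,
    fun K w w' x y p q hx hy hB hB' hp hq hpq v hv => ?_⟩
  have hvn : v ^ (-(n : ℝ)) = (v ^ n)⁻¹ := by rw [Real.rpow_neg hv.le, Real.rpow_natCast]
  have hb := abs_gaussDiff_le_of_base hx hy hB hB' hv p q hp hq hR
  set r := ‖p - q‖ with hr
  have hr0 : 0 ≤ r := norm_nonneg _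
  set T := r ^ 2 / v with hT
  have hT0 : 0 ≤ T := by positivity
  have e1 : r * R / v - r ^ 2 / (4 * v) ≤ -(T / 8) := by
    have : r * R / v ≤ r ^ 2 / 8 / v := by
      gcongr; nlinarith
    calc r * R / v - r ^ 2 / (4 * v) ≤ r ^ 2 / 8 / v - r ^ 2 / (4 * v) := by linarith
      _ = _ := by rw [hT]; field_simp; ring
  have e2 : (r / (2 * v)) ^ (2 * n) + gaussMoment d n / (2 * v) ^ n ≤
      (M + gaussMoment d n) * Real.exp (T / 16) / v ^ n := by
    have h1 : (r / (2 * v)) ^ (2 * n) = T ^ n / 4 ^ n / v ^ n := by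
      rw [pow_mul, hT, ← div_pow, ← div_pow]; congr 1; field_simp; ring
    have h2 : T ^ n / 4 ^ n ≤ M * Real.exp (T / 16) := by
      refine (div_le_self (by positivity) (one_le_pow₀ (by norm_num))).trans ?_
      exact pow_le_const_mul_exp n hT0
    have h3 : gaussMoment d n / (2 * v) ^ n ≤ gaussMoment d n * Real.exp (T / 16) / v ^ n := by
      rw [mul_pow, ← div_div]
      have : (1 : ℝ) ≤ Real.exp (T / 16) := Real.one_le_exp (by positivity)
      gcongr
      calc gaussMoment d n / 2 ^ n ≤ gaussMoment d n :=
            div_le_self hm (one_le_pow₀ (by norm_num))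
        _ ≤ _ := le_mul_of_one_le_right hm this
    rw [h1, add_mul, add_div]
    refine add_le_add ?_ h3
    gcongr
  have e3 : Real.exp (-(T / 8)) * Real.exp (T / 16) = Real.exp (-(r ^ 2 / 16 / v)) := by
    rw [← Real.exp_add]; congr 1; rw [hT]; field_simp; norm_num
  calc _ ≤ Real.exp (-(T / 8)) * (B ^ 2 * R ^ (2 * n) * (2 ^ (2 * n) *
        ((M + gaussMoment d n) * Real.exp (T / 16) / v ^ n))) := by
        refine hb.trans ?_; gcongr
    _ = (B ^ 2 * R ^ (2 * n) * 2 ^ (2 * n) * (M + gaussMoment d n)) *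
        ((v ^ n)⁻¹ * (Real.exp (-(T / 8)) * Real.exp (T / 16))) := by
        rw [div_eq_mul_inv]; ring
    _ ≤ _ := by
        rw [e3, hvn]
        gcongr
        linarith

end Kernel

/-! ### Double differences of the Matérn kernel -/

lemma integrableOn_rpow_mul_min {ν n : ℝ} (hν : 0 < ν) (hn : ν < n) :
    IntegrableOn (fun v : ℝ => v ^ (ν - 1) * min 1 (v ^ (-n))) (Ioi 0) := by
  have hmeas : Measurable fun v : ℝ => v ^ (ν - 1) * min 1 (v ^ (-n)) := by fun_prop
  rw [← Ioc_union_Ioi_eq_Ioi zero_le_one]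
  refine IntegrableOn.union ?_ ?_
  · have h : IntegrableOn (fun v : ℝ => v ^ (ν - 1)) (Ioc 0 1) := by
      rw [integrableOn_Ioc_iff_integrableOn_Ioo, intervalIntegral.integrableOn_Ioo_rpow_iff one_pos]
      linarith
    refine h.mono' hmeas.aestronglyMeasurable ?_
    filter_upwards [ae_restrict_mem measurableSet_Ioc] with v hv
    have hv0 : 0 < v := hv.1
    rw [Real.norm_of_nonneg (by positivity)]
    exact mul_le_of_le_one_right (by positivity) (min_le_left _ _)
  · refine (integrableOn_Ioi_rpow_of_lt (a := ν - 1 - n) (by linarith) one_pos).mono'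
      hmeas.aestronglyMeasurable ?_
    filter_upwards [ae_restrict_mem measurableSet_Ioi] with v hv
    have hv0 : (0 : ℝ) < v := lt_trans one_pos hv
    rw [Real.norm_of_nonneg (by positivity), sub_eq_add_neg (ν - 1), Real.rpow_add hv0]
    gcongr
    exact min_le_right _ _

/-- The inverse Gamma integral. -/
lemma integral_rpow_mul_exp_neg_div {s a : ℝ} (hs : 0 < s) (ha : 0 < a) :
    IntegrableOn (fun v : ℝ => v ^ (-s - 1) * Real.exp (-(a / v))) (Ioi 0) ∧
    ∫ v in Ioi (0 : ℝ), v ^ (-s - 1) * Real.exp (-(a / v)) = (1 / a) ^ s * Real.Gamma s := by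
  have hg : IntegrableOn (fun y : ℝ => y ^ (s - 1) * Real.exp (-(a * y))) (Ioi 0) :=
    integrableOn_rpow_mul_exp_neg_mul hs ha
  have hcongr : ∀ x ∈ Ioi (0 : ℝ), (|(-1 : ℝ)| * x ^ ((-1 : ℝ) - 1)) •
      ((x ^ (-1 : ℝ)) ^ (s - 1) * Real.exp (-(a * x ^ (-1 : ℝ)))) =
      x ^ (-s - 1) * Real.exp (-(a / x)) := by
    intro x (hx : 0 < x)
    rw [abs_neg, abs_one, one_mul, smul_eq_mul, ← mul_assoc, ← Real.rpow_mul hx.le,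
      ← Real.rpow_add hx, Real.rpow_neg_one, div_eq_mul_inv]
    ring_nf
  constructor
  · have := (integrableOn_Ioi_comp_rpow_iff (fun y : ℝ => y ^ (s - 1) * Real.exp (-(a * y)))
      (p := -1) (by norm_num)).2 hg
    exact this.congr_fun hcongr measurableSet_Ioi
  · rw [← Real.integral_rpow_mul_exp_neg_mul_Ioi hs ha,
      ← integral_comp_rpow_Ioi (fun y : ℝ => y ^ (s - 1) * Real.exp (-(a * y)))
        (p := -1) (by norm_num)]
    exact (setIntegral_congr_fun measurableSet_Ioi hcongr).symm

section Matern

variable {κ : Type*} {d n : ℕ}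

/-- The double difference `∑ₖ ∑ₖ' wₖ w'ₖ' K_{α,ν}(‖xₖ - yₖ'‖)` of the Matérn kernel. -/
def maternDiff (ν α : ℝ) (K : Finset κ) (w w' : κ → ℝ) (x y : κ → Loc d) : ℝ :=
  ∑ k ∈ K, ∑ k' ∈ K, w k * w' k' * maternK ν α ‖x k - y k'‖

/-- The double difference of the mixture at mixing rate `α`; `α = 0` is allowed. -/
def mixtureDiff (ν α : ℝ) (K : Finset κ) (w w' : κ → ℝ) (x y : κ → Loc d) : ℝ :=
  (Real.Gamma ν)⁻¹ * ∫ v in Ioi (0 : ℝ),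
    v ^ (ν - 1) * Real.exp (-(α ^ 2 * v)) * gaussDiff K w w' x y v

lemma maternDiff_eq_mixtureDiff {ν α : ℝ} (hν : 0 < ν) (hα : 0 < α) (K : Finset κ)
    (w w' : κ → ℝ) (x y : κ → Loc d) :
    maternDiff ν α K w w' x y = mixtureDiff ν α K w w' x y := by
  unfold maternDiff mixtureDiff gaussDiff
  have hint := fun r => integrableOn_matern_mixture hν hα r
  have : ∀ v : ℝ, v ^ (ν - 1) * Real.exp (-(α ^ 2 * v)) * ∑ k ∈ K, ∑ k' ∈ K, w k * w' k' *
      Real.exp (-(‖x k - y k'‖ ^ 2 / (4 * v))) = ∑ k ∈ K, ∑ k' ∈ K, w k * w' k' *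
      (v ^ (ν - 1) * Real.exp (-(α ^ 2 * v)) * Real.exp (-(‖x k - y k'‖ ^ 2 / (4 * v)))) := by
    intro v
    simp_rw [Finset.mul_sum]
    exact Finset.sum_congr rfl fun k _ => Finset.sum_congr rfl fun k' _ => by ring
  simp_rw [this]
  rw [integral_finsetSum _ fun k _ => integrable_finsetSum _ fun k' _ => (hint _).const_mul _,
    Finset.mul_sum]
  refine Finset.sum_congr rfl fun k _ => ?_
  rw [integral_finsetSum _ fun k' _ => (hint _).const_mul _, Finset.mul_sum]
  refine Finset.sum_congr rfl fun k' _ => ?_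
  rw [integral_const_mul, maternK_eq_mixture hν hα (norm_nonneg _)]
  ring

lemma measurable_gaussDiff (K : Finset κ) (w w' : κ → ℝ) (x y : κ → Loc d) :
    Measurable (gaussDiff K w w' x y) := by
  unfold gaussDiff; fun_prop

lemma abs_mixtureDiff_le {ν α : ℝ} (hν : 0 < ν) {K : Finset κ} {w w' : κ → ℝ}
    {x y : κ → Loc d} {g : ℝ → ℝ} (hg : IntegrableOn (fun v => v ^ (ν - 1) * g v) (Ioi 0))
    (hle : ∀ v, 0 < v → |gaussDiff K w w' x y v| ≤ g v) :
    |mixtureDiff ν α K w w' x y| ≤ (Real.Gamma ν)⁻¹ * ∫ v in Ioi (0 : ℝ), v ^ (ν - 1) * g v := by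
  have hΓ := Real.Gamma_pos_of_pos hν
  rw [mixtureDiff, abs_mul, abs_of_pos (inv_pos.2 hΓ)]
  refine mul_le_mul_of_nonneg_left ?_ (inv_pos.2 hΓ).le
  refine norm_integral_le_of_norm_le (f := fun v : ℝ => v ^ (ν - 1) * Real.exp (-(α ^ 2 * v)) *
    gaussDiff K w w' x y v) hg ?_
  filter_upwards [ae_restrict_mem measurableSet_Ioi] with v hv
  have hv : 0 < v := hv
  rw [norm_mul, norm_mul, Real.norm_of_nonneg (by positivity : 0 ≤ v ^ (ν - 1)),
    Real.norm_of_nonneg (Real.exp_pos _).le, mul_assoc]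
  refine mul_le_mul_of_nonneg_left ?_ (by positivity)
  refine (mul_le_of_le_one_left (norm_nonneg _) (Real.exp_le_one_iff.2 ?_)).trans (hle v hv)
  have : 0 ≤ α ^ 2 * v := by positivity
  linarith

/-- The double differences of the Matérn kernel decay at least like the distance to the power
`-d`, uniformly in the inverse range parameter. The bound is stated in the weaker form of a
product over the coordinates, whose square is summable one coordinate at a time. -/
theorem exists_abs_maternDiff_le {ν : ℝ} (hν : 0 < ν) (hn : ν + (d : ℝ) / 2 ≤ n) (hd : 0 < d)
    (B R : ℝ) (hR : 1 ≤ R) :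
    ∃ C : ℝ, 0 < C ∧ ∀ (α : ℝ), 0 < α → ∀ (K : Finset κ) (w w' : κ → ℝ) (x y : κ → Loc d)
      (p q : Loc d), Annihilates n K w (fun k => x k) → Annihilates n K w' (fun k => y k) →
      ∑ k ∈ K, |w k| ≤ B → ∑ k ∈ K, |w' k| ≤ B →
      (∀ k ∈ K, ‖x k - p‖ ≤ R) → (∀ k ∈ K, ‖y k - q‖ ≤ R) →
      |maternDiff ν α K w w' x y| ≤ C * ∏ j, (1 + |p j - q j|)⁻¹ := by
  have hΓ := Real.Gamma_pos_of_pos hν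
  have hd' : (0 : ℝ) < d := by exact_mod_cast hd
  have hνn : ν < n := by linarith
  obtain ⟨C₁, hC₁, h₁⟩ := exists_abs_gaussDiff_le_near (κ := κ) d n B (9 * R) (by linarith)
  obtain ⟨C₂, hC₂, h₂⟩ := exists_abs_gaussDiff_le_far (κ := κ) d n B R (by linarith)
  set I₁ := ∫ v in Ioi (0 : ℝ), v ^ (ν - 1) * min 1 (v ^ (-(n : ℝ))) with hI₁
  have hI₁0 : 0 ≤ I₁ := setIntegral_nonneg measurableSet_Ioi fun v hv => by
    have : (0 : ℝ) < v := hv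
    positivity
  set A₁ := (Real.Gamma ν)⁻¹ * (C₁ * I₁) with hA₁
  set A₂ := (Real.Gamma ν)⁻¹ * (C₂ * (16 ^ ((n : ℝ) - ν) * Real.Gamma (n - ν))) with hA₂
  have hΓ2 := Real.Gamma_pos_of_pos (s := n - ν) (by linarith)
  have hA₁0 : 0 ≤ A₁ := by positivity
  have hA₂0 : 0 ≤ A₂ := by positivity
  refine ⟨A₁ * (1 + 8 * R) ^ d + A₂ * 2 ^ d + 1, by positivity,
    fun α hα K w w' x y p q hx hy hB hB' hp hq => ?_⟩
  rw [maternDiff_eq_mixtureDiff hν hα]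
  set r := ‖p - q‖ with hr
  have hr0 : 0 ≤ r := norm_nonneg _
  have hprod : ((1 + r) ^ d)⁻¹ ≤ ∏ j, (1 + |p j - q j|)⁻¹ := by
    calc ((1 + r) ^ d)⁻¹ = ∏ _j : Fin d, (1 + r)⁻¹ := by simp
      _ ≤ _ := by
        refine Finset.prod_le_prod (fun _ _ => by positivity) fun j _ => ?_
        have : |p j - q j| ≤ r := by
          have := PiLp.norm_apply_le (p - q) j
          simpa using this
        gcongr
  have hprod0 : 0 ≤ ∏ j, (1 + |p j - q j|)⁻¹ := Finset.prod_nonneg fun j _ => by positivity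
  -- Close configurations only need integrability in `v`. For distant ones the Gaussian factor
  -- yields `r ^ (-2 (n - ν))`, which is at most `r ^ (-d)` because `ν + d / 2 ≤ n`.
  rcases lt_or_ge r (8 * R) with hlt | hge
  · have hq' : ∀ k ∈ K, ‖y k - p‖ ≤ 9 * R := fun k hk => by
      have h1 := norm_sub_le_norm_sub_add_norm_sub (y k) q p
      rw [norm_sub_rev q p] at h1
      linarith [hq k hk]
    have hint := integrableOn_rpow_mul_min hν hνn
    have hb := abs_mixtureDiff_le (α := α) hν (K := K) (w := w) (w' := w') (x := x) (y := y)
      (g := fun v => C₁ * min 1 (v ^ (-(n : ℝ))))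
      (by simpa only [mul_left_comm, IntegrableOn] using hint.const_mul C₁)
      (fun v hv => h₁ K w w' x y p hx hy hB hB' (fun k hk => (hp k hk).trans (by linarith))
        hq' v hv)
    simp_rw [mul_left_comm _ C₁] at hb
    rw [integral_const_mul] at hb
    calc _ ≤ A₁ * 1 := by rw [mul_one]; exact hb
      _ ≤ A₁ * ((1 + 8 * R) ^ d * ((1 + r) ^ d)⁻¹) := by
          refine mul_le_mul_of_nonneg_left ?_ hA₁0
          rw [← div_eq_mul_inv, one_le_div (by positivity)]
          gcongr
      _ = (A₁ * (1 + 8 * R) ^ d) * ((1 + r) ^ d)⁻¹ := by ring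
      _ ≤ (A₁ * (1 + 8 * R) ^ d + A₂ * 2 ^ d + 1) * ∏ j, (1 + |p j - q j|)⁻¹ := by
          gcongr
          have : 0 ≤ A₂ * 2 ^ d := by positivity
          linarith
  · have hr1 : 1 ≤ r := by linarith
    have hr00 : 0 < r := by linarith
    obtain ⟨hint, hval⟩ := integral_rpow_mul_exp_neg_div (s := n - ν) (a := r ^ 2 / 16)
      (by linarith) (by positivity)
    have hco : ∀ v ∈ Ioi (0 : ℝ), v ^ (-((n : ℝ) - ν) - 1) * Real.exp (-(r ^ 2 / 16 / v)) =
        v ^ (ν - 1) * (v ^ (-(n : ℝ)) * Real.exp (-(r ^ 2 / 16 / v))) := by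
      intro v (hv : 0 < v)
      rw [← mul_assoc, ← Real.rpow_add hv]; ring_nf
    have hint' := hint.congr_fun hco measurableSet_Ioi
    rw [setIntegral_congr_fun measurableSet_Ioi hco] at hval
    have hb := abs_mixtureDiff_le (α := α) hν (K := K) (w := w) (w' := w') (x := x) (y := y)
      (g := fun v => C₂ * (v ^ (-(n : ℝ)) * Real.exp (-(r ^ 2 / 16 / v))))
      (by simpa only [mul_left_comm _ C₂, IntegrableOn] using hint'.const_mul C₂)
      (fun v hv => h₂ K w w' x y p q hx hy hB hB' hp hq hge v hv)
    simp_rw [mul_left_comm _ C₂] at hb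
    rw [integral_const_mul, hval] at hb
    have hpow : (1 / (r ^ 2 / 16)) ^ ((n : ℝ) - ν) ≤ 16 ^ ((n : ℝ) - ν) * (r ^ d)⁻¹ := by
      rw [one_div_div, Real.div_rpow (by norm_num) (by positivity), div_eq_mul_inv]
      refine mul_le_mul_of_nonneg_left ?_ (by positivity)
      gcongr
      rw [← Real.rpow_natCast r 2, ← Real.rpow_mul hr0, ← Real.rpow_natCast r d]
      refine Real.rpow_le_rpow_of_exponent_le hr1 ?_
      push_cast; linarith
    calc _ ≤ (Real.Gamma ν)⁻¹ * (C₂ * (16 ^ ((n : ℝ) - ν) * (r ^ d)⁻¹ * Real.Gamma (n - ν))) := by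
          refine hb.trans ?_; gcongr
      _ = A₂ * (r ^ d)⁻¹ := by rw [hA₂]; ring
      _ ≤ A₂ * (2 ^ d * ((1 + r) ^ d)⁻¹) := by
          refine mul_le_mul_of_nonneg_left ?_ hA₂0
          rw [← div_eq_mul_inv, inv_le_comm₀ (by positivity) (by positivity), inv_div, ← div_pow]
          gcongr
          linarith
      _ = (A₂ * 2 ^ d) * ((1 + r) ^ d)⁻¹ := by ring
      _ ≤ (A₁ * (1 + 8 * R) ^ d + A₂ * 2 ^ d + 1) * ∏ j, (1 + |p j - q j|)⁻¹ := by
          gcongr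
          have : 0 ≤ A₁ * (1 + 8 * R) ^ d := by positivity
          linarith

/-- Joint continuity of the double difference at a configuration `(c, z)` and at
inverse range parameter `0`, along annihilating configurations. -/
theorem exists_abs_maternDiff_sub_lt {ν : ℝ} (hν : 0 < ν) (hn : ν < n) (K : Finset κ)
    (c : κ → ℝ) (z : κ → Loc d) {ε : ℝ} (hε : 0 < ε) :
    ∃ η : ℝ, 0 < η ∧ ∀ (α : ℝ) (w w' : κ → ℝ) (x y : κ → Loc d),
      Annihilates n K w (fun k => x k) → Annihilates n K w' (fun k => y k) → 0 < α → α < η →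
      (∀ k ∈ K, |w k - c k| < η) → (∀ k ∈ K, |w' k - c k| < η) →
      (∀ k ∈ K, ‖x k - z k‖ < η) → (∀ k ∈ K, ‖y k - z k‖ < η) →
      |maternDiff ν α K w w' x y - mixtureDiff ν 0 K c c z z| < ε := by
  -- Otherwise some sequence of configurations with `η → 0` stays `ε` away from the limit, which
  -- contradicts dominated convergence in the mixture.
  by_contra! hcon
  have hpos : ∀ N : ℕ, (0 : ℝ) < 1 / (N + 1) := fun N => by positivity
  choose α w w' x y hx hy hα hαη hw hw' hxz hyz hbad using fun N : ℕ => hcon _ (hpos N)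
  have h1N : ∀ N : ℕ, (1 : ℝ) / (N + 1) ≤ 1 := fun N => by
    rw [div_le_one (by positivity)]; linarith [Nat.cast_nonneg (α := ℝ) N]
  have hB : ∀ u : ℕ → κ → ℝ, (∀ N, ∀ k ∈ K, |u N k - c k| < 1 / (N + 1)) → ∀ N,
      ∑ k ∈ K, |u N k| ≤ ∑ k ∈ K, (|c k| + 1) := fun u hu N =>
    Finset.sum_le_sum fun k hk => by
      have h2 := abs_sub_abs_le_abs_sub (u N k) (c k)
      linarith [hu N k hk, h1N N]
  have hRR : ∀ u : ℕ → κ → Loc d, (∀ N, ∀ k ∈ K, ‖u N k - z k‖ < 1 / (N + 1)) → ∀ N,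
      ∀ k ∈ K, ‖u N k - 0‖ ≤ ∑ k ∈ K, (‖z k‖ + 1) := fun u hu N k hk => by
    rw [sub_zero]
    have h3 := Finset.single_le_sum (f := fun k => ‖z k‖ + 1) (fun _ _ => by positivity) hk
    have h2 := norm_sub_norm_le (u N k) (z k)
    linarith [hu N k hk, h1N N]
  obtain ⟨C, hC, hle⟩ := exists_abs_gaussDiff_le_near (κ := κ) d n (∑ k ∈ K, (|c k| + 1))
    (∑ k ∈ K, (‖z k‖ + 1)) (Finset.sum_nonneg fun _ _ => by positivity)
  have hlim : ∀ {u : ℕ → ℝ} {l : ℝ}, (∀ N : ℕ, |u N - l| < 1 / (N + 1)) →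
      Filter.Tendsto u Filter.atTop (nhds l) := fun {u l} h => by
    rw [tendsto_iff_dist_tendsto_zero]
    exact squeeze_zero (fun _ => dist_nonneg) (fun N => (h N).le)
      tendsto_one_div_add_atTop_nhds_zero_nat
  have hlimE : ∀ {u : ℕ → Loc d} {l : Loc d}, (∀ N : ℕ, ‖u N - l‖ < 1 / (N + 1)) →
      Filter.Tendsto u Filter.atTop (nhds l) := fun {u l} h => by
    rw [tendsto_iff_norm_sub_tendsto_zero]
    exact squeeze_zero (fun _ => norm_nonneg _) (fun N => (h N).le)
      tendsto_one_div_add_atTop_nhds_zero_nat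
  have hα0 : Filter.Tendsto α Filter.atTop (nhds 0) := hlim fun N => by
    rw [sub_zero, abs_of_pos (hα N)]; exact hαη N
  have hconv : Filter.Tendsto (fun N => ∫ v in Ioi (0 : ℝ), v ^ (ν - 1) *
      Real.exp (-(α N ^ 2 * v)) * gaussDiff K (w N) (w' N) (x N) (y N) v) Filter.atTop
      (nhds (∫ v in Ioi (0 : ℝ), v ^ (ν - 1) * Real.exp (-(0 ^ 2 * v)) *
        gaussDiff K c c z z v)) := by
    refine tendsto_integral_of_dominated_convergence
      (fun v => C * (v ^ (ν - 1) * min 1 (v ^ (-(n : ℝ))))) (fun N => ?_)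
      ((integrableOn_rpow_mul_min hν hn).const_mul C) (fun N => ?_) ?_
    · have := measurable_gaussDiff K (w N) (w' N) (x N) (y N)
      exact Measurable.aestronglyMeasurable (by fun_prop)
    · filter_upwards [ae_restrict_mem measurableSet_Ioi] with v hv
      have hv : 0 < v := hv
      have h4 := hle K (w N) (w' N) (x N) (y N) 0 (hx N) (hy N) (hB w hw N) (hB w' hw' N)
        (hRR x hxz N) (hRR y hyz N) v hv
      rw [norm_mul, norm_mul, Real.norm_of_nonneg (by positivity : 0 ≤ v ^ (ν - 1)),
        Real.norm_of_nonneg (Real.exp_pos _).le, mul_left_comm C, mul_assoc]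
      refine mul_le_mul_of_nonneg_left ?_ (by positivity)
      refine (mul_le_of_le_one_left (norm_nonneg _) (Real.exp_le_one_iff.2 ?_)).trans h4
      have : 0 ≤ α N ^ 2 * v := by positivity
      linarith
    · filter_upwards [ae_restrict_mem measurableSet_Ioi] with v hv
      refine Filter.Tendsto.mul (Filter.Tendsto.const_mul _ ?_) ?_
      · exact (Real.continuous_exp.tendsto _).comp ((hα0.pow 2).mul_const v).neg
      · unfold gaussDiff
        refine tendsto_finsetSum _ fun k hk => tendsto_finsetSum _ fun k' hk' => ?_
        refine Filter.Tendsto.mul ((hlim fun N => hw N k hk).mul (hlim fun N => hw' N k' hk')) ?_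
        refine (Real.continuous_exp.tendsto _).comp (Filter.Tendsto.neg ?_)
        exact (((hlimE fun N => hxz N k hk).sub (hlimE fun N => hyz N k' hk')).norm.pow 2).div_const _
  have hconv' := hconv.const_mul (Real.Gamma ν)⁻¹
  have hev := (Metric.tendsto_nhds.1 hconv' ε hε).exists
  obtain ⟨N, hN⟩ := hev
  refine absurd hN (not_lt.2 ?_)
  have := hbad N
  rw [maternDiff_eq_mixtureDiff hν (hα N)] at this
  exact this

end Matern

/-! ### Mellin transforms of exponential sums with vanishing moments -/

section Mellin

variable {ι : Type*} {s : Finset ι} {w X : ι → ℝ}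

/-- The exponential sum `∑ᵢ wᵢ exp (-Xᵢ y)`. -/
def expSum (s : Finset ι) (w X : ι → ℝ) (y : ℝ) : ℝ := ∑ i ∈ s, w i * Real.exp (-(X i * y))

lemma continuous_expSum : Continuous (expSum s w X) := by unfold expSum; fun_prop

lemma hasDerivAt_expSum (y : ℝ) :
    HasDerivAt (expSum s w X) (-expSum s (fun i => w i * X i) X y) y := by
  unfold expSum
  rw [← Finset.sum_neg_distrib]
  refine HasDerivAt.fun_sum fun i _ => ?_
  have h : HasDerivAt (fun y : ℝ => -(X i * y)) (-(X i)) y := by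
    simpa using (hasDerivAt_const_mul (X i) (x := y)).fun_neg
  exact (h.exp.const_mul (w i)).congr_deriv (by ring)

lemma abs_expSum_le (hX : ∀ i ∈ s, 0 ≤ X i) {y : ℝ} (hy : 0 ≤ y) :
    |expSum s w X y| ≤ ∑ i ∈ s, |w i| := by
  refine (Finset.abs_sum_le_sum_abs _ _).trans (Finset.sum_le_sum fun i hi => ?_)
  rw [abs_mul, abs_of_pos (Real.exp_pos _)]
  refine mul_le_of_le_one_right (abs_nonneg _) (Real.exp_le_one_iff.2 ?_)
  have := mul_nonneg (hX i hi) hy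
  linarith

/-- Vanishing moments make the exponential sum small at the origin. -/
lemma abs_expSum_le_pow (hX : ∀ i ∈ s, 0 ≤ X i) {N : ℕ}
    (hmom : ∀ j < N, ∑ i ∈ s, w i * X i ^ j = 0) {y : ℝ} (hy : 0 ≤ y) :
    |expSum s w X y| ≤ (∑ i ∈ s, |w i| * X i ^ N) * y ^ N := by
  have h : expSum s w X y = ∑ i ∈ s, w i * (Real.exp (-(X i * y)) -
      ∑ j ∈ Finset.range N, (-(X i * y)) ^ j / (j.factorial : ℝ)) := by
    simp_rw [mul_sub, Finset.sum_sub_distrib, Finset.mul_sum]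
    rw [Finset.sum_comm, Finset.sum_eq_zero (s := Finset.range N), sub_zero, expSum]
    intro j hj
    have := hmom j (Finset.mem_range.1 hj)
    have h2 : ∀ i, w i * ((-(X i * y)) ^ j / (j.factorial : ℝ)) =
        (w i * X i ^ j) * ((-y) ^ j / j.factorial) := fun i => by
      rw [show -(X i * y) = X i * -y by ring, mul_pow]; ring
    simp_rw [h2]
    rw [← Finset.sum_mul, this, zero_mul]
  rw [h, Finset.sum_mul]
  refine (Finset.abs_sum_le_sum_abs _ _).trans (Finset.sum_le_sum fun i hi => ?_)
  rw [abs_mul, mul_assoc, ← mul_pow]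
  refine mul_le_mul_of_nonneg_left ?_ (abs_nonneg _)
  have hXy := mul_nonneg (hX i hi) hy
  have := norm_exp_sub_sum_le_exp_re N ((-(X i * y) : ℝ) : ℂ)
  rw [Complex.ofReal_re, max_eq_left (by linarith), Real.exp_zero, mul_one, Complex.norm_real,
    norm_neg, Real.norm_of_nonneg hXy] at this
  refine le_trans (le_of_eq ?_) this
  rw [← Real.norm_eq_abs, ← Complex.norm_real]
  push_cast
  rfl

lemma integrableOn_rpow_mul_expSum (hX : ∀ i ∈ s, 0 ≤ X i) {N : ℕ}
    (hmom : ∀ j < N, ∑ i ∈ s, w i * X i ^ j = 0) {ν : ℝ} (hν : 0 < ν) (hN : ν < N) :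
    IntegrableOn (fun y : ℝ => y ^ (-ν - 1) * expSum s w X y) (Ioi 0) := by
  have hmeas : Measurable fun y : ℝ => y ^ (-ν - 1) * expSum s w X y :=
    (by fun_prop : Measurable fun y : ℝ => y ^ (-ν - 1)).mul continuous_expSum.measurable
  rw [← Ioc_union_Ioi_eq_Ioi zero_le_one]
  refine IntegrableOn.union ?_ ?_
  · have h : IntegrableOn (fun v : ℝ => v ^ ((N : ℝ) - ν - 1)) (Ioc 0 1) := by
      rw [integrableOn_Ioc_iff_integrableOn_Ioo, intervalIntegral.integrableOn_Ioo_rpow_iff one_pos]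
      linarith
    refine (h.const_mul (∑ i ∈ s, |w i| * X i ^ N)).mono' hmeas.aestronglyMeasurable ?_
    filter_upwards [ae_restrict_mem measurableSet_Ioc] with v hv
    have hv0 : 0 < v := hv.1
    rw [norm_mul, Real.norm_of_nonneg (by positivity), mul_comm]
    calc _ ≤ (∑ i ∈ s, |w i| * X i ^ N) * v ^ N * v ^ (-ν - 1) :=
          mul_le_mul_of_nonneg_right (abs_expSum_le_pow hX hmom hv0.le) (by positivity)
      _ = _ := by rw [mul_assoc, ← Real.rpow_natCast, ← Real.rpow_add hv0]; ring_nf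
  · refine ((integrableOn_Ioi_rpow_of_lt (a := -ν - 1) (by linarith) one_pos).mul_const
      (∑ i ∈ s, |w i|)).mono' hmeas.aestronglyMeasurable ?_
    filter_upwards [ae_restrict_mem measurableSet_Ioi] with v hv
    have hv0 : (0 : ℝ) < v := lt_trans one_pos hv
    rw [norm_mul, Real.norm_of_nonneg (by positivity)]
    exact mul_le_mul_of_nonneg_left (abs_expSum_le hX hv0.le) (by positivity)

/-- Integration by parts lowers the exponent and the number of vanishing moments by one. -/
lemma integral_rpow_mul_expSum_succ (hX : ∀ i ∈ s, 0 ≤ X i) {N : ℕ}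
    (hmom : ∀ j < N + 1, ∑ i ∈ s, w i * X i ^ j = 0) {ν : ℝ} (hν : 0 < ν) (hN : ν < N + 1)
    (hint : IntegrableOn (fun y : ℝ => y ^ (-(ν - 1) - 1) * expSum s (fun i => w i * X i) X y)
      (Ioi 0)) :
    ∫ y in Ioi (0 : ℝ), y ^ (-ν - 1) * expSum s w X y = -(1 / ν) *
      ∫ y in Ioi (0 : ℝ), y ^ (-(ν - 1) - 1) * expSum s (fun i => w i * X i) X y := by
  have hint0 := integrableOn_rpow_mul_expSum hX hmom hν (by exact_mod_cast hN)
  have hexp : -(ν - 1) - 1 = -ν := by ring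
  rw [hexp] at hint ⊢
  have hv : ∀ y ∈ Ioi (0 : ℝ), HasDerivAt (fun y : ℝ => -(1 / ν) * y ^ (-ν)) (y ^ (-ν - 1)) y := by
    intro y (hy : 0 < y)
    refine ((Real.hasDerivAt_rpow_const (Or.inl hy.ne')).const_mul _).congr_deriv ?_
    field_simp
  have h0 : Filter.Tendsto (expSum s w X * fun y : ℝ => -(1 / ν) * y ^ (-ν)) (nhdsWithin 0 (Ioi 0))
      (nhds 0) := by
    rw [tendsto_zero_iff_norm_tendsto_zero]
    have hl : Filter.Tendsto (fun y : ℝ => (1 / ν * ∑ i ∈ s, |w i| * X i ^ (N + 1)) *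
        y ^ ((N + 1 : ℝ) - ν)) (nhdsWithin 0 (Ioi 0)) (nhds 0) := by
      have : Filter.Tendsto (fun y : ℝ => y ^ ((N + 1 : ℝ) - ν)) (nhds 0) (nhds (0 ^ ((N + 1 : ℝ) - ν))) :=
        (Real.continuousAt_rpow_const 0 _ (Or.inr (by linarith))).tendsto
      rw [Real.zero_rpow (by linarith)] at this
      simpa using (this.mono_left nhdsWithin_le_nhds).const_mul _
    refine squeeze_zero' (Filter.Eventually.of_forall fun _ => norm_nonneg _) ?_ hl
    filter_upwards [self_mem_nhdsWithin] with y hy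
    have hy : 0 < y := hy
    have := abs_expSum_le_pow hX hmom hy.le
    rw [Pi.mul_apply, norm_mul, norm_mul, norm_neg, Real.norm_of_nonneg (by positivity : 0 ≤ 1 / ν),
      Real.norm_of_nonneg (by positivity : 0 ≤ y ^ (-ν)), sub_eq_add_neg, Real.rpow_add hy]
    calc _ ≤ ((∑ i ∈ s, |w i| * X i ^ (N + 1)) * y ^ (N + 1)) * (1 / ν * y ^ (-ν)) := by
          gcongr; exact this
      _ = _ := by
          rw [← Real.rpow_natCast y (N + 1)]; push_cast; ring
  have hinf : Filter.Tendsto (expSum s w X * fun y : ℝ => -(1 / ν) * y ^ (-ν)) Filter.atTop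
      (nhds 0) := by
    rw [tendsto_zero_iff_norm_tendsto_zero]
    have hl : Filter.Tendsto (fun y : ℝ => (1 / ν * ∑ i ∈ s, |w i|) * y ^ (-ν)) Filter.atTop
        (nhds 0) := by
      simpa using (tendsto_rpow_neg_atTop hν).const_mul _
    refine squeeze_zero' (Filter.Eventually.of_forall fun _ => norm_nonneg _) ?_ hl
    filter_upwards [Filter.eventually_gt_atTop 0] with y hy
    have := abs_expSum_le (w := w) hX hy.le
    rw [Pi.mul_apply, norm_mul, norm_mul, norm_neg, Real.norm_of_nonneg (by positivity : 0 ≤ 1 / ν),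
      Real.norm_of_nonneg (by positivity : 0 ≤ y ^ (-ν))]
    calc _ ≤ (∑ i ∈ s, |w i|) * (1 / ν * y ^ (-ν)) := by gcongr; exact this
      _ = _ := by ring
  have := integral_Ioi_mul_deriv_eq_deriv_mul (a := (0 : ℝ)) (u := expSum s w X)
    (v := fun y : ℝ => -(1 / ν) * y ^ (-ν)) (v' := fun y : ℝ => y ^ (-ν - 1))
    (u' := fun y => -expSum s (fun i => w i * X i) X y) (fun y _ => hasDerivAt_expSum y) hv
    (by simpa only [Pi.mul_def, mul_comm (expSum s w X _)] using hint0)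
    (by
      have hc : IntegrableOn (fun y : ℝ => 1 / ν * (y ^ (-ν) * expSum s (fun i => w i * X i) X y))
        (Ioi 0) := hint.const_mul (1 / ν)
      refine hc.congr_fun (fun y _ => ?_) measurableSet_Ioi
      simp only [Pi.mul_apply]; ring) h0 hinf
  simp only [mul_comm (_ ^ (-ν - 1))]
  rw [this, ← integral_const_mul, sub_self, zero_sub, ← integral_neg]
  exact setIntegral_congr_fun measurableSet_Ioi fun y _ => by ring

/-- The Mellin transform at a non-integer exponent, by induction from a Gamma integral. The
hypothesis `h0` excludes constant terms when `ν < 0`, where they are not integrable. -/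
theorem integral_rpow_mul_expSum (N : ℕ) (w : ι → ℝ) (hX : ∀ i ∈ s, 0 ≤ X i)
    (hmom : ∀ j < N, ∑ i ∈ s, w i * X i ^ j = 0) (h0 : N = 0 → ∀ i ∈ s, X i = 0 → w i = 0)
    {ν : ℝ} (hν : (N : ℝ) - 1 < ν) (hN : ν < N) :
    IntegrableOn (fun y : ℝ => y ^ (-ν - 1) * expSum s w X y) (Ioi 0) ∧
    ∫ y in Ioi (0 : ℝ), y ^ (-ν - 1) * expSum s w X y =
      Real.Gamma (-ν) * ∑ i ∈ s, w i * X i ^ ν := by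
  induction N generalizing w ν with
  | zero =>
    have hν0 : ν < 0 := by simpa using hN
    have hterm : ∀ i ∈ s, IntegrableOn (fun y : ℝ => y ^ (-ν - 1) *
        (w i * Real.exp (-(X i * y)))) (Ioi 0) ∧
        ∫ y in Ioi (0 : ℝ), y ^ (-ν - 1) * (w i * Real.exp (-(X i * y))) =
          Real.Gamma (-ν) * (w i * X i ^ ν) := by
      intro i hi
      rcases (hX i hi).eq_or_lt with hz | hp
      · simp [h0 rfl i hi hz.symm]
      · simp_rw [mul_left_comm _ (w i)]
        refine ⟨(integrableOn_rpow_mul_exp_neg_mul (by linarith) hp).const_mul _, ?_⟩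
        rw [integral_const_mul, Real.integral_rpow_mul_exp_neg_mul_Ioi (by linarith) hp, one_div,
          Real.inv_rpow hp.le, Real.rpow_neg hp.le, inv_inv]
        ring
    simp only [expSum, Finset.mul_sum]
    refine ⟨integrable_finsetSum _ fun i hi => (hterm i hi).1, ?_⟩
    rw [integral_finsetSum _ fun i hi => (hterm i hi).1]
    exact Finset.sum_congr rfl fun i hi => (hterm i hi).2
  | succ N ih =>
    push_cast at hν hN
    have hν0 : 0 < ν := by
      rcases Nat.eq_zero_or_pos N with h | h
      · subst h; simpa using hν
      · have : (1 : ℝ) ≤ N := by exact_mod_cast h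
        linarith
    obtain ⟨h1, h2⟩ := ih (fun i => w i * X i) (fun j hj => by
      have := hmom (j + 1) (by omega)
      simpa only [mul_assoc, ← pow_succ'] using this) (fun _ i _ h => by simp [h])
      (ν := ν - 1) (by linarith) (by linarith)
    refine ⟨integrableOn_rpow_mul_expSum hX hmom hν0 (by push_cast; exact hN), ?_⟩
    rw [integral_rpow_mul_expSum_succ hX hmom hν0 hN h1, h2]
    have hG : Real.Gamma (-(ν - 1)) = -ν * Real.Gamma (-ν) := by
      rw [← Real.Gamma_add_one (by linarith)]; ring_nf
    rw [hG]
    have : ∀ i ∈ s, w i * X i * X i ^ (ν - 1) = w i * X i ^ ν := by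
      intro i hi
      rcases (hX i hi).eq_or_lt with hz | hp
      · rw [← hz, Real.zero_rpow hν0.ne']; ring
      · rw [mul_assoc, Real.rpow_sub_one hp.ne']; field_simp
    rw [Finset.sum_congr rfl this]
    field_simp

lemma integral_inv_mul_exp_sub_exp {a : ℝ} (ha : 0 < a) :
    IntegrableOn (fun y : ℝ => y⁻¹ * (Real.exp (-(a * y)) - Real.exp (-y))) (Ioi 0) ∧
    ∫ y in Ioi (0 : ℝ), y⁻¹ * (Real.exp (-(a * y)) - Real.exp (-y)) = -Real.log a := by
  have hint : IntegrableOn (fun y : ℝ => y⁻¹ * (Real.exp (-(a * y)) - Real.exp (-y))) (Ioi 0) := by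
    have hb : IntegrableOn (fun y : ℝ => |a - 1| * (Real.exp (-(a * y)) + Real.exp (-y)))
        (Ioi 0) := by
      have h1 : IntegrableOn (fun y : ℝ => Real.exp (-(a * y))) (Ioi 0) := by
        simpa using integrableOn_rpow_mul_exp_neg_mul one_pos ha
      have h2 : IntegrableOn (fun y : ℝ => Real.exp (-y)) (Ioi 0) := by
        simpa using integrableOn_rpow_mul_exp_neg_mul one_pos one_pos
      exact (h1.add h2).const_mul _
    refine hb.mono' (Measurable.aestronglyMeasurable (by fun_prop)) ?_
    filter_upwards [ae_restrict_mem measurableSet_Ioi] with y hy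
    have hy : 0 < y := hy
    rw [norm_mul, norm_inv, Real.norm_of_nonneg hy.le, inv_mul_le_iff₀ hy, Real.norm_eq_abs]
    have e1 := Real.exp_pos (-(a * y))
    have e2 := Real.exp_pos (-y)
    -- `1 + t ≤ exp t` at `t = ±(a - 1) y`
    have k1 : Real.exp (-(a * y)) * ((a - 1) * y + 1) ≤ Real.exp (-y) := by
      have := mul_le_mul_of_nonneg_left (Real.add_one_le_exp ((a - 1) * y)) e1.le
      rwa [← Real.exp_add, show -(a * y) + (a - 1) * y = -y by ring] at this
    have k2 : Real.exp (-y) * (-((a - 1) * y) + 1) ≤ Real.exp (-(a * y)) := by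
      have := mul_le_mul_of_nonneg_left (Real.add_one_le_exp (-((a - 1) * y))) e2.le
      rwa [← Real.exp_add, show -y + -((a - 1) * y) = -(a * y) by ring] at this
    have ab1 := le_abs_self (a - 1)
    have ab2 := neg_le_abs (a - 1)
    have hab := abs_nonneg (a - 1)
    rw [abs_le]
    constructor
    · nlinarith [mul_le_mul_of_nonneg_right ab1 (mul_pos hy e2).le,
        mul_nonneg hab (mul_pos hy e1).le]
    · nlinarith [mul_le_mul_of_nonneg_right ab2 (mul_pos hy e1).le,
        mul_nonneg hab (mul_pos hy e2).le]
  refine ⟨hint, ?_⟩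
  have hf : Continuous fun y : ℝ => Real.exp (-y) := by fun_prop
  have := Frullani.integral_Ioi_eq (f := fun y : ℝ => Real.exp (-y)) (a := a) (b := 1) (L := 1)
    (R := 0) (hf.locallyIntegrable.locallyIntegrableOn _) ha one_pos
    (by
      have := hf.tendsto 0
      simp only [neg_zero, Real.exp_zero] at this
      exact this.mono_left nhdsWithin_le_nhds)
    (Real.tendsto_exp_neg_atTop_nhds_zero) (by simpa using hint)
  simpa [Real.log_inv] using this

/-- The Mellin transform at an integer exponent produces a logarithm, by induction from the
Frullani integral `integral_inv_mul_exp_sub_exp`. -/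
theorem integral_rpow_mul_expSum_nat (N : ℕ) (w : ι → ℝ) (hX : ∀ i ∈ s, 0 ≤ X i)
    (hmom : ∀ j < N + 1, ∑ i ∈ s, w i * X i ^ j = 0) (h0 : N = 0 → ∀ i ∈ s, X i = 0 → w i = 0) :
    IntegrableOn (fun y : ℝ => y ^ (-(N : ℝ) - 1) * expSum s w X y) (Ioi 0) ∧
    ∫ y in Ioi (0 : ℝ), y ^ (-(N : ℝ) - 1) * expSum s w X y =
      (-1) ^ (N + 1) / (N.factorial : ℝ) * ∑ i ∈ s, w i * (X i ^ N * Real.log (X i)) := by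
  induction N generalizing w with
  | zero =>
    have hterm : ∀ i ∈ s, IntegrableOn (fun y : ℝ => w i * (y⁻¹ *
        (Real.exp (-(X i * y)) - Real.exp (-y)))) (Ioi 0) ∧
        ∫ y in Ioi (0 : ℝ), w i * (y⁻¹ * (Real.exp (-(X i * y)) - Real.exp (-y))) =
          -(w i * Real.log (X i)) := by
      intro i hi
      rcases (hX i hi).eq_or_lt with hz | hp
      · simp [h0 rfl i hi hz.symm]
      · obtain ⟨h1, h2⟩ := integral_inv_mul_exp_sub_exp hp
        refine ⟨h1.const_mul _, ?_⟩
        rw [integral_const_mul, h2]; ring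
    have heq : ∀ y : ℝ, y ^ (-((0 : ℕ) : ℝ) - 1) * expSum s w X y =
        ∑ i ∈ s, w i * (y⁻¹ * (Real.exp (-(X i * y)) - Real.exp (-y))) := by
      intro y
      have hw : ∑ i ∈ s, w i = 0 := by simpa using hmom 0 (by omega)
      rw [show (-((0 : ℕ) : ℝ) - 1) = -1 by norm_num, Real.rpow_neg_one, expSum]
      simp_rw [mul_sub, Finset.sum_sub_distrib, ← Finset.sum_mul, hw, zero_mul, sub_zero,
        Finset.mul_sum]
      exact Finset.sum_congr rfl fun i _ => by ring
    simp_rw [heq]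
    refine ⟨integrable_finsetSum _ fun i hi => (hterm i hi).1, ?_⟩
    rw [integral_finsetSum _ fun i hi => (hterm i hi).1, Finset.sum_congr rfl fun i hi => (hterm i hi).2]
    simp
  | succ N ih =>
    have hN0 : (0 : ℝ) < N + 1 := by positivity
    obtain ⟨h1, h2⟩ := ih (fun i => w i * X i) (fun j hj => by
      have := hmom (j + 1) (by omega)
      simpa only [mul_assoc, ← pow_succ'] using this) (fun _ i _ h => by simp [h])
    have hsub : ((N + 1 : ℕ) : ℝ) - 1 = N := by push_cast; ring
    have hpos : (0 : ℝ) < ((N + 1 : ℕ) : ℝ) := by push_cast; exact hN0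
    have hlt : ((N + 1 : ℕ) : ℝ) < ((N + 1 : ℕ) : ℝ) + 1 := by linarith
    refine ⟨integrableOn_rpow_mul_expSum hX hmom hpos (by push_cast; linarith), ?_⟩
    rw [integral_rpow_mul_expSum_succ (N := N + 1) hX hmom hpos hlt (by rw [hsub]; exact h1), hsub,
      h2, Nat.factorial_succ]
    have : ∀ i, w i * X i * (X i ^ N * Real.log (X i)) =
        w i * (X i ^ (N + 1) * Real.log (X i)) := fun i => by ring
    simp_rw [this]
    have hf : (N.factorial : ℝ) ≠ 0 := by exact_mod_cast N.factorial_ne_zero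
    push_cast
    field_simp
    ring

end Mellin

/-! ### The limiting constant `ξ*_ν H` -/

section Limit

variable {κ : Type*} {d n : ℕ} {K : Finset κ} {c : κ → ℝ} {z : κ → Loc d}

/-- Annihilation in each of the two variables kills all even powers of the distance up to
total degree `2 n - 2`: in every monomial one of the two degrees is less than `n`. -/
lemma Annihilates.sum_norm_sub_pow (hz : Annihilates n K c (fun k => z k)) {j : ℕ} (hj : j < n) :
    ∑ k ∈ K, ∑ k' ∈ K, c k * c k' * (‖z k - z k'‖ ^ 2) ^ j = 0 := by
  have hexp : ∀ k k', (‖z k - z k'‖ ^ 2) ^ j = ∑ a ∈ Finset.univ.piAntidiag j,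
      ∑ e ∈ Fintype.piFinset fun i => Finset.range (2 * a i + 1),
        ((Nat.multinomial Finset.univ a : ℝ) * ∏ i, (-1 : ℝ) ^ (2 * a i - e i) *
          ((2 * a i).choose (e i) : ℝ)) *
          ((∏ i, z k i ^ e i) * ∏ i, z k' i ^ (2 * a i - e i)) := by
    intro k k'
    rw [EuclideanSpace.norm_sq_eq, Finset.sum_pow_eq_sum_piAntidiag]
    refine Finset.sum_congr rfl fun a _ => ?_
    have h1 : ∏ i, (‖(z k - z k') i‖ ^ 2) ^ a i = ∏ i, (1 * z k i + -z k' i) ^ (2 * a i) := by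
      refine Finset.prod_congr rfl fun i _ => ?_
      rw [Real.norm_eq_abs, sq_abs, ← pow_mul]
      simp [sub_eq_add_neg]
    rw [h1, prod_affine_pow_eq_sum, Finset.mul_sum]
    refine Finset.sum_congr rfl fun e _ => ?_
    rw [mul_assoc, ← Finset.prod_mul_distrib, ← Finset.prod_mul_distrib, ← Finset.prod_mul_distrib]
    congr 1
    refine Finset.prod_congr rfl fun i _ => ?_
    rw [one_pow, neg_pow]; ring
  simp_rw [hexp, Finset.mul_sum]
  have hswap : ∀ f : κ → κ → (Fin d → ℕ) → (Fin d → ℕ) → ℝ,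
      ∑ k ∈ K, ∑ k' ∈ K, ∑ a ∈ Finset.univ.piAntidiag j,
        ∑ e ∈ Fintype.piFinset fun i => Finset.range (2 * a i + 1), f k k' a e =
      ∑ a ∈ Finset.univ.piAntidiag j, ∑ e ∈ Fintype.piFinset fun i => Finset.range (2 * a i + 1),
        ∑ k ∈ K, ∑ k' ∈ K, f k k' a e := by
    intro f
    simp_rw [Finset.sum_comm (s := K) (t := Finset.univ.piAntidiag j)]
    refine Finset.sum_congr rfl fun a _ => ?_
    simp_rw [Finset.sum_comm (s := K) (t := Fintype.piFinset _)]
  rw [hswap]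
  refine Finset.sum_eq_zero fun a ha => Finset.sum_eq_zero fun e he => ?_
  have hs : ∑ i, a i = j := (Finset.mem_piAntidiag.1 ha).1
  have he' : ∀ i, e i ≤ 2 * a i := fun i => by
    have := Fintype.mem_piFinset.1 he i
    simp at this; omega
  have hsum : ∑ i, e i + ∑ i, (2 * a i - e i) = 2 * j := by
    rw [← Finset.sum_add_distrib, ← hs, Finset.mul_sum]
    exact Finset.sum_congr rfl fun i _ => by have := he' i; omega
  set q : ℝ := (Nat.multinomial Finset.univ a : ℝ) * ∏ i, (-1 : ℝ) ^ (2 * a i - e i) *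
    ((2 * a i).choose (e i) : ℝ)
  have hfac : ∑ k ∈ K, ∑ k' ∈ K, c k * c k' *
      (q * ((∏ i, z k i ^ e i) * ∏ i, z k' i ^ (2 * a i - e i))) =
      q * ((∑ k ∈ K, c k * ∏ i, z k i ^ e i) *
        ∑ k' ∈ K, c k' * ∏ i, z k' i ^ (2 * a i - e i)) := by
    rw [Finset.sum_mul_sum, Finset.mul_sum]
    refine Finset.sum_congr rfl fun k _ => ?_
    rw [Finset.mul_sum]
    exact Finset.sum_congr rfl fun k' _ => by ring
  rw [hfac]
  rcases lt_or_ge (∑ i, e i) n with h | h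
  · rw [hz e h, zero_mul, mul_zero]
  · rw [hz (fun i => 2 * a i - e i) (by omega), mul_zero, mul_zero]

lemma gaussDiff_inv_eq_expSum {y : ℝ} (hy : 0 < y) :
    gaussDiff K c c z z y⁻¹ = expSum (K ×ˢ K) (fun k => c k.1 * c k.2)
      (fun k => ‖z k.1 - z k.2‖ ^ 2 / 4) y := by
  rw [gaussDiff, expSum, Finset.sum_product]
  refine Finset.sum_congr rfl fun k _ => Finset.sum_congr rfl fun k' _ => ?_
  congr 2
  field_simp

lemma mixtureDiff_zero_eq (ν : ℝ) : mixtureDiff ν 0 K c c z z = (Real.Gamma ν)⁻¹ *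
    ∫ y in Ioi (0 : ℝ), y ^ (-ν - 1) * expSum (K ×ˢ K) (fun k => c k.1 * c k.2)
      (fun k => ‖z k.1 - z k.2‖ ^ 2 / 4) y := by
  rw [mixtureDiff, ← integral_comp_rpow_Ioi (p := -1) _ (by norm_num)]
  congr 1
  refine setIntegral_congr_fun measurableSet_Ioi fun y (hy : 0 < y) => ?_
  rw [Real.rpow_neg_one, gaussDiff_inv_eq_expSum hy, Real.inv_rpow hy.le, ← Real.rpow_neg hy.le]
  simp only [abs_neg, abs_one, one_mul, smul_eq_mul, ne_eq, OfNat.ofNat_ne_zero,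
    not_false_eq_true, zero_pow, zero_mul, neg_zero, Real.exp_zero, mul_one]
  rw [← mul_assoc, ← Real.rpow_add hy]
  ring_nf

/-- The limiting double difference of the Matérn kernel at zero inverse range parameter. -/
theorem mixtureDiff_zero_eq_sum {ν : ℝ} (hν : 0 < ν) (hn : ν < n)
    (hz : Annihilates n K c (fun k => z k)) :
    mixtureDiff ν 0 K c c z z =
      xiStar ν * ∑ k ∈ K, ∑ k' ∈ K, c k * c k' * G ν ‖z k - z k'‖ := by
  have hΓ := Real.Gamma_pos_of_pos hν
  have hmom : ∀ j < n, ∑ i ∈ K ×ˢ K, c i.1 * c i.2 * (‖z i.1 - z i.2‖ ^ 2 / 4) ^ j = 0 := by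
    intro j hj
    have := hz.sum_norm_sub_pow hj
    rw [Finset.sum_product]
    simp_rw [div_pow, ← mul_div_assoc, ← Finset.sum_div]
    rw [this, zero_div]
  have hX : ∀ i ∈ K ×ˢ K, 0 ≤ ‖z i.1 - z i.2‖ ^ 2 / 4 := fun i _ => by positivity
  have hpow : ∀ t : ℝ, 0 ≤ t → (t ^ 2 / 4) ^ ν = t ^ (2 * ν) / 2 ^ (2 * ν) := fun t ht => by
    rw [Real.div_rpow (by positivity) (by norm_num), ← Real.rpow_natCast t 2, ← Real.rpow_mul ht,
      Real.rpow_mul two_pos.le 2 ν]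
    norm_num
  rw [mixtureDiff_zero_eq]
  by_cases hint : IsPosInt ν
  · obtain ⟨N, hN, hνN⟩ := hint
    have hint : IsPosInt ν := ⟨N, hN, hνN⟩
    have hNn : N < n := by rw [hνN] at hn; exact_mod_cast hn
    have h := (integral_rpow_mul_expSum_nat N (fun k : κ × κ => c k.1 * c k.2) hX
      (fun j hj => hmom j (by omega)) (fun h => by omega)).2
    rw [← hνN] at h
    rw [h, xiStar, if_pos hint]
    simp only [G, if_pos hint]
    have hterm : ∀ t : ℝ, 0 ≤ t → (t ^ 2 / 4) ^ N * Real.log (t ^ 2 / 4) =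
        2 * (t ^ (2 * ν) * Real.log t) / 2 ^ (2 * ν) - (t ^ 2 / 4) ^ N * Real.log 4 := by
      intro t ht
      rcases ht.eq_or_lt with rfl | ht0
      · rw [Real.zero_rpow (by positivity), zero_pow two_ne_zero, zero_div, zero_pow (by omega)]
        simp
      · have e := hpow t ht
        rw [hνN, Real.rpow_natCast, ← hνN] at e
        rw [Real.log_div (by positivity) (by norm_num), Real.log_pow, mul_sub, e]
        push_cast; ring
    have hsum : ∑ i ∈ K ×ˢ K, c i.1 * c i.2 * ((‖z i.1 - z i.2‖ ^ 2 / 4) ^ N *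
        Real.log (‖z i.1 - z i.2‖ ^ 2 / 4)) = 2 / 2 ^ (2 * ν) * ∑ k ∈ K, ∑ k' ∈ K,
          c k * c k' * (‖z k - z k'‖ ^ (2 * ν) * Real.log ‖z k - z k'‖) := by
      simp_rw [hterm _ (norm_nonneg _), mul_sub, Finset.sum_sub_distrib, ← mul_assoc (_ * _) _ (Real.log 4),
        ← Finset.sum_mul, hmom N hNn, zero_mul, sub_zero]
      rw [Finset.sum_product, Finset.mul_sum]
      refine Finset.sum_congr rfl fun k _ => ?_
      rw [Finset.mul_sum]
      exact Finset.sum_congr rfl fun k' _ => by ring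
    rw [hsum]
    have hfl : ⌊ν⌋₊ = N := by rw [hνN]; simp
    have hG1 : Real.Gamma (ν + 1) = N.factorial := by
      rw [hνN]; exact_mod_cast Real.Gamma_nat_eq_factorial N
    rw [hfl, hG1, Real.rpow_sub two_pos, Real.rpow_one]
    have hf : (N.factorial : ℝ) ≠ 0 := by exact_mod_cast N.factorial_ne_zero
    have h2 : (2 : ℝ) ^ (2 * ν) ≠ 0 := by positivity
    field_simp
  · have hfl1 := Nat.floor_le hν.le
    have hfl2 := Nat.lt_floor_add_one ν
    have hlt : (⌊ν⌋₊ : ℝ) < ν := by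
      refine lt_of_le_of_ne hfl1 fun h => hint ⟨⌊ν⌋₊, ?_, h.symm⟩
      have : (0 : ℝ) < (⌊ν⌋₊ : ℝ) := by rw [h]; exact hν
      exact_mod_cast this
    have hNn : ⌊ν⌋₊ + 1 ≤ n := by
      have : ⌊ν⌋₊ < n := (Nat.floor_lt hν.le).2 hn
      omega
    have h := (integral_rpow_mul_expSum (⌊ν⌋₊ + 1) (fun k : κ × κ => c k.1 * c k.2) hX
      (fun j hj => hmom j (by omega)) (fun h => by omega) (ν := ν) (by push_cast; linarith)
      (by push_cast; exact hfl2)).2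
    rw [h, xiStar, if_neg hint]
    simp only [G, if_neg hint]
    simp_rw [hpow _ (norm_nonneg _)]
    rw [Finset.sum_product]
    simp_rw [← mul_div_assoc, ← Finset.sum_div]
    -- the reflection formula at `-ν`
    have hsin : Real.sin (ν * Real.pi) ≠ 0 := by
      intro h0
      obtain ⟨k, hk⟩ := Real.sin_eq_zero_iff.1 h0
      have hkν : (k : ℝ) = ν := mul_right_cancel₀ Real.pi_ne_zero hk
      have hk0 : 0 < k := by
        have : (0 : ℝ) < k := hkν ▸ hν
        exact_mod_cast this
      refine hint ⟨k.toNat, by omega, ?_⟩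
      rw [← hkν]
      have : ((k.toNat : ℤ) : ℝ) = k := by rw [Int.toNat_of_nonneg hk0.le]
      exact_mod_cast this.symm
    have hrefl : Real.Gamma (-ν) * Real.Gamma (ν + 1) = -Real.pi / Real.sin (ν * Real.pi) := by
      have := Real.Gamma_mul_Gamma_one_sub (-ν)
      rw [sub_neg_eq_add, add_comm, show Real.pi * -ν = -(ν * Real.pi) by ring, Real.sin_neg] at this
      rw [this, div_neg, neg_div]
    have hG1 : Real.Gamma (ν + 1) ≠ 0 := (Real.Gamma_pos_of_pos (by linarith)).ne'
    have hG : Real.Gamma (-ν) = -Real.pi / Real.sin (ν * Real.pi) / Real.Gamma (ν + 1) := by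
      rw [← hrefl]; field_simp
    have h2 : (2 : ℝ) ^ (2 * ν) ≠ 0 := by positivity
    rw [hG]
    field_simp

lemma gaussDiff_self_nonneg {v : ℝ} (hv : 0 < v) : 0 ≤ gaussDiff K c c z z v := by
  -- the quadratic form is `E |∑ₖ cₖ exp (i ⟨Z, zₖ⟩ / √(2v))|²`
  set r : ℝ := (√(2 * v))⁻¹ with hr
  let Φ : Loc d → ℂ := fun Z => ∑ k ∈ K, (c k : ℂ) *
    Complex.exp (((inner ℝ Z (r • z k) : ℝ) : ℂ) * Complex.I)
  have hint : ∀ t : Loc d, Integrable (fun Z : Loc d =>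
      Complex.exp (((inner ℝ Z t : ℝ) : ℂ) * Complex.I)) (stdGaussian (Loc d)) := fun t =>
    Integrable.of_bound (C := 1) (Continuous.aestronglyMeasurable (by fun_prop))
      (Filter.Eventually.of_forall fun Z => by rw [Complex.norm_exp_ofReal_mul_I])
  have key : ((gaussDiff K c c z z v : ℝ) : ℂ) =
      ∫ Z, ((Complex.normSq (Φ Z) : ℝ) : ℂ) ∂(stdGaussian (Loc d)) := by
    have h1 : ∀ Z, ((Complex.normSq (Φ Z) : ℝ) : ℂ) = ∑ k ∈ K, ∑ k' ∈ K, ((c k : ℂ) * c k') *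
        Complex.exp (((inner ℝ Z (r • (z k - z k')) : ℝ) : ℂ) * Complex.I) := by
      intro Z
      rw [← Complex.mul_conj]
      simp only [Φ, map_sum, Finset.sum_mul_sum, map_mul, Complex.conj_ofReal, ← Complex.exp_conj,
        Complex.conj_I]
      refine Finset.sum_congr rfl fun k _ => Finset.sum_congr rfl fun k' _ => ?_
      rw [mul_mul_mul_comm, ← Complex.exp_add, smul_sub, inner_sub_right]
      congr 2
      push_cast; ring
    simp_rw [h1]
    rw [integral_finsetSum _ fun k _ => integrable_finsetSum _ fun k' _ => (hint _).const_mul _]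
    simp_rw [integral_finsetSum K fun k' _ => (hint _).const_mul _, integral_const_mul,
      integral_cexp_inner_stdGaussian]
    rw [gaussDiff]
    push_cast
    refine Finset.sum_congr rfl fun k _ => Finset.sum_congr rfl fun k' _ => ?_
    congr 2
    have : ‖r • (z k - z k')‖ ^ 2 / 2 = ‖z k - z k'‖ ^ 2 / (4 * v) := by
      rw [norm_smul, mul_pow, hr, norm_inv, inv_pow, Real.norm_of_nonneg (Real.sqrt_nonneg _),
        Real.sq_sqrt (by positivity)]
      field_simp; ring
    have h2 : (((‖r • (z k - z k')‖ ^ 2 / 2 : ℝ)) : ℂ) = ((‖z k - z k'‖ ^ 2 / (4 * v) : ℝ) : ℂ) := by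
      rw [this]
    push_cast at h2
    rw [h2]
  rw [integral_complex_ofReal] at key
  have : gaussDiff K c c z z v = ∫ Z, Complex.normSq (Φ Z) ∂(stdGaussian (Loc d)) := by
    exact_mod_cast key
  rw [this]
  exact integral_nonneg fun Z => Complex.normSq_nonneg _

/-- The limit is positive: the Gaussian kernel is positive semidefinite at every scale, and at
small scales its quadratic form is close to `∑ₖ cₖ²`. -/
theorem mixtureDiff_zero_pos {ν : ℝ} (hν : 0 < ν) (hn : ν < n)
    (hz : Annihilates n K c (fun k => z k)) (hinj : Set.InjOn z K) (hc : ∃ k ∈ K, c k ≠ 0) :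
    0 < mixtureDiff ν 0 K c c z z := by
  have hΓ := Real.Gamma_pos_of_pos hν
  refine mul_pos (inv_pos.2 hΓ) ?_
  simp only [ne_eq, OfNat.ofNat_ne_zero, not_false_eq_true, zero_pow, zero_mul, neg_zero,
    Real.exp_zero, mul_one]
  have hlim : Filter.Tendsto (gaussDiff K c c z z) (nhdsWithin 0 (Ioi 0))
      (nhds (∑ k ∈ K, c k ^ 2)) := by
    classical
    rw [Finset.sum_congr rfl fun k hk => show c k ^ 2 = ∑ k' ∈ K, if k' = k then c k * c k' else 0
      by rw [Finset.sum_ite_eq' K k, if_pos hk, sq]]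
    unfold gaussDiff
    refine tendsto_finsetSum _ fun k hk => tendsto_finsetSum _ fun k' hk' => ?_
    split_ifs with h
    · subst h
      simp
    · have hne : 0 < ‖z k - z k'‖ ^ 2 := by
        have : z k ≠ z k' := fun e => h (hinj hk' hk e.symm)
        have := norm_pos_iff.2 (sub_ne_zero.2 this)
        positivity
      have : Filter.Tendsto (fun v : ℝ => ‖z k - z k'‖ ^ 2 / (4 * v)) (nhdsWithin 0 (Ioi 0))
          Filter.atTop := by
        have : ∀ v : ℝ, ‖z k - z k'‖ ^ 2 / (4 * v) = (‖z k - z k'‖ ^ 2 / 4) * v⁻¹ := fun v => by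
          rw [div_mul_eq_div_div, div_eq_mul_inv]
        simp_rw [this]
        exact tendsto_inv_nhdsGT_zero.const_mul_atTop (by positivity)
      simpa using (Real.tendsto_exp_neg_atTop_nhds_zero.comp this).const_mul (c k * c k')
  obtain ⟨k₀, hk₀, hck⟩ := hc
  have hpos : 0 < ∑ k ∈ K, c k ^ 2 :=
    lt_of_lt_of_le (by positivity : 0 < c k₀ ^ 2)
      (Finset.single_le_sum (f := fun k => c k ^ 2) (fun _ _ => sq_nonneg _) hk₀)
  have hev := hlim.eventually (lt_mem_nhds hpos)
  rw [eventually_nhdsWithin_iff, Metric.eventually_nhds_iff] at hev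
  obtain ⟨δ, hδ, hball⟩ := hev
  obtain ⟨C, hC, hle⟩ := exists_abs_gaussDiff_le_near (κ := κ) d n (∑ k ∈ K, |c k|)
    (∑ k ∈ K, ‖z k‖) (Finset.sum_nonneg fun _ _ => norm_nonneg _)
  have hR : ∀ k ∈ K, ‖z k - 0‖ ≤ ∑ k ∈ K, ‖z k‖ := fun k hk => by
    rw [sub_zero]
    exact Finset.single_le_sum (f := fun k => ‖z k‖) (fun _ _ => norm_nonneg _) hk
  have hint : IntegrableOn (fun v : ℝ => v ^ (ν - 1) * gaussDiff K c c z z v) (Ioi 0) := by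
    have := measurable_gaussDiff K c c z z
    refine ((integrableOn_rpow_mul_min hν hn).const_mul C).mono'
      (Measurable.aestronglyMeasurable (by fun_prop)) ?_
    filter_upwards [ae_restrict_mem measurableSet_Ioi] with v hv
    have hv : 0 < v := hv
    rw [norm_mul, Real.norm_of_nonneg (by positivity : 0 ≤ v ^ (ν - 1)), mul_left_comm C]
    exact mul_le_mul_of_nonneg_left (hle K c c z z 0 hz hz le_rfl le_rfl hR hR v hv) (by positivity)
  rw [setIntegral_pos_iff_support_of_nonneg_ae _ hint]
  · have hsub : Ioo 0 δ ⊆ Function.support (fun v : ℝ => v ^ (ν - 1) * gaussDiff K c c z z v) ∩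
        Ioi 0 := by
      intro v hv
      have h1 := hball (y := v) (by rw [Real.dist_0_eq_abs, abs_of_pos hv.1]; exact hv.2) hv.1
      have h2 : 0 < v ^ (ν - 1) := Real.rpow_pos_of_pos hv.1 _
      exact ⟨(mul_pos h2 h1).ne', hv.1⟩
    refine lt_of_lt_of_le ?_ (measure_mono hsub)
    simp [hδ]
  · filter_upwards [ae_restrict_mem measurableSet_Ioi] with v hv
    have hv : 0 < v := hv
    have := gaussDiff_self_nonneg (K := K) (c := c) (z := z) hv
    simp only [Pi.zero_apply]
    positivity

end Limit

/-! ### Existence of differencing constants -/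

section Existence

variable {d ℓ : ℕ}

lemma mem_multiIdx {k : Fin d → ℕ} : k ∈ multiIdx d ℓ ↔ ∀ j, k j ≤ ℓ := by
  simp [multiIdx, Fintype.mem_piFinset]

/-- The generalised Vandermonde matrix of a configuration of `(ℓ + 1)^d` points: the row of the
multi-index `l` holds the values of the monomial `X^l`. -/
def vandermondeGrid (x : multiIdx d ℓ → Fin d → ℝ) : Matrix (multiIdx d ℓ) (multiIdx d ℓ) ℝ :=
  Matrix.of fun l k => ∏ j, x k j ^ l.1 j

/-- The grid `{0, …, ℓ}^d`. -/
def gridPoint (k : multiIdx d ℓ) (j : Fin d) : ℝ := k.1 j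

/-- A polynomial of degree at most `ℓ` in each variable which vanishes on the grid is zero. -/
lemma det_vandermondeGrid_ne_zero :
    (vandermondeGrid (gridPoint : multiIdx d ℓ → Fin d → ℝ)).det ≠ 0 := by
  classical
  intro h
  obtain ⟨v, hv, hv0⟩ := Matrix.exists_vecMul_eq_zero_iff.2 h
  let e : (Fin d → ℕ) ≃ (Fin d →₀ ℕ) := Finsupp.equivFunOnFinite.symm
  let p : MvPolynomial (Fin d) ℝ := ∑ l : multiIdx d ℓ, MvPolynomial.monomial (e l.1) (v l)
  have heval : ∀ k : multiIdx d ℓ, MvPolynomial.eval (fun j => (k.1 j : ℝ)) p = 0 := by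
    intro k
    have := congrFun hv0 k
    simp only [Matrix.vecMul, dotProduct, vandermondeGrid, Matrix.of_apply, gridPoint,
      Pi.zero_apply] at this
    simp only [p, map_sum, MvPolynomial.eval_monomial]
    rw [← this]
    refine Finset.sum_congr rfl fun l _ => ?_
    congr 1
    rw [Finsupp.prod_fintype _ _ (by simp)]
    rfl
  have hp : p = 0 := by
    refine MvPolynomial.eq_zero_of_eval_zero_at_prod_finset p
      (fun _ => (Finset.range (ℓ + 1)).image (fun a : ℕ => (a : ℝ))) (fun j => ?_) fun x hx => ?_
    · rw [Finset.card_image_of_injective _ Nat.cast_injective, Finset.card_range, Nat.lt_succ_iff]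
      refine (MvPolynomial.degreeOf_sum_le j _ _).trans (Finset.sup_le fun l _ => ?_)
      by_cases hl : v l = 0
      · simp [hl]
      · rw [MvPolynomial.degreeOf_monomial_eq _ _ hl]
        exact mem_multiIdx.1 l.2 j
    · have hx' : ∀ j, ∃ a : ℕ, a ≤ ℓ ∧ (a : ℝ) = x j := fun j => by
        have := hx j
        simpa [Nat.lt_succ_iff] using this
      choose a ha hax using hx'
      have := heval ⟨a, mem_multiIdx.2 ha⟩
      rwa [show (fun j => ((a j : ℕ) : ℝ)) = x from funext hax] at this
  apply hv
  ext l
  have hc := congrArg (MvPolynomial.coeff (e l.1)) hp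
  simp only [p, MvPolynomial.coeff_sum, MvPolynomial.coeff_monomial, MvPolynomial.coeff_zero,
    EmbeddingLike.apply_eq_iff_eq] at hc
  rw [Finset.sum_eq_single l (fun b _ hb => if_neg fun h => hb (Subtype.ext h)) (by simp),
    if_pos rfl] at hc
  simpa using hc

lemma contDiff_vandermondeGrid (l k : multiIdx d ℓ) :
    ContDiff ℝ 1 (fun x : multiIdx d ℓ → Fin d → ℝ => vandermondeGrid x l k) := by
  simp only [vandermondeGrid, Matrix.of_apply]
  fun_prop

variable [NeZero d]

/-- The right-hand side of the moment conditions: `ℓ!` for the monomial `X_d^ℓ`, zero for all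
other monomials. -/
def momentTarget (d ℓ : ℕ) [NeZero d] (l : multiIdx d ℓ) : ℝ :=
  if l.1 = Pi.single (lastIdx d) ℓ then (ℓ.factorial : ℝ) else 0

/-- The weights solving the moment conditions at the configuration `x`, by Cramer's rule. -/
def cramerWeights (x : multiIdx d ℓ → Fin d → ℝ) (k : multiIdx d ℓ) : ℝ :=
  (vandermondeGrid x).det⁻¹ * Matrix.cramer (vandermondeGrid x) (momentTarget d ℓ) k

lemma contDiff_det {ι E : Type*} [Fintype ι] [DecidableEq ι] [NormedAddCommGroup E]
    [NormedSpace ℝ E] {A : E → Matrix ι ι ℝ} (hA : ∀ i j, ContDiff ℝ 1 fun x => A x i j) :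
    ContDiff ℝ 1 fun x => (A x).det := by
  simp only [Matrix.det_apply]
  exact ContDiff.sum fun σ _ => (contDiff_prod fun i _ => hA _ _).const_smul _

lemma sum_cramerWeights_mul {x : multiIdx d ℓ → Fin d → ℝ} (hx : (vandermondeGrid x).det ≠ 0)
    (l : multiIdx d ℓ) : ∑ k, cramerWeights x k * ∏ j, x k j ^ l.1 j = momentTarget d ℓ l := by
  have := congrFun (Matrix.mulVec_cramer (vandermondeGrid x) (momentTarget d ℓ)) l
  simp only [Matrix.mulVec, dotProduct, Pi.smul_apply, smul_eq_mul] at this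
  simp_rw [cramerWeights, mul_assoc]
  rw [← Finset.mul_sum, inv_mul_eq_iff_eq_mul₀ hx, ← this]
  exact Finset.sum_congr rfl fun k _ => mul_comm _ _

/-- Near the grid the moment conditions are solvable with weights depending Lipschitz
continuously on the configuration. -/
lemma exists_lipschitz_cramerWeights : ∃ (η C : ℝ), 0 < η ∧ 0 ≤ C ∧
    ∀ x : multiIdx d ℓ → Fin d → ℝ, (∀ k j, |x k j - gridPoint k j| ≤ η) →
      (vandermondeGrid x).det ≠ 0 ∧ ∀ r, (∀ k j, |x k j - gridPoint k j| ≤ r) → 0 ≤ r →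
        ∀ k, |cramerWeights x k - cramerWeights gridPoint k| ≤ C * r := by
  have hdet : ContDiff ℝ 1 fun x : multiIdx d ℓ → Fin d → ℝ => (vandermondeGrid x).det :=
    contDiff_det contDiff_vandermondeGrid
  have hcr : ContDiffAt ℝ 1 (fun x : multiIdx d ℓ → Fin d → ℝ => cramerWeights x) gridPoint := by
    rw [contDiffAt_pi]
    intro k
    refine ContDiffAt.mul (hdet.contDiffAt.inv det_vandermondeGrid_ne_zero) (ContDiff.contDiffAt ?_)
    simp only [Matrix.cramer_apply]
    refine contDiff_det fun i j => ?_
    simp only [Matrix.updateCol_apply]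
    split_ifs
    · exact contDiff_const
    · exact contDiff_vandermondeGrid i j
  obtain ⟨C, t, ht, hlip⟩ := hcr.exists_lipschitzOnWith
  have hne : ∀ᶠ x in nhds (gridPoint : multiIdx d ℓ → Fin d → ℝ), (vandermondeGrid x).det ≠ 0 :=
    hdet.continuous.continuousAt.eventually_ne det_vandermondeGrid_ne_zero
  obtain ⟨η, hη, hball⟩ := Metric.eventually_nhds_iff.1 (hne.and ht)
  refine ⟨η / 2, C, by positivity, C.2, fun x hx => ?_⟩
  have hdist : ∀ r, (∀ k j, |x k j - gridPoint k j| ≤ r) → 0 ≤ r → dist x gridPoint ≤ r := by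
    intro r h hr
    refine (dist_pi_le_iff hr).2 fun k => (dist_pi_le_iff hr).2 fun j => h k j
  have hx1 := hball (lt_of_le_of_lt (hdist _ hx (by positivity)) (by linarith))
  refine ⟨hx1.1, fun r h hr k => ?_⟩
  have h1 := hlip.dist_le_mul x hx1.2 gridPoint (mem_of_mem_nhds ht)
  calc |cramerWeights x k - cramerWeights gridPoint k| ≤ dist (cramerWeights x)
        (cramerWeights gridPoint) := dist_le_pi_dist (cramerWeights x) (cramerWeights gridPoint) k
    _ ≤ C * dist x gridPoint := h1
    _ ≤ C * r := mul_le_mul_of_nonneg_left (hdist r h hr) C.2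

end Existence

lemma tendsto_omega {γ : ℝ} (hγ : 0 < γ) : Filter.Tendsto (omega γ) Filter.atTop Filter.atTop :=
  tendsto_nat_floor_atTop.comp ((tendsto_rpow_atTop hγ).comp tendsto_natCast_atTop_atTop)

/-- The coordinates of the sites seen from the corner of the cell of `i`, at mesh size `ω_m / m`:
they form a perturbation of size `1 / ω_m` of the integer grid. -/
lemma site_add_mul_eq {d : ℕ} {m w : ℕ} (hm : 0 < m) (hw : 0 < w) (δ : (Fin d → ℕ) → Fin d → ℝ)
    (i k : Fin d → ℕ) (j : Fin d) :
    site m δ (fun j => i j + k j * w) j =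
      (w / m : ℝ) * (k j + δ (fun j => i j + k j * w) j / w) + ((i j : ℝ) - 1) / m := by
  have hm' : (m : ℝ) ≠ 0 := by positivity
  have hw' : (w : ℝ) ≠ 0 := by positivity
  simp only [site]
  push_cast
  field_simp
  ring

theorem exists_isDifferencing (d : ℕ) [NeZero d] (ℓ : ℕ) {γ : ℝ} (hγ : 0 < γ) :
    ∃ c cLim, IsDifferencing d ℓ γ c cLim := by
  classical
  obtain ⟨η, C, hη, hC, hmain⟩ := exists_lipschitz_cramerWeights (d := d) (ℓ := ℓ)
  let pt : ℕ → ((Fin d → ℕ) → Fin d → ℝ) → (Fin d → ℕ) → multiIdx d ℓ → Fin d → ℝ :=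
    fun m δ i k j => k.1 j + δ (fun j => i j + k.1 j * omega γ m) j / omega γ m
  refine ⟨fun m δ i k => if h : k ∈ multiIdx d ℓ then cramerWeights (pt m δ i) ⟨k, h⟩ else 0,
    fun k => if h : k ∈ multiIdx d ℓ then cramerWeights gridPoint (⟨k, h⟩ : multiIdx d ℓ) else 0, C, ?_⟩
  obtain ⟨m₁, hm₁⟩ := Filter.eventually_atTop.1 ((tendsto_omega hγ).eventually
    (Filter.eventually_ge_atTop (⌈1 / η⌉₊ + 1)))
  refine ⟨m₁ + 1, fun m hm δ hδ i hi => ?_⟩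
  have hω := hm₁ m (by omega)
  set w := omega γ m with hw
  have hw0 : 0 < w := by omega
  have hm0 : 0 < m := by omega
  have hwR : (0 : ℝ) < w := by exact_mod_cast hw0
  have hwη : 1 / (w : ℝ) ≤ η := by
    rw [div_le_comm₀ hwR hη]
    calc 1 / η ≤ ⌈1 / η⌉₊ := Nat.le_ceil _
      _ ≤ w := by exact_mod_cast (by omega : ⌈1 / η⌉₊ ≤ w)
  have hclose : ∀ k j, |pt m δ i k j - gridPoint k j| ≤ 1 / w := by
    intro k j
    have := hδ (fun j => i j + k.1 j * w) j
    simp only [pt, gridPoint, add_sub_cancel_left]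
    rw [abs_div, abs_of_pos hwR, abs_of_nonneg this.1]
    gcongr
    exact this.2.le
  obtain ⟨hdet, hlip⟩ := hmain (pt m δ i) fun k j => (hclose k j).trans hwη
  have hsite : ∀ (k : multiIdx d ℓ) j, site m δ (fun j => i j + k.1 j * w) j =
      (w / m : ℝ) * pt m δ i k j + ((i j : ℝ) - 1) / m := fun k j =>
    site_add_mul_eq hm0 hw0 δ i k.1 j
  -- moments in the original coordinates, expanded into moments of the rescaled configuration
  have hexp : ∀ l : Fin d → ℕ, ∑ j, l j ≤ ℓ → ∑ k : multiIdx d ℓ, cramerWeights (pt m δ i) k *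
      ∏ j, site m δ (fun j' => i j' + k.1 j' * w) j ^ l j =
      ∑ a ∈ Fintype.piFinset fun j => Finset.range (l j + 1),
        (∏ j, (w / m : ℝ) ^ a j * (((i j : ℝ) - 1) / m) ^ (l j - a j) * (l j).choose (a j)) *
          if a = Pi.single (lastIdx d) ℓ then (ℓ.factorial : ℝ) else 0 := by
    intro l hl
    simp_rw [hsite, prod_affine_pow_eq_sum, Finset.mul_sum]
    rw [Finset.sum_comm]
    refine Finset.sum_congr rfl fun a ha => ?_
    have hal : ∀ j, a j ≤ l j := fun j => by
      have := Fintype.mem_piFinset.1 ha j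
      simp at this; omega
    have haK : a ∈ multiIdx d ℓ := mem_multiIdx.2 fun j =>
      (hal j).trans ((Finset.single_le_sum (fun _ _ => Nat.zero_le _) (Finset.mem_univ j)).trans hl)
    have := sum_cramerWeights_mul hdet ⟨a, haK⟩
    simp_rw [mul_left_comm (cramerWeights _ _)]
    rw [← Finset.mul_sum, this, momentTarget]
  have hconv : ∀ f : (Fin d → ℕ) → ℝ, ∑ k ∈ multiIdx d ℓ,
      (if h : k ∈ multiIdx d ℓ then cramerWeights (pt m δ i) ⟨k, h⟩ else 0) * f k =
      ∑ k : multiIdx d ℓ, cramerWeights (pt m δ i) k * f k.1 := by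
    intro f
    rw [← Finset.sum_coe_sort (multiIdx d ℓ)]
    exact Finset.sum_congr rfl fun k _ => by rw [dif_pos k.2]
  refine ⟨?_, fun l hl hls => ?_, fun k hk => ?_⟩
  · have h1 := hexp (Pi.single (lastIdx d) ℓ) (by simp)
    have h2 : ∀ y : Fin d → ℝ, ∏ j, y j ^ (Pi.single (lastIdx d) ℓ : Fin d → ℕ) j =
        y (lastIdx d) ^ ℓ := fun y => by
      rw [Finset.prod_eq_single (lastIdx d)]
      · simp
      · intro j _ hj; simp [hj]
      · simp
    simp_rw [h2] at h1
    rw [hconv fun k => site m δ (fun j => i j + k j * w) (lastIdx d) ^ ℓ, h1,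
      Finset.sum_eq_single (Pi.single (lastIdx d) ℓ)]
    · rw [if_pos rfl, Finset.prod_congr rfl fun j _ => show _ = (w / m : ℝ) ^
        (Pi.single (lastIdx d) ℓ : Fin d → ℕ) j by simp]
      rw [h2 fun _ => (w / m : ℝ)]
      ring
    · intro a _ ha; rw [if_neg ha, mul_zero]
    · intro h; exact absurd (Fintype.mem_piFinset.2 fun j => by simp) h
  · rw [hconv fun k => ∏ j, site m δ (fun j' => i j' + k j' * w) j ^ l j, hexp l hls]
    refine Finset.sum_eq_zero fun a ha => ?_
    have hal := Fintype.mem_piFinset.1 ha (lastIdx d)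
    rw [if_neg, mul_zero]
    rintro rfl
    simp at hal
    omega
  · simp only [dif_pos hk]
    have := hlip (1 / w) hclose (by positivity) ⟨k, hk⟩
    rwa [mul_one_div] at this

lemma isDesign_zero {d : ℕ} : IsDesign (fun _ _ => 0 : (Fin d → ℕ) → Fin d → ℝ) :=
  fun _ _ => by simp

/-! ### Consequences of the differencing conditions -/

section Differencing

variable {d : ℕ} [NeZero d] {ℓ : ℕ} {γ : ℝ}
  {c : ℕ → ((Fin d → ℕ) → Fin d → ℝ) → (Fin d → ℕ) → (Fin d → ℕ) → ℝ} {cLim : (Fin d → ℕ) → ℝ}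

lemma tendsto_omega_div (hγ1 : γ < 1) :
    Filter.Tendsto (fun m : ℕ => (omega γ m : ℝ) / m) Filter.atTop (nhds 0) := by
  have h : Filter.Tendsto (fun m : ℕ => (m : ℝ) ^ (-(1 - γ))) Filter.atTop (nhds 0) :=
    (tendsto_rpow_neg_atTop (by linarith)).comp tendsto_natCast_atTop_atTop
  refine squeeze_zero' (Filter.Eventually.of_forall fun m => by positivity) ?_ h
  filter_upwards [Filter.eventually_gt_atTop 0] with m hm
  have hm' : (0 : ℝ) < m := by exact_mod_cast hm
  rw [div_le_iff₀ hm', neg_sub, Real.rpow_sub_one hm'.ne', div_mul_cancel₀ _ hm'.ne']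
  exact Nat.floor_le (by positivity)

lemma eventually_mul_omega_lt (hγ1 : γ < 1) (a : ℕ) :
    ∀ᶠ m : ℕ in Filter.atTop, a * omega γ m < m := by
  have h := ((tendsto_omega_div hγ1).const_mul (a : ℝ)).eventually
    (gt_mem_nhds (by simp : (a : ℝ) * 0 < 1))
  filter_upwards [h, Filter.eventually_gt_atTop 0] with m hm hm0
  have hm' : (0 : ℝ) < m := by exact_mod_cast hm0
  rw [← mul_div_assoc, div_lt_one hm'] at hm
  exact_mod_cast hm

/-- The moment conditions pass to the limit weights: evaluate them on the regular lattice, where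
the rescaled configuration is the integer grid. -/
lemma IsDifferencing.sum_cLim (h : IsDifferencing d ℓ γ c cLim) (hγ : 0 < γ) (hγ1 : γ < 1) :
    (∑ k ∈ multiIdx d ℓ, cLim k * (k (lastIdx d) : ℝ) ^ ℓ = ℓ.factorial) ∧
      Annihilates ℓ (multiIdx d ℓ) cLim (fun k j => (k j : ℝ)) := by
  obtain ⟨C, m₀, hm₀⟩ := h
  have hev : ∀ᶠ m : ℕ in Filter.atTop, 0 < m ∧ 0 < omega γ m ∧ m₀ ≤ m ∧
      1 ≤ m - ℓ * omega γ m := by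
    filter_upwards [Filter.eventually_gt_atTop 0, (tendsto_omega hγ).eventually
      (Filter.eventually_gt_atTop 0), Filter.eventually_ge_atTop m₀, eventually_mul_omega_lt hγ1 ℓ]
      with m h1 h2 h3 h4
    exact ⟨h1, h2, h3, by omega⟩
  set δ : (Fin d → ℕ) → Fin d → ℝ := fun _ _ => 0
  have hlim : ∀ k ∈ multiIdx d ℓ, Filter.Tendsto (fun m => c m δ (fun _ => 1) k) Filter.atTop
      (nhds (cLim k)) := by
    intro k hk
    rw [tendsto_iff_dist_tendsto_zero]
    have h0 : Filter.Tendsto (fun m => C / (omega γ m : ℝ)) Filter.atTop (nhds 0) :=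
      Filter.Tendsto.const_div_atTop (tendsto_natCast_atTop_atTop.comp (tendsto_omega hγ)) _
    refine squeeze_zero' (Filter.Eventually.of_forall fun _ => dist_nonneg) ?_ h0
    filter_upwards [hev] with m hm
    exact (hm₀ m hm.2.2.1 δ isDesign_zero _ (fun j => by simp; omega)).2.2 k hk
  have hsite : ∀ m, 0 < m → 0 < omega γ m → ∀ (k : Fin d → ℕ) j,
      site m δ (fun j => 1 + k j * omega γ m) j = (omega γ m / m : ℝ) * k j := by
    intro m hm hw k j
    rw [site_add_mul_eq hm hw δ (fun _ => 1) k j]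
    simp [δ]
  constructor
  · refine tendsto_nhds_unique (tendsto_finsetSum _ fun k hk => (hlim k hk).mul_const _)
      (tendsto_const_nhds.congr' ?_)
    filter_upwards [hev] with m hm
    have h1 := (hm₀ m hm.2.2.1 δ isDesign_zero (fun _ => 1) (fun j => by simp; omega)).1
    simp_rw [hsite m hm.1 hm.2.1, mul_pow, mul_left_comm (c _ _ _ _)] at h1
    rw [← Finset.mul_sum, mul_comm] at h1
    have hne : ((omega γ m : ℝ) / m) ^ ℓ ≠ 0 := by
      have h2 : (0 : ℝ) < omega γ m := by exact_mod_cast hm.2.1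
      have h3 : (0 : ℝ) < m := by exact_mod_cast hm.1
      positivity
    exact (mul_right_cancel₀ hne h1).symm
  · intro l hl
    refine tendsto_nhds_unique (tendsto_finsetSum _ fun k hk => (hlim k hk).mul_const _)
      (tendsto_const_nhds.congr' ?_)
    filter_upwards [hev] with m hm
    have h1 := (hm₀ m hm.2.2.1 δ isDesign_zero (fun _ => 1) (fun j => by simp; omega)).2.1 l
      (lt_of_le_of_lt (Finset.single_le_sum (fun _ _ => Nat.zero_le _) (Finset.mem_univ _)) hl) hl.le
    simp_rw [hsite m hm.1 hm.2.1, mul_pow, Finset.prod_mul_distrib,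
      mul_left_comm (c _ _ _ _)] at h1
    rw [← Finset.mul_sum] at h1
    have hne : ∏ j, ((omega γ m : ℝ) / m) ^ l j ≠ 0 := by
      have h2 : (0 : ℝ) < omega γ m := by exact_mod_cast hm.2.1
      have h3 : (0 : ℝ) < m := by exact_mod_cast hm.1
      positivity
    exact ((mul_eq_zero.1 h1).resolve_left hne).symm

lemma IsDifferencing.exists_cLim_ne_zero (h : IsDifferencing d ℓ γ c cLim) (hγ : 0 < γ)
    (hγ1 : γ < 1) : ∃ k ∈ multiIdx d ℓ, cLim k ≠ 0 := by
  by_contra! hc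
  have := (h.sum_cLim hγ hγ1).1
  rw [Finset.sum_eq_zero fun k hk => by rw [hc k hk, zero_mul]] at this
  exact ℓ.factorial_ne_zero (by exact_mod_cast this.symm)

end Differencing

/-! ### Differences of the regression functions -/

section Taylor

variable {d : ℕ}

/-- Mean value inequality along coordinate directions in the cube. -/
lemma abs_sub_le_of_partials {g : Loc d → ℝ} {g' : Fin d → Loc d → ℝ} {p x : Loc d} {r B : ℝ}
    (hp : p ∈ cube d) (hx : x ∈ cube d) (hr : 0 ≤ r) (hpx : ∀ k, |x k - p k| ≤ r)
    (hg : ∀ k, ∀ s ∈ cube d, (∀ i, |s i - p i| ≤ r) →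
      HasLineDerivWithinAt ℝ g (g' k s) (cube d) s (EuclideanSpace.single k 1) ∧ |g' k s| ≤ B) :
    |g x - g p| ≤ d * (B * r) := by
  -- move one coordinate
  have step : ∀ (k : Fin d) (y : Loc d) (b : ℝ), y ∈ cube d → (∀ i, |y i - p i| ≤ r) →
      y k = p k → y + b • EuclideanSpace.single k (1 : ℝ) ∈ cube d → |b| ≤ r →
      |g (y + b • EuclideanSpace.single k (1 : ℝ)) - g y| ≤ B * r := by
    intro k y b hy hyp hyk hb hbr
    have hcoord : ∀ (t : ℝ) (i : Fin d), (y + t • EuclideanSpace.single k (1 : ℝ)) i =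
        y i + if i = k then t else 0 := by
      intro t i
      simp
    have hmem : ∀ t ∈ uIcc 0 b, y + t • EuclideanSpace.single k (1 : ℝ) ∈ cube d ∧
        ∀ i, |(y + t • EuclideanSpace.single k (1 : ℝ)) i - p i| ≤ r := by
      intro t ht
      have htb : |t| ≤ |b| := by
        rcases le_total 0 b with h | h
        · rw [uIcc_of_le h] at ht
          rw [abs_of_nonneg ht.1, abs_of_nonneg h]; exact ht.2
        · rw [uIcc_of_ge h] at ht
          rw [abs_of_nonpos ht.2, abs_of_nonpos h]; linarith [ht.1]
      constructor
      · intro i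
        rw [hcoord]
        split_ifs with h
        · subst h
          have h1 := hy i
          have h2 := hb i
          rw [hcoord, if_pos rfl] at h2
          rcases le_total 0 b with h | h
          · rw [uIcc_of_le h] at ht
            exact ⟨by linarith [h1.1, ht.1], by linarith [h2.2, ht.2]⟩
          · rw [uIcc_of_ge h] at ht
            exact ⟨by linarith [h2.1, ht.1], by linarith [h1.2, ht.2]⟩
        · simpa using hy i
      · intro i
        rw [hcoord]
        split_ifs with h
        · subst h
          rw [hyk, add_sub_cancel_left]; exact htb.trans hbr
        · simpa using hyp i
    have hder : ∀ t ∈ uIcc 0 b, HasDerivWithinAt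
        (fun t : ℝ => g (y + t • EuclideanSpace.single k (1 : ℝ)))
        (g' k (y + t • EuclideanSpace.single k (1 : ℝ))) (uIcc 0 b) t := by
      intro t ht
      obtain ⟨h1, h2⟩ := hmem t ht
      have h3 := (hg k _ h1 h2).1
      unfold HasLineDerivWithinAt at h3
      have hshift : HasDerivWithinAt (fun u : ℝ => u - t) 1 (uIcc 0 b) t :=
        (hasDerivWithinAt_id t _).sub_const t
      have h4 := HasDerivWithinAt.scomp_of_eq (h := fun u : ℝ => u - t) (s := uIcc 0 b) t h3 hshift
        (fun u hu => by
          simp only [mem_preimage]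
          rw [add_assoc, ← add_smul, add_sub_cancel]
          exact (hmem u hu).1) (by simp)
      simp only [one_smul] at h4
      refine h4.congr_of_mem (fun u _ => ?_) ht
      simp only [Function.comp_apply]
      rw [add_assoc, ← add_smul, add_sub_cancel]
    have := Convex.norm_image_sub_le_of_norm_hasDerivWithin_le hder
      (fun t ht => (hg k _ (hmem t ht).1 (hmem t ht).2).2) (convex_uIcc 0 b) left_mem_uIcc
      right_mem_uIcc
    simp only [zero_smul, add_zero, sub_zero, Real.norm_eq_abs] at this
    have hB : 0 ≤ B := (abs_nonneg _).trans (hg k y hy hyp).2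
    exact this.trans (mul_le_mul_of_nonneg_left hbr hB)
  -- hybrid points taking the first `n` coordinates from `x`
  let Y : ℕ → Loc d := fun n => WithLp.toLp 2 fun i => if (i : ℕ) < n then x i else p i
  have hY : ∀ n, Y n ∈ cube d ∧ ∀ i, |Y n i - p i| ≤ r := by
    intro n
    constructor
    · intro i
      simp only [Y]
      split_ifs
      · exact hx i
      · exact hp i
    · intro i
      simp only [Y]
      split_ifs
      · exact hpx i
      · simpa using hr
  have hYs : ∀ n, n < d → |g (Y (n + 1)) - g (Y n)| ≤ B * r := by
    intro n hn
    have he : Y (n + 1) = Y n + (x ⟨n, hn⟩ - p ⟨n, hn⟩) • EuclideanSpace.single ⟨n, hn⟩ (1 : ℝ) := by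
      ext i
      simp only [Y, PiLp.add_apply, PiLp.smul_apply, PiLp.single_apply, smul_eq_mul]
      by_cases h1 : i = ⟨n, hn⟩
      · subst h1; simp
      · have h2 : (i : ℕ) ≠ n := fun h => h1 (Fin.ext h)
        have h3 : (i : ℕ) < n + 1 ↔ (i : ℕ) < n := by omega
        simp [h1, h3]
    rw [he]
    refine step _ _ _ (hY n).1 (hY n).2 (by simp [Y]) ?_ (hpx _)
    rw [← he]; exact (hY (n + 1)).1
  have hY0 : Y 0 = p := by ext i; simp [Y]
  have hYd : Y d = x := by ext i; simp [Y]
  have htel := Finset.sum_range_sub (fun n => g (Y n)) d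
  simp only [hY0, hYd] at htel
  rw [← htel]
  refine (Finset.abs_sum_le_sum_abs _ _).trans ?_
  refine (Finset.sum_le_sum fun n hn => hYs n (Finset.mem_range.1 hn)).trans ?_
  simp

/-- The normalised monomial `∏ᵢ (xᵢ - pᵢ)^{lᵢ} / lᵢ!`. -/
def taylorMonomial (p : Loc d) (l : Fin d → ℕ) (x : Loc d) : ℝ :=
  ∏ i, (x i - p i) ^ l i / ((l i).factorial : ℝ)

/-- The multi-indices of degree less than `M`. -/
def degreeLT (d M : ℕ) : Finset (Fin d → ℕ) :=
  (Fintype.piFinset fun _ => Finset.range M).filter fun l => ∑ i, l i < M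

lemma mem_degreeLT {M : ℕ} {l : Fin d → ℕ} : l ∈ degreeLT d M ↔ ∑ i, l i < M := by
  simp only [degreeLT, Finset.mem_filter, Fintype.mem_piFinset, Finset.mem_range, and_iff_right_iff_imp]
  exact fun h i => lt_of_le_of_lt (Finset.single_le_sum (fun _ _ => Nat.zero_le _)
    (Finset.mem_univ i)) h

/-- The `j`-th partial derivative of the Taylor polynomial of degree less than `N` at `p` with
coefficients `a`. -/
def taylorPoly (N : ℕ) (a : (Fin d → ℕ) → ℝ) (p : Loc d) (j : Fin d → ℕ) (x : Loc d) : ℝ :=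
  ∑ l ∈ degreeLT d (N - ∑ i, j i), a (j + l) * taylorMonomial p l x

lemma hasDerivAt_taylorMonomial (p x : Loc d) (l : Fin d → ℕ) (k : Fin d) :
    HasDerivAt (fun t : ℝ => taylorMonomial p l (x + t • EuclideanSpace.single k (1 : ℝ)))
      (if l k = 0 then 0 else taylorMonomial p (l - Pi.single k 1) x) 0 := by
  have hsplit : ∀ (l : Fin d → ℕ) (y : Loc d), taylorMonomial p l y =
      (y k - p k) ^ l k / ((l k).factorial : ℝ) *
        ∏ i ∈ Finset.univ.erase k, (y i - p i) ^ l i / ((l i).factorial : ℝ) := fun l y => by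
    rw [taylorMonomial, Finset.mul_prod_erase _ (fun i => (y i - p i) ^ l i / ((l i).factorial : ℝ))
      (Finset.mem_univ k)]
  have hfun : (fun t : ℝ => taylorMonomial p l (x + t • EuclideanSpace.single k (1 : ℝ))) =
      fun t => (x k + t - p k) ^ l k / ((l k).factorial : ℝ) *
        ∏ i ∈ Finset.univ.erase k, (x i - p i) ^ l i / ((l i).factorial : ℝ) := by
    ext t
    rw [hsplit]
    congr 1
    · simp
    · refine Finset.prod_congr rfl fun i hi => ?_
      simp [Finset.ne_of_mem_erase hi]
  rw [hfun]
  have hbase : HasDerivAt (fun t : ℝ => x k + t - p k) 1 0 :=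
    ((hasDerivAt_id (0 : ℝ)).const_add (x k)).sub_const (p k)
  have h := ((hbase.pow (l k)).div_const ((l k).factorial : ℝ)).mul_const
    (∏ i ∈ Finset.univ.erase k, (x i - p i) ^ l i / ((l i).factorial : ℝ))
  refine h.congr_deriv ?_
  split_ifs with h0
  · simp [h0]
  · obtain ⟨b, hb⟩ := Nat.exists_eq_succ_of_ne_zero h0
    rw [hsplit]
    have hk : (l - Pi.single k 1 : Fin d → ℕ) k = b := by simp [hb]
    have hi : ∏ i ∈ Finset.univ.erase k, (x i - p i) ^ (l - Pi.single k 1 : Fin d → ℕ) i /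
        (((l - Pi.single k 1 : Fin d → ℕ) i).factorial : ℝ) =
        ∏ i ∈ Finset.univ.erase k, (x i - p i) ^ l i / ((l i).factorial : ℝ) := by
      refine Finset.prod_congr rfl fun i hi => ?_
      simp [Finset.ne_of_mem_erase hi]
    rw [hi, hk, hb, Nat.succ_eq_add_one, Nat.factorial_succ]
    have hf : (b.factorial : ℝ) ≠ 0 := by exact_mod_cast b.factorial_ne_zero
    have hb1 : ((b : ℝ) + 1) ≠ 0 := by positivity
    push_cast
    simp only [add_zero]
    field_simp

lemma hasDerivAt_taylorPoly (N : ℕ) (a : (Fin d → ℕ) → ℝ) (p x : Loc d) (j : Fin d → ℕ)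
    (k : Fin d) (hj : ∑ i, j i < N) :
    HasDerivAt (fun t : ℝ => taylorPoly N a p j (x + t • EuclideanSpace.single k (1 : ℝ)))
      (taylorPoly N a p (j + Pi.single k 1) x) 0 := by
  have h := HasDerivAt.fun_sum (u := degreeLT d (N - ∑ i, j i))
    fun l _ => (hasDerivAt_taylorMonomial p x l k).const_mul (a (j + l))
  refine h.congr_deriv ?_
  have hsum : ∑ i, (j + Pi.single k 1 : Fin d → ℕ) i = ∑ i, j i + 1 := by
    simp [Finset.sum_add_distrib]
  have hsumk : ∀ l : Fin d → ℕ, ∑ i, (l + Pi.single k 1 : Fin d → ℕ) i = ∑ i, l i + 1 := fun l => by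
    simp [Finset.sum_add_distrib]
  rw [taylorPoly, hsum]
  have hne : ∑ l ∈ degreeLT d (N - ∑ i, j i), a (j + l) *
      (if l k = 0 then 0 else taylorMonomial p (l - Pi.single k 1) x) =
      ∑ l ∈ (degreeLT d (N - ∑ i, j i)).filter (fun l => l k ≠ 0), a (j + l) *
        taylorMonomial p (l - Pi.single k 1) x := by
    rw [Finset.sum_filter]
    refine Finset.sum_congr rfl fun l _ => ?_
    by_cases h : l k = 0 <;> simp [h]
  rw [hne]
  have hback : ∀ l : Fin d → ℕ, l k ≠ 0 → l - Pi.single k 1 + Pi.single k 1 = l := by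
    intro l hl
    ext i
    by_cases h : i = k
    · subst h; simp; omega
    · simp [h]
  refine Finset.sum_nbij' (fun l => l - Pi.single k 1) (fun l => l + Pi.single k 1) ?_ ?_ ?_ ?_ ?_
  · intro l hl
    rw [Finset.mem_filter, mem_degreeLT] at hl
    rw [mem_degreeLT]
    have := hsumk (l - Pi.single k 1)
    rw [hback l hl.2] at this
    omega
  · intro l hl
    rw [mem_degreeLT] at hl
    rw [Finset.mem_filter, mem_degreeLT, hsumk]
    exact ⟨by omega, by simp⟩
  · intro l hl
    exact hback l (Finset.mem_filter.1 hl).2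
  · intro l _
    ext i; simp
  · intro l hl
    rw [add_assoc, add_comm (Pi.single k 1), hback l (Finset.mem_filter.1 hl).2]

lemma taylorPoly_self (N : ℕ) (a : (Fin d → ℕ) → ℝ) (p : Loc d) (j : Fin d → ℕ)
    (hj : ∑ i, j i < N) : taylorPoly N a p j p = a j := by
  rw [taylorPoly, Finset.sum_eq_single 0]
  · simp [taylorMonomial]
  · intro l _ hl
    obtain ⟨i, hi⟩ := Function.ne_iff.1 hl
    rw [taylorMonomial, Finset.prod_eq_zero (Finset.mem_univ i), mul_zero]
    simp only [sub_self, Pi.zero_apply] at hi ⊢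
    rw [zero_pow hi, zero_div]
  · intro h
    exact absurd (mem_degreeLT.2 (by simpa using hj)) h

/-- Weights annihilating polynomials of degree less than `N` map a function with bounded partial
derivatives up to order `N` to `O(r^N)`, where `r` is the diameter of the configuration. -/
theorem HasBoundedPartials.abs_sum_le {N : ℕ} {C : ℝ} {f : Loc d → ℝ}
    (hf : HasBoundedPartials N C f) {κ : Type*} {K : Finset κ} {w : κ → ℝ} {x : κ → Loc d}
    (hw : Annihilates N K w (fun k => x k)) {p : Loc d} (hp : p ∈ cube d)
    (hx : ∀ k ∈ K, x k ∈ cube d) {r : ℝ} (hr : 0 ≤ r) (hxp : ∀ k ∈ K, ∀ i, |x k i - p i| ≤ r) :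
    |∑ k ∈ K, w k * f (x k)| ≤ (∑ k ∈ K, |w k|) * (C * (d * r) ^ N) := by
  obtain ⟨D, hD0, hD, hDb⟩ := hf
  set a : (Fin d → ℕ) → ℝ := fun j => D j p
  have main : ∀ M ≤ N, ∀ j : Fin d → ℕ, ∑ i, j i + M = N → ∀ y ∈ cube d,
      (∀ i, |y i - p i| ≤ r) → |D j y - taylorPoly N a p j y| ≤ C * (d * r) ^ M := by
    intro M
    induction M with
    | zero =>
      intro _ j hj y hy _
      have : taylorPoly N a p j y = 0 := by
        rw [taylorPoly, ← hj]
        refine Finset.sum_eq_zero fun l hl => ?_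
        have := mem_degreeLT.1 hl
        omega
      rw [this, sub_zero, pow_zero, mul_one]
      exact hDb j (by omega) y hy
    | succ M ih =>
      intro hM j hj y hy hyp
      have hjN : ∑ i, j i < N := by omega
      have h := abs_sub_le_of_partials (g := fun y => D j y - taylorPoly N a p j y)
        (g' := fun k y => D (j + Pi.single k 1) y - taylorPoly N a p (j + Pi.single k 1) y)
        (B := C * (d * r) ^ M) hp hy hr hyp (fun k s hs hsp => by
          refine ⟨?_, ih (by omega) _ (by simp [Finset.sum_add_distrib]; omega) s hs hsp⟩
          have h1 := hD j hjN k s hs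
          have h2 := (hasDerivAt_taylorPoly N a p s j k hjN).hasDerivWithinAt
            (s := (fun t : ℝ => s + t • EuclideanSpace.single k (1 : ℝ)) ⁻¹' cube d)
          exact HasDerivWithinAt.sub h1 h2)
      rw [taylorPoly_self N a p j hjN, sub_self, sub_zero] at h
      refine h.trans (le_of_eq ?_)
      rw [pow_succ]; ring
  have hT : ∑ k ∈ K, w k * taylorPoly N a p 0 (x k) = 0 := by
    simp only [taylorPoly, Finset.mul_sum]
    rw [Finset.sum_comm]
    refine Finset.sum_eq_zero fun l hl => ?_
    have hl' : ∑ i, l i < N := by simpa using mem_degreeLT.1 hl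
    have := hw.sub p l hl'
    simp only [taylorMonomial, Finset.prod_div_distrib]
    simp_rw [mul_left_comm (w _), ← mul_div_assoc]
    rw [← Finset.sum_div, ← Finset.mul_sum, this, mul_zero, zero_div]
  have heq : ∑ k ∈ K, w k * f (x k) = ∑ k ∈ K, w k * (D 0 (x k) - taylorPoly N a p 0 (x k)) := by
    simp_rw [mul_sub, Finset.sum_sub_distrib]
    rw [hT, sub_zero]
    exact Finset.sum_congr rfl fun k hk => by rw [hD0 _ (hx k hk)]
  rw [heq, Finset.sum_mul]
  refine (Finset.abs_sum_le_sum_abs _ _).trans (Finset.sum_le_sum fun k hk => ?_)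
  rw [abs_mul]
  exact mul_le_mul_of_nonneg_left (main N le_rfl 0 (by simp) _ (hx k hk) (hxp k hk)) (abs_nonneg _)

end Taylor

/-! ### Geometry of the differencing configurations -/

section Geometry

variable {d ℓ w m : ℕ} {δ : (Fin d → ℕ) → Fin d → ℝ}
  {a : (Fin d → ℕ) → (Fin d → ℕ) → ℝ} {cLim : (Fin d → ℕ) → ℝ} {B η : ℝ}

/-- The indices `i` for which all the sites `i + k w` of a difference lie in the design. -/
def gridIdx (d ℓ w m : ℕ) : Finset (Fin d → ℕ) :=
  Fintype.piFinset fun _ => Finset.Icc 1 (m - ℓ * w)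

lemma mem_gridIdx {i : Fin d → ℕ} : i ∈ gridIdx d ℓ w m ↔ ∀ j, 1 ≤ i j ∧ i j ≤ m - ℓ * w := by
  simp [gridIdx, Fintype.mem_piFinset]

/-- The site of index `i + k w`, seen at mesh size `w / m`. -/
def scaledSite (w : ℕ) (δ : (Fin d → ℕ) → Fin d → ℝ) (i k : Fin d → ℕ) : Loc d :=
  WithLp.toLp 2 fun j => (k j : ℝ) + δ (fun j => i j + k j * w) j / w + ((i j : ℝ) - 1) / w

/-- The corner of the cell of index `i`, seen at mesh size `w / m`. -/
def scaledCorner (w : ℕ) (i : Fin d → ℕ) : Loc d :=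
  WithLp.toLp 2 fun j => ((i j : ℝ) - 1) / w

/-- The integer vector `k` as a point of the Euclidean space. -/
def latticePoint (k : Fin d → ℕ) : Loc d := WithLp.toLp 2 fun j => (k j : ℝ)

/-- The deterministic properties of a differencing array on a design with `m^d` cells and
lag `w`, with tolerance `η`, used in the moment computations. -/
structure IsRegular (d ℓ w m : ℕ) (δ : (Fin d → ℕ) → Fin d → ℝ)
    (a : (Fin d → ℕ) → (Fin d → ℕ) → ℝ) (cLim : (Fin d → ℕ) → ℝ) (B η : ℝ) : Prop where
  design : IsDesign δ
  two_le : 2 ≤ w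
  room : 4 * (ℓ * w) + 2 ≤ m
  ann : ∀ i ∈ gridIdx d ℓ w m, Annihilates ℓ (multiIdx d ℓ) (a i)
    (fun k => site m δ (fun j => i j + k j * w))
  bound : ∀ i ∈ gridIdx d ℓ w m, ∑ k ∈ multiIdx d ℓ, |a i k| ≤ B
  close : ∀ i ∈ gridIdx d ℓ w m, ∀ k ∈ multiIdx d ℓ, |a i k - cLim k| < η
  small : 2 * (d : ℝ) < η * w

/-- For large `m` differencing arrays are regular, uniformly in the design. -/
lemma IsDifferencing.eventually_isRegular [NeZero d] {γ : ℝ} (hγ : 0 < γ) (hγ1 : γ < 1)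
    {c : ℕ → ((Fin d → ℕ) → Fin d → ℝ) → (Fin d → ℕ) → (Fin d → ℕ) → ℝ}
    (h : IsDifferencing d ℓ γ c cLim) : ∃ B : ℝ, 0 < B ∧ ∀ η > 0, ∀ᶠ m in Filter.atTop,
      ∀ δ, IsDesign δ → IsRegular d ℓ (omega γ m) m δ (c m δ) cLim B η := by
  obtain ⟨C, m₀, hm₀⟩ := h
  refine ⟨∑ k ∈ multiIdx d ℓ, (|cLim k| + 1), Finset.sum_pos (fun _ _ => by positivity)
    ⟨0, mem_multiIdx.2 fun j => by simp⟩, fun η hη => ?_⟩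
  have h0 : Filter.Tendsto (fun m => C / (omega γ m : ℝ)) Filter.atTop (nhds 0) :=
    Filter.Tendsto.const_div_atTop (tendsto_natCast_atTop_atTop.comp (tendsto_omega hγ)) _
  have h1 : Filter.Tendsto (fun m => 2 * (d : ℝ) / (omega γ m : ℝ)) Filter.atTop (nhds 0) :=
    Filter.Tendsto.const_div_atTop (tendsto_natCast_atTop_atTop.comp (tendsto_omega hγ)) _
  filter_upwards [Filter.eventually_ge_atTop m₀, (tendsto_omega hγ).eventually
    (Filter.eventually_ge_atTop 2), eventually_mul_omega_lt hγ1 (4 * ℓ + 1),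
    h0.eventually (gt_mem_nhds hη), h0.eventually (gt_mem_nhds one_pos),
    h1.eventually (gt_mem_nhds hη)] with m hm hw hroom hCη hC1 hdη δ hδ
  have hi : ∀ i ∈ gridIdx d ℓ (omega γ m) m, ∀ k, i k ∈ Finset.Icc 1 (m - ℓ * omega γ m) :=
    fun i hi k => Finset.mem_Icc.2 (mem_gridIdx.1 hi k)
  have hwR : (0 : ℝ) < omega γ m := by exact_mod_cast (by omega : 0 < omega γ m)
  refine ⟨hδ, hw, ?_, fun i hi' l hl => ?_, fun i hi' => ?_, fun i hi' k hk => ?_, ?_⟩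
  · have : (4 * ℓ + 1) * omega γ m = 4 * (ℓ * omega γ m) + omega γ m := by ring
    omega
  · exact (hm₀ m hm δ hδ i (hi i hi')).2.1 l
      (lt_of_le_of_lt (Finset.single_le_sum (fun _ _ => Nat.zero_le _) (Finset.mem_univ _)) hl) hl.le
  · refine Finset.sum_le_sum fun k hk => ?_
    have h2 := (hm₀ m hm δ hδ i (hi i hi')).2.2 k hk
    have h3 := abs_sub_abs_le_abs_sub (c m δ i k) (cLim k)
    linarith
  · exact ((hm₀ m hm δ hδ i (hi i hi')).2.2 k hk).trans_lt hCη
  · rwa [div_lt_iff₀ hwR] at hdη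

lemma site_eq_smul_scaledSite (hm : 0 < m) (hw : 0 < w) (δ : (Fin d → ℕ) → Fin d → ℝ)
    (i k : Fin d → ℕ) :
    site m δ (fun j => i j + k j * w) = ((w : ℝ) / m) • scaledSite w δ i k := by
  ext j
  rw [site_add_mul_eq hm hw]
  have hw' : (w : ℝ) ≠ 0 := by positivity
  have hm' : (m : ℝ) ≠ 0 := by positivity
  simp only [scaledSite, PiLp.smul_apply, smul_eq_mul]
  field_simp

lemma site_injective (hm : 0 < m) (hδ : IsDesign δ) : Function.Injective (site m δ) := by
  intro i i' h
  have hm' : (0 : ℝ) < m := by exact_mod_cast hm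
  ext j
  have hj : site m δ i j = site m δ i' j := by rw [h]
  simp only [site] at hj
  rw [← add_div, ← add_div, div_left_inj' hm'.ne'] at hj
  obtain ⟨h1, h2⟩ := hδ i j
  obtain ⟨h3, h4⟩ := hδ i' j
  have h5 : (i j : ℝ) < i' j + 1 := by linarith
  have h6 : (i' j : ℝ) < i j + 1 := by linarith
  norm_cast at h5 h6
  omega

lemma site_mem_cube (hm : 0 < m) (hδ : IsDesign δ) {i : Fin d → ℕ}
    (hi : ∀ j, 1 ≤ i j ∧ i j ≤ m) : site m δ i ∈ cube d := by
  intro j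
  have hm' : (0 : ℝ) < m := by exact_mod_cast hm
  obtain ⟨h1, h2⟩ := hδ i j
  have h3 : (1 : ℝ) ≤ i j := by exact_mod_cast (hi j).1
  have h4 : (i j : ℝ) ≤ m := by exact_mod_cast (hi j).2
  simp only [site]
  rw [← add_div, Set.mem_Icc, le_div_iff₀ hm', div_le_iff₀ hm']
  constructor <;> linarith

lemma norm_le_sum_abs (x : Loc d) : ‖x‖ ≤ ∑ j, |x j| := by
  rw [EuclideanSpace.norm_eq]
  refine Real.sqrt_le_iff.2 ⟨Finset.sum_nonneg fun _ _ => abs_nonneg _, ?_⟩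
  simpa using Finset.sum_sq_le_sq_sum_of_nonneg (s := Finset.univ) (f := fun j => |x j|)
    fun _ _ => abs_nonneg _

lemma norm_scaledSite_sub_scaledCorner_le (hδ : IsDesign δ) (hw : 0 < w) (i : Fin d → ℕ)
    {k : Fin d → ℕ} (hk : k ∈ multiIdx d ℓ) :
    ‖scaledSite w δ i k - scaledCorner w i‖ ≤ d * (ℓ + 1) := by
  refine (norm_le_sum_abs _).trans ?_
  have hw' : (1 : ℝ) ≤ w := by exact_mod_cast hw
  calc ∑ j, |(scaledSite w δ i k - scaledCorner w i) j| ≤ ∑ _j : Fin d, ((ℓ : ℝ) + 1) := by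
        refine Finset.sum_le_sum fun j _ => ?_
        obtain ⟨h1, h2⟩ := hδ (fun j => i j + k j * w) j
        have h3 : (k j : ℝ) ≤ ℓ := by exact_mod_cast mem_multiIdx.1 hk j
        have h4 : δ (fun j => i j + k j * w) j / w ≤ 1 := by
          rw [div_le_one (by linarith)]; linarith
        have h5 : 0 ≤ δ (fun j => i j + k j * w) j / w := by positivity
        simp only [scaledSite, scaledCorner, PiLp.sub_apply, add_sub_cancel_right]
        rw [abs_of_nonneg (by positivity)]
        linarith
    _ = d * (ℓ + 1) := by simp [mul_add]

/-- Up to a common shift, the scaled sites of `i + u`, `u` a `0`-`1` vector, are within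
`2 d / w` of the integer grid. -/
lemma norm_scaledSite_sub_latticePoint_le (hδ : IsDesign δ) (hw : 0 < w) (i u k : Fin d → ℕ)
    (hu : ∀ j, u j ≤ 1) :
    ‖scaledSite w δ (i + u) k - scaledCorner w i - latticePoint k‖ ≤ 2 * d / w := by
  refine (norm_le_sum_abs _).trans ?_
  have hw' : (0 : ℝ) < w := by exact_mod_cast hw
  calc ∑ j, |(scaledSite w δ (i + u) k - scaledCorner w i - latticePoint k) j|
      ≤ ∑ _j : Fin d, (2 : ℝ) / w := by
        refine Finset.sum_le_sum fun j _ => ?_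
        obtain ⟨h1, h2⟩ := hδ (fun j => (i + u) j + k j * w) j
        have h3 : (u j : ℝ) ≤ 1 := by exact_mod_cast hu j
        have : (scaledSite w δ (i + u) k - scaledCorner w i - latticePoint k) j =
            (δ (fun j => (i + u) j + k j * w) j + u j) / w := by
          simp only [scaledSite, scaledCorner, latticePoint, PiLp.sub_apply, Pi.add_apply]
          push_cast
          ring
        rw [this, abs_of_nonneg (by positivity)]
        gcongr
        linarith
    _ = 2 * d / w := by simp; ring

/-- The total weight of common sites of the differences at `i` and `i'`: the nugget contributes
`τ` times this number to their covariance. -/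
def overlap (ℓ w : ℕ) (a : (Fin d → ℕ) → (Fin d → ℕ) → ℝ) (i i' : Fin d → ℕ) : ℝ :=
  ∑ k ∈ multiIdx d ℓ, ∑ k' ∈ multiIdx d ℓ, a i k * a i' k' *
    if (fun j => i j + k j * w) = (fun j => i' j + k' j * w) then 1 else 0

lemma overlap_self (hw : 0 < w) (i : Fin d → ℕ) :
    overlap ℓ w a i i = ∑ k ∈ multiIdx d ℓ, a i k ^ 2 := by
  refine Finset.sum_congr rfl fun k hk => ?_
  rw [Finset.sum_eq_single k, if_pos rfl]
  · ring
  · intro k' _ hne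
    rw [if_neg, mul_zero]
    intro h
    refine hne (funext fun j => ?_)
    have := congrFun h j
    simp only [Nat.add_left_cancel_iff] at this
    exact (Nat.eq_of_mul_eq_mul_right hw this).symm
  · exact fun h => absurd hk h

/-- Differences whose indices differ by a unit vector have no site in common. -/
lemma overlap_add_single (hw : 2 ≤ w) (i : Fin d → ℕ) (j : Fin d) :
    overlap ℓ w a i (i + Pi.single j 1) = 0 := by
  refine Finset.sum_eq_zero fun k _ => Finset.sum_eq_zero fun k' _ => ?_
  rw [if_neg, mul_zero]
  intro h
  have := congrFun h j
  simp only [Pi.add_apply, Pi.single_eq_same] at this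
  have h1 : k j * w = 1 + k' j * w := by omega
  have h2 : w ∣ 1 := (Nat.dvd_add_left (Dvd.intro_left (k' j) rfl)).1
    (h1 ▸ Dvd.intro_left (k j) rfl)
  have := Nat.le_of_dvd one_pos h2
  omega

lemma abs_overlap_le {i i' : Fin d → ℕ} : |overlap ℓ w a i i'| ≤
    ∑ k ∈ multiIdx d ℓ, ∑ k' ∈ multiIdx d ℓ, |a i k| * |a i' k'| *
      if (fun j => i j + k j * w) = (fun j => i' j + k' j * w) then 1 else 0 := by
  refine (Finset.abs_sum_le_sum_abs _ _).trans (Finset.sum_le_sum fun k _ => ?_)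
  refine (Finset.abs_sum_le_sum_abs _ _).trans (Finset.sum_le_sum fun k' _ => ?_)
  rw [abs_mul, abs_mul]
  split_ifs <;> simp

/-- Each difference shares sites with boundedly many others. -/
lemma IsRegular.sum_sq_overlap_le (h : IsRegular d ℓ w m δ a cLim B η) {i : Fin d → ℕ}
    (hi : i ∈ gridIdx d ℓ w m) : ∑ i' ∈ gridIdx d ℓ w m, overlap ℓ w a i i' ^ 2 ≤
      (multiIdx d ℓ).card * B ^ 4 := by
  have hB : 0 ≤ B := (Finset.sum_nonneg fun _ _ => abs_nonneg _).trans (h.bound i hi)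
  have h1 : ∀ i' ∈ gridIdx d ℓ w m, |overlap ℓ w a i i'| ≤ B ^ 2 := by
    intro i' hi'
    refine abs_overlap_le.trans ?_
    calc _ ≤ ∑ k ∈ multiIdx d ℓ, ∑ k' ∈ multiIdx d ℓ, |a i k| * |a i' k'| := by
          refine Finset.sum_le_sum fun k _ => Finset.sum_le_sum fun k' _ => ?_
          split_ifs
          · simp
          · rw [mul_zero]; positivity
      _ = (∑ k ∈ multiIdx d ℓ, |a i k|) * ∑ k ∈ multiIdx d ℓ, |a i' k| :=
          (Finset.sum_mul_sum _ _ _ _).symm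
      _ ≤ B * B := mul_le_mul (h.bound i hi) (h.bound i' hi')
          (Finset.sum_nonneg fun _ _ => abs_nonneg _) hB
      _ = B ^ 2 := by ring
  have h2 : ∑ i' ∈ gridIdx d ℓ w m, |overlap ℓ w a i i'| ≤ (multiIdx d ℓ).card * B ^ 2 := by
    calc _ ≤ ∑ i' ∈ gridIdx d ℓ w m, ∑ k ∈ multiIdx d ℓ, ∑ k' ∈ multiIdx d ℓ, |a i k| * B *
          (if (fun j => i j + k j * w) = (fun j => i' j + k' j * w) then 1 else 0) := by
          refine Finset.sum_le_sum fun i' hi' => abs_overlap_le.trans ?_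
          refine Finset.sum_le_sum fun k _ => Finset.sum_le_sum fun k' hk' => ?_
          gcongr
          exact (Finset.single_le_sum (f := fun k => |a i' k|) (fun _ _ => abs_nonneg _) hk').trans
            (h.bound i' hi')
      _ = ∑ k ∈ multiIdx d ℓ, ∑ k' ∈ multiIdx d ℓ, ∑ i' ∈ gridIdx d ℓ w m, |a i k| * B *
          (if (fun j => i j + k j * w) = (fun j => i' j + k' j * w) then 1 else 0) := by
          rw [Finset.sum_comm]
          exact Finset.sum_congr rfl fun k _ => Finset.sum_comm
      _ ≤ ∑ k ∈ multiIdx d ℓ, ∑ _k' ∈ multiIdx d ℓ, |a i k| * B := by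
          refine Finset.sum_le_sum fun k _ => Finset.sum_le_sum fun k' _ => ?_
          rw [← Finset.mul_sum]
          refine mul_le_of_le_one_right (by positivity) ?_
          rw [Finset.sum_boole]
          norm_cast
          refine Finset.card_le_one.2 fun x hx y hy => ?_
          have hx := (Finset.mem_filter.1 hx).2
          have hy := (Finset.mem_filter.1 hy).2
          refine funext fun j => ?_
          have := congrFun (hx.symm.trans hy) j
          simpa using this
      _ = (multiIdx d ℓ).card * ((∑ k ∈ multiIdx d ℓ, |a i k|) * B) := by
          simp only [Finset.sum_const, nsmul_eq_mul, ← Finset.mul_sum, Finset.sum_mul]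
      _ ≤ (multiIdx d ℓ).card * B ^ 2 := by
          rw [pow_two]
          gcongr
          exact h.bound i hi
  calc _ ≤ ∑ i' ∈ gridIdx d ℓ w m, B ^ 2 * |overlap ℓ w a i i'| := by
        refine Finset.sum_le_sum fun i' hi' => ?_
        rw [← sq_abs, pow_two]
        exact mul_le_mul_of_nonneg_right (h1 i' hi') (abs_nonneg _)
    _ ≤ B ^ 2 * ((multiIdx d ℓ).card * B ^ 2) := by
        rw [← Finset.mul_sum]
        exact mul_le_mul_of_nonneg_left h2 (by positivity)
    _ = (multiIdx d ℓ).card * B ^ 4 := by ring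

lemma sum_comp_dist_le (f : ℕ → ℝ) (hf : ∀ t, 0 ≤ f t) (a N : ℕ) (ha : a ≤ N) :
    ∑ b ∈ Finset.Icc 1 N, f ((a - b) + (b - a)) ≤ 2 * ∑ t ∈ Finset.range (N + 1), f t := by
  have hpart : ∀ s : Finset ℕ, Set.InjOn (fun b => (a - b) + (b - a)) s →
      (∀ b ∈ s, b ≤ N) → ∑ b ∈ s, f ((a - b) + (b - a)) ≤ ∑ t ∈ Finset.range (N + 1), f t := by
    intro s hs hsN
    rw [← Finset.sum_image (f := f) hs]
    refine Finset.sum_le_sum_of_subset_of_nonneg (fun t ht => ?_) fun _ _ _ => hf _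
    obtain ⟨b, hb, rfl⟩ := Finset.mem_image.1 ht
    have := hsN b hb
    simp; omega
  rw [← Finset.sum_filter_add_sum_filter_not _ (fun b => b ≤ a), two_mul]
  refine add_le_add (hpart _ ?_ ?_) (hpart _ ?_ ?_)
  · intro x hx y hy hxy
    simp at hx hy hxy; omega
  · intro x hx; simp at hx; omega
  · intro x hx y hy hxy
    simp at hx hy hxy; omega
  · intro x hx; simp at hx; omega

lemma sum_range_inv_sq_le (hw : 2 ≤ w) (N : ℕ) :
    ∑ t ∈ Finset.range N, ((1 + (t : ℝ) / w)⁻¹) ^ 2 ≤ 2 * w := by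
  have hw' : (2 : ℝ) ≤ w := by exact_mod_cast hw
  have h : ∑ t ∈ Finset.range N, ((1 + (t : ℝ) / w)⁻¹) ^ 2 ≤
      (w : ℝ) ^ 2 * (1 / (w - 1) - 1 / (w + N - 1)) := by
    induction N with
    | zero => simp
    | succ N ih =>
      rw [Finset.sum_range_succ]
      refine (add_le_add_left ih _).trans ?_
      have h1 : (0 : ℝ) < w + N - 1 := by have : (0 : ℝ) ≤ N := by positivity
                                          linarith
      have h2 : ((1 + (N : ℝ) / w)⁻¹) ^ 2 = (w : ℝ) ^ 2 * (1 / (w + N) ^ 2) := by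
        field_simp
      have h3 : (1 : ℝ) / (w + N) ^ 2 ≤ 1 / (w + N - 1) - 1 / (w + (N + 1 : ℕ) - 1) := by
        have h4 : (0 : ℝ) < w + (N + 1 : ℕ) - 1 := by push_cast; linarith
        rw [div_sub_div _ _ h1.ne' h4.ne', div_le_div_iff₀ (by positivity) (by positivity)]
        push_cast
        nlinarith
      rw [h2, ← mul_add]
      refine mul_le_mul_of_nonneg_left ?_ (by positivity)
      linarith
  refine h.trans ?_
  have h1 : (0 : ℝ) < w - 1 := by linarith
  have h3 : (0 : ℝ) ≤ 1 / (w + N - 1) := by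
    have : (0 : ℝ) ≤ N := by positivity
    exact div_nonneg zero_le_one (by linarith)
  calc (w : ℝ) ^ 2 * (1 / (w - 1) - 1 / (w + N - 1)) ≤ (w : ℝ) ^ 2 * (1 / (w - 1)) :=
        mul_le_mul_of_nonneg_left (by linarith) (by positivity)
    _ ≤ 2 * w := by
        rw [mul_one_div, div_le_iff₀ h1]; nlinarith

/-- The squared decay factors of the covariances of the differences, summed over the grid. -/
lemma sum_prod_decay_le (hw : 2 ≤ w) {i : Fin d → ℕ} (hi : i ∈ gridIdx d ℓ w m) :
    ∑ i' ∈ gridIdx d ℓ w m,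
      (∏ j, (1 + |scaledCorner w i j - scaledCorner w i' j|)⁻¹) ^ 2 ≤ (4 * w : ℝ) ^ d := by
  have hw' : (0 : ℝ) < w := by exact_mod_cast (by omega : 0 < w)
  simp_rw [← Finset.prod_pow]
  change ∑ i' ∈ Fintype.piFinset (fun _ => Finset.Icc 1 (m - ℓ * w)),
    ∏ j, ((1 + |scaledCorner w i j - ((i' j : ℝ) - 1) / w|)⁻¹) ^ 2 ≤ _
  rw [← Finset.prod_univ_sum (fun _ => Finset.Icc 1 (m - ℓ * w))
    (fun j b => ((1 + |scaledCorner w i j - ((b : ℝ) - 1) / w|)⁻¹) ^ 2)]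
  calc _ ≤ ∏ _j : Fin d, (4 * w : ℝ) := by
        refine Finset.prod_le_prod (fun j _ => Finset.sum_nonneg fun _ _ => by positivity)
          fun j _ => ?_
        have h1 := sum_comp_dist_le (fun t => ((1 + (t : ℝ) / w)⁻¹) ^ 2) (fun _ => by positivity)
          (i j) (m - ℓ * w) (mem_gridIdx.1 hi j).2
        have h2 := sum_range_inv_sq_le hw (m - ℓ * w + 1)
        calc _ = ∑ b ∈ Finset.Icc 1 (m - ℓ * w),
              ((1 + (((i j - b) + (b - i j) : ℕ) : ℝ) / w)⁻¹) ^ 2 := by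
              refine Finset.sum_congr rfl fun b _ => ?_
              have : |scaledCorner w i j - ((b : ℝ) - 1) / w| =
                  (((i j - b) + (b - i j) : ℕ) : ℝ) / w := by
                simp only [scaledCorner]
                rw [← sub_div, abs_div, abs_of_pos hw', sub_sub_sub_cancel_right]
                congr 1
                rcases le_total b (i j) with hb | hb
                · rw [Nat.sub_eq_zero_of_le hb, add_zero, Nat.cast_sub hb,
                    abs_of_nonneg (sub_nonneg.2 (by exact_mod_cast hb))]
                · rw [Nat.sub_eq_zero_of_le hb, zero_add, Nat.cast_sub hb, abs_sub_comm,
                    abs_of_nonneg (sub_nonneg.2 (by exact_mod_cast hb))]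
              rw [this]
          _ ≤ 4 * w := by linarith
    _ = (4 * w : ℝ) ^ d := by simp

end Geometry

/-! ### Quadratic variations with a lag -/

section Products

variable {Ω : Type*} [MeasurableSpace Ω] {P : Measure Ω}

lemma sum_comp_le_of_injective {S T : Type*} [Fintype S] [Fintype T] {σ : S → T}
    (hσ : Function.Injective σ) {f : T → ℝ} (hf : ∀ t, 0 ≤ f t) : ∑ i, f (σ i) ≤ ∑ t, f t := by
  have := Finset.sum_map Finset.univ ⟨σ, hσ⟩ f
  simp only [Function.Embedding.coeFn_mk] at this
  rw [← this]
  exact Finset.sum_le_sum_of_subset_of_nonneg (Finset.subset_univ _) fun _ _ _ => hf _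

/-- Tail bound for a sum of products of jointly Gaussian variables, by polarisation: the products
are differences of squares of `X ± X'`. -/
theorem measure_abs_sum_mul_sub_le {S T : Type*} [Fintype S] [Fintype T] {X : T → Ω → ℝ}
    (hX : HasGaussianLaw (fun ω i => X i ω) P) {σ₁ σ₂ : S → T} (h₁ : Function.Injective σ₁)
    (h₂ : Function.Injective σ₂) {F s : ℝ} (hF : 0 ≤ F) (hs : 0 < s)
    (hcov : ∑ i, ∑ i', cov[X i, X i'; P] ^ 2 ≤ F ^ 2) (hFs : F ≤ s)
    (hmean : (∑ i, (∫ ω, X i ω ∂P) ^ 2) * F ≤ s ^ 2) (t : ℝ) :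
    P.real {ω | t ≤ |∑ i, X (σ₁ i) ω * X (σ₂ i) ω - ∑ i, (cov[X (σ₁ i), X (σ₂ i); P] +
      (∫ ω, X (σ₁ i) ω ∂P) * ∫ ω, X (σ₂ i) ω ∂P)|} ≤ 8 * Real.exp (-(t / (16 * s))) := by
  have hP := hX.isProbabilityMeasure
  have hG : ∀ i, HasGaussianLaw (X i) P := fun i => hX.eval i
  have hL2 : ∀ i, MemLp (X i) 2 P := fun i => (hG i).memLp_two
  have hL1 : ∀ i, Integrable (X i) P := fun i => (hG i).integrable
  set μ : T → ℝ := fun i => ∫ ω, X i ω ∂P with hμ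
  set κ : T → T → ℝ := fun i i' => cov[X i, X i'; P] with hκ
  -- the squares of `X ± X'`
  have hsum : ∀ σ σ' : S → T, Function.Injective σ → Function.Injective σ' →
      ∑ i, ∑ i', κ (σ i) (σ' i') ^ 2 ≤ F ^ 2 := by
    intro σ σ' hσ hσ'
    refine le_trans ?_ hcov
    refine le_trans (Finset.sum_le_sum fun i _ => sum_comp_le_of_injective hσ'
      (f := fun t => κ (σ i) t ^ 2) fun _ => sq_nonneg _) ?_
    exact sum_comp_le_of_injective hσ (f := fun t => ∑ t', κ t t' ^ 2)
      fun _ => Finset.sum_nonneg fun _ _ => sq_nonneg _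
  have hsumμ : ∀ σ : S → T, Function.Injective σ → ∑ i, μ (σ i) ^ 2 ≤ ∑ i, μ i ^ 2 :=
    fun σ hσ => sum_comp_le_of_injective hσ (f := fun t => μ t ^ 2) fun _ => sq_nonneg _
  have hcW : ∀ e : ℝ, ∀ i i', cov[fun ω => X (σ₁ i) ω + e * X (σ₂ i) ω,
      fun ω => X (σ₁ i') ω + e * X (σ₂ i') ω; P] = κ (σ₁ i) (σ₁ i') + e * κ (σ₁ i) (σ₂ i') +
        e * κ (σ₂ i) (σ₁ i') + e ^ 2 * κ (σ₂ i) (σ₂ i') := by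
    intro e i i'
    have m1 : ∀ j, MemLp (fun ω => e * X j ω) 2 P := fun j => (hL2 j).const_mul e
    have hl : ∀ {U V W : Ω → ℝ}, MemLp U 2 P → MemLp V 2 P → MemLp W 2 P →
        cov[fun ω => U ω + V ω, W; P] = cov[U, W; P] + cov[V, W; P] :=
      fun hU hV hW => covariance_add_left hU hV hW
    have hr : ∀ {U V W : Ω → ℝ}, MemLp U 2 P → MemLp V 2 P → MemLp W 2 P →
        cov[U, fun ω => V ω + W ω; P] = cov[U, V; P] + cov[U, W; P] :=
      fun hU hV hW => covariance_add_right hU hV hW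
    have m2 : MemLp (fun ω => X (σ₁ i') ω + e * X (σ₂ i') ω) 2 P := (hL2 _).add (m1 _)
    rw [hl (hL2 _) (m1 _) m2, hr (hL2 _) (hL2 _) (m1 _),
      hr (m1 _) (hL2 _) (m1 _)]
    simp only [covariance_const_mul_left, covariance_const_mul_right, hκ]
    ring
  have hmW : ∀ e : ℝ, ∀ i, ∫ ω, (X (σ₁ i) ω + e * X (σ₂ i) ω) ∂P = μ (σ₁ i) + e * μ (σ₂ i) := by
    intro e i
    rw [integral_add (hL1 _) ((hL1 _).const_mul e), integral_const_mul]
  have key : ∀ e : ℝ, e ^ 2 = 1 → P.real {ω | 2 * t ≤ |∑ i, (X (σ₁ i) ω + e * X (σ₂ i) ω) ^ 2 -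
      ∑ i, (κ (σ₁ i) (σ₁ i) + e * κ (σ₁ i) (σ₂ i) + e * κ (σ₂ i) (σ₁ i) + κ (σ₂ i) (σ₂ i) +
        (μ (σ₁ i) + e * μ (σ₂ i)) ^ 2)|} ≤ 4 * Real.exp (-(t / (16 * s))) := by
    intro e he
    let L : (T → ℝ) →L[ℝ] S → ℝ :=
      { toFun x i := x (σ₁ i) + e * x (σ₂ i)
        map_add' x y := by ext; simp; ring
        map_smul' c x := by ext; simp; ring }
    have hW : HasGaussianLaw (fun ω i => X (σ₁ i) ω + e * X (σ₂ i) ω) P := hX.map_fun L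
    have hFF : 0 ≤ 4 * F := by positivity
    have := measure_abs_sum_sq_sub_le (W := fun i ω => X (σ₁ i) ω + e * X (σ₂ i) ω) hW
      hFF (by positivity : 0 < 4 * s) ?_ (by linarith) ?_ (2 * t)
    · simp only [hcW, hmW, he, one_mul] at this
      convert! this using 4
      field_simp
      ring
    · simp only [hcW, he, one_mul]
      calc _ ≤ ∑ i, ∑ i', (4 * κ (σ₁ i) (σ₁ i') ^ 2 + 4 * κ (σ₁ i) (σ₂ i') ^ 2 +
            4 * κ (σ₂ i) (σ₁ i') ^ 2 + 4 * κ (σ₂ i) (σ₂ i') ^ 2) := by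
            refine Finset.sum_le_sum fun i _ => Finset.sum_le_sum fun i' _ => ?_
            generalize κ (σ₁ i) (σ₁ i') = x
            generalize κ (σ₁ i) (σ₂ i') = y
            generalize κ (σ₂ i) (σ₁ i') = z
            generalize κ (σ₂ i) (σ₂ i') = u
            have h1 : (e * y) ^ 2 = y ^ 2 := by rw [mul_pow, he, one_mul]
            have h2 : (e * z) ^ 2 = z ^ 2 := by rw [mul_pow, he, one_mul]
            rw [← h1, ← h2]
            nlinarith [sq_nonneg (x - e * y), sq_nonneg (x - e * z), sq_nonneg (x - u),
              sq_nonneg (e * y - e * z), sq_nonneg (e * y - u), sq_nonneg (e * z - u)]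
        _ ≤ 4 * F ^ 2 + 4 * F ^ 2 + 4 * F ^ 2 + 4 * F ^ 2 := by
            simp only [Finset.sum_add_distrib, ← Finset.mul_sum]
            have := hsum σ₁ σ₁ h₁ h₁
            have := hsum σ₁ σ₂ h₁ h₂
            have := hsum σ₂ σ₁ h₂ h₁
            have := hsum σ₂ σ₂ h₂ h₂
            linarith
        _ = (4 * F) ^ 2 := by ring
    · simp only [hmW]
      have : ∑ i, (μ (σ₁ i) + e * μ (σ₂ i)) ^ 2 ≤ 4 * ∑ i, μ i ^ 2 := by
        calc _ ≤ ∑ i, (2 * μ (σ₁ i) ^ 2 + 2 * μ (σ₂ i) ^ 2) := by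
              refine Finset.sum_le_sum fun i _ => ?_
              have h1 : (e * μ (σ₂ i)) ^ 2 = μ (σ₂ i) ^ 2 := by rw [mul_pow, he, one_mul]
              rw [← h1]
              nlinarith [sq_nonneg (μ (σ₁ i) - e * μ (σ₂ i))]
          _ ≤ 4 * ∑ i, μ i ^ 2 := by
              simp only [Finset.sum_add_distrib, ← Finset.mul_sum]
              linarith [hsumμ σ₁ h₁, hsumμ σ₂ h₂]
      calc _ ≤ (4 * ∑ i, μ i ^ 2) * (4 * F) := mul_le_mul_of_nonneg_right this hFF
        _ = 16 * ((∑ i, μ i ^ 2) * F) := by ring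
        _ ≤ 16 * s ^ 2 := by linarith
        _ = (4 * s) ^ 2 := by ring
  have k1 := key 1 (by norm_num)
  have k2 := key (-1) (by norm_num)
  set A : Ω → ℝ := fun ω => ∑ i, (X (σ₁ i) ω + 1 * X (σ₂ i) ω) ^ 2 -
      ∑ i, (κ (σ₁ i) (σ₁ i) + 1 * κ (σ₁ i) (σ₂ i) + 1 * κ (σ₂ i) (σ₁ i) + κ (σ₂ i) (σ₂ i) +
        (μ (σ₁ i) + 1 * μ (σ₂ i)) ^ 2)
  set A' : Ω → ℝ := fun ω => ∑ i, (X (σ₁ i) ω + -1 * X (σ₂ i) ω) ^ 2 -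
      ∑ i, (κ (σ₁ i) (σ₁ i) + -1 * κ (σ₁ i) (σ₂ i) + -1 * κ (σ₂ i) (σ₁ i) + κ (σ₂ i) (σ₂ i) +
        (μ (σ₁ i) + -1 * μ (σ₂ i)) ^ 2)
  have hAA : ∀ ω, ∑ i, X (σ₁ i) ω * X (σ₂ i) ω - ∑ i, (κ (σ₁ i) (σ₂ i) + μ (σ₁ i) * μ (σ₂ i)) =
      (A ω - A' ω) / 4 := by
    intro ω
    simp only [A, A', ← Finset.sum_sub_distrib]
    rw [Finset.sum_div]
    refine Finset.sum_congr rfl fun i _ => ?_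
    have : κ (σ₂ i) (σ₁ i) = κ (σ₁ i) (σ₂ i) := covariance_comm _ _
    rw [this]
    ring
  calc _ ≤ P.real ({ω | 2 * t ≤ |A ω|} ∪ {ω | 2 * t ≤ |A' ω|}) := by
        refine measureReal_mono fun ω hω => ?_
        have hω : t ≤ |∑ i, X (σ₁ i) ω * X (σ₂ i) ω -
          ∑ i, (κ (σ₁ i) (σ₂ i) + μ (σ₁ i) * μ (σ₂ i))| := hω
        rw [hAA, abs_div, abs_of_pos (by norm_num : (0 : ℝ) < 4)] at hω
        have := abs_sub (A ω) (A' ω)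
        by_contra hcon
        simp only [mem_union, mem_ofPred_eq, not_or, not_le] at hcon
        linarith [hcon.1, hcon.2]
    _ ≤ _ := measureReal_union_le _ _
    _ ≤ 4 * Real.exp (-(t / (16 * s))) + 4 * Real.exp (-(t / (16 * s))) := add_le_add k1 k2
    _ = _ := by ring

end Products

/-! ### Moments of the differences under the model -/

section Moments

variable {d p ℓ w m : ℕ} {δ : (Fin d → ℕ) → Fin d → ℝ}
  {a : (Fin d → ℕ) → (Fin d → ℕ) → ℝ} {cLim : (Fin d → ℕ) → ℝ} {B η ν : ℝ}
  {f : Fin p → Loc d → ℝ} {q : Param p} {Ω : Type*} [MeasurableSpace Ω] {P : Measure Ω}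
  {Y : Loc d → Ω → ℝ}

lemma IsRegular.pos_left (h : IsRegular d ℓ w m δ a cLim B η) : 0 < m := by have := h.room; omega

lemma IsRegular.pos_lag (h : IsRegular d ℓ w m δ a cLim B η) : 0 < w := by
  have := h.two_le; omega

lemma IsRegular.site_mem (h : IsRegular d ℓ w m δ a cLim B η) {i k : Fin d → ℕ}
    (hi : i ∈ gridIdx d ℓ w m) (hk : k ∈ multiIdx d ℓ) :
    site m δ (fun j => i j + k j * w) ∈ cube d := by
  refine site_mem_cube h.pos_left h.design fun j => ?_
  obtain ⟨h1, h2⟩ := mem_gridIdx.1 hi j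
  have h3 : k j * w ≤ ℓ * w := Nat.mul_le_mul_right _ (mem_multiIdx.1 hk j)
  have := h.room
  omega

/-- The differences of the observations form a Gaussian vector. -/
lemma IsModel.hasGaussianLaw_nabla (hM : IsModel ν f q P Y)
    (h : IsRegular d ℓ w m δ a cLim B η) :
    HasGaussianLaw (fun o (i : gridIdx d ℓ w m) =>
      nabla ℓ w a (fun i => Y (site m δ i) o) i.1) P := by
  classical
  have hZ : IsGaussianProcess (fun (z : gridIdx d ℓ w m × multiIdx d ℓ) o =>
      Y (site m δ (fun j => z.1.1 j + z.2.1 j * w)) o) P :=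
    hM.gaussian.comp_right fun z => (⟨_, h.site_mem z.1.2 z.2.2⟩ : cube d)
  let L : (↥(Finset.univ : Finset (gridIdx d ℓ w m × multiIdx d ℓ)) → ℝ) →L[ℝ]
      gridIdx d ℓ w m → ℝ :=
    { toFun x i := ∑ k : multiIdx d ℓ, a i.1 k.1 * x ⟨(i, k), Finset.mem_univ _⟩
      map_add' x y := by ext; simp [mul_add, Finset.sum_add_distrib]
      map_smul' c x := by ext; simp [mul_left_comm, Finset.mul_sum] }
  have := (hZ.hasGaussianLaw Finset.univ).map_fun L
  refine this.congr (ae_of_all _ fun o => funext fun i => ?_)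
  exact (Finset.sum_coe_sort (multiIdx d ℓ) (fun k => a i.1 k *
    Y (site m δ (fun j => i.1 j + k j * w)) o))

lemma IsModel.hasGaussianLaw (hM : IsModel ν f q P Y) {s : Loc d} (hs : s ∈ cube d) :
    HasGaussianLaw (Y s) P :=
  hM.gaussian.hasGaussianLaw_eval ⟨s, hs⟩

/-- The mean of the difference at `i`. -/
def meanDiff (f : Fin p → Loc d → ℝ) (q : Param p) (ℓ w m : ℕ) (δ : (Fin d → ℕ) → Fin d → ℝ)
    (a : (Fin d → ℕ) → (Fin d → ℕ) → ℝ) (i : Fin d → ℕ) : ℝ :=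
  ∑ l, q.β l * ∑ k ∈ multiIdx d ℓ, a i k * f l (site m δ (fun j => i j + k j * w))

/-- The covariance of the differences at `i` and `i'`: a rescaled double difference of the Matérn
kernel, and the nugget on the common sites. -/
def covDiff (ν : ℝ) (q : Param p) (ℓ w m : ℕ) (δ : (Fin d → ℕ) → Fin d → ℝ)
    (a : (Fin d → ℕ) → (Fin d → ℕ) → ℝ) (i i' : Fin d → ℕ) : ℝ :=
  q.θ * ((w : ℝ) / m) ^ (2 * ν) * maternDiff ν (q.α * (w / m)) (multiIdx d ℓ) (a i) (a i')
    (scaledSite w δ i) (scaledSite w δ i') + q.τ * overlap ℓ w a i i'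

lemma IsModel.integral_nabla (hM : IsModel ν f q P Y) (h : IsRegular d ℓ w m δ a cLim B η)
    {i : Fin d → ℕ} (hi : i ∈ gridIdx d ℓ w m) :
    ∫ o, nabla ℓ w a (fun i => Y (site m δ i) o) i ∂P = meanDiff f q ℓ w m δ a i := by
  simp only [nabla, meanDiff]
  rw [integral_finsetSum _ fun k hk =>
    ((hM.hasGaussianLaw (h.site_mem hi hk)).integrable.const_mul _)]
  simp_rw [integral_const_mul, Finset.mul_sum]
  rw [Finset.sum_comm]
  refine Finset.sum_congr rfl fun k hk => ?_
  rw [hM.mean _ (h.site_mem hi hk), Finset.mul_sum]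
  exact Finset.sum_congr rfl fun l _ => by ring

lemma IsModel.covariance_nabla (hM : IsModel ν f q P Y) (h : IsRegular d ℓ w m δ a cLim B η)
    (hα : 0 < q.α) {i i' : Fin d → ℕ} (hi : i ∈ gridIdx d ℓ w m) (hi' : i' ∈ gridIdx d ℓ w m) :
    cov[fun o => nabla ℓ w a (fun i => Y (site m δ i) o) i,
      fun o => nabla ℓ w a (fun i => Y (site m δ i) o) i'; P] =
      covDiff ν q ℓ w m δ a i i' := by
  have hm := h.pos_left
  have hw := h.pos_lag
  have hh : (0 : ℝ) < (w : ℝ) / m := by positivity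
  have hP := hM.gaussian.isProbabilityMeasure
  simp only [nabla]
  rw [covariance_fun_sum_fun_sum'
    (fun k hk => (hM.hasGaussianLaw (h.site_mem hi hk)).memLp_two.const_mul _)
    (fun k hk => (hM.hasGaussianLaw (h.site_mem hi' hk)).memLp_two.const_mul _)]
  simp only [covDiff, maternDiff, overlap, Finset.mul_sum, ← Finset.sum_add_distrib]
  refine Finset.sum_congr rfl fun k hk => Finset.sum_congr rfl fun k' hk' => ?_
  rw [covariance_const_mul_left, covariance_const_mul_right,
    hM.cov _ (h.site_mem hi hk) _ (h.site_mem hi' hk')]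
  have h1 : ‖site m δ (fun j => i j + k j * w) - site m δ (fun j => i' j + k' j * w)‖ =
      (w : ℝ) / m * ‖scaledSite w δ i k - scaledSite w δ i' k'‖ := by
    rw [site_eq_smul_scaledSite hm hw, site_eq_smul_scaledSite hm hw, ← smul_sub, norm_smul,
      Real.norm_of_nonneg hh.le]
  rw [h1, maternK_mul ν hα hh (norm_nonneg _)]
  by_cases heq : (fun j => i j + k j * w) = (fun j => i' j + k' j * w)
  · rw [if_pos (by rw [heq]), if_pos heq]; ring
  · rw [if_neg fun hs => heq (site_injective hm h.design hs), if_neg heq]; ring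

lemma abs_apply_le_norm {p : ℕ} (β : EuclideanSpace ℝ (Fin p)) (l : Fin p) : |β l| ≤ ‖β‖ := by
  simpa using PiLp.norm_apply_le β l

/-- The mean of a difference is of the order of the `ℓ`-th power of the mesh size. -/
lemma IsRegular.sq_meanDiff_le (h : IsRegular d ℓ w m δ a cLim B η) {Cf : ℝ} (hf : ∀ l, HasBoundedPartials ℓ Cf (f l))
    {i : Fin d → ℕ} (hi : i ∈ gridIdx d ℓ w m) :
    meanDiff f q ℓ w m δ a i ^ 2 ≤
      (p * (B * (|Cf| * (d * (ℓ + 1)) ^ ℓ))) ^ 2 * (‖q.β‖ ^ 2 * ((w : ℝ) / m) ^ (2 * ℓ)) := by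
  have hm := h.pos_left
  have hw := h.pos_lag
  have hm' : (0 : ℝ) < m := by exact_mod_cast hm
  have hw' : (1 : ℝ) ≤ w := by exact_mod_cast hw
  have hB : 0 ≤ B := (Finset.sum_nonneg fun _ _ => abs_nonneg _).trans (h.bound i hi)
  have h0 : (0 : Fin d → ℕ) ∈ multiIdx d ℓ := mem_multiIdx.2 fun j => by simp
  have hbase := h.site_mem hi h0
  have hterm : ∀ l, |∑ k ∈ multiIdx d ℓ, a i k * f l (site m δ (fun j => i j + k j * w))| ≤
      B * (|Cf| * (d * (((ℓ : ℝ) + 1) * (w / m))) ^ ℓ) := by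
    intro l
    have := (hf l).abs_sum_le (h.ann i hi) hbase (fun k hk => h.site_mem hi hk)
      (by positivity : (0 : ℝ) ≤ ((ℓ : ℝ) + 1) * (w / m)) fun k hk j => ?_
    · refine this.trans ?_
      calc _ ≤ (∑ k ∈ multiIdx d ℓ, |a i k|) *
            (|Cf| * (d * (((ℓ : ℝ) + 1) * (w / m))) ^ ℓ) := by
            gcongr
            exact le_abs_self _
        _ ≤ _ := by
            gcongr
            exact h.bound i hi
    · obtain ⟨h1, h2⟩ := h.design (fun j => i j + k j * w) j
      obtain ⟨h3, h4⟩ := h.design (fun j => i j + (0 : Fin d → ℕ) j * w) j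
      have h5 : (k j : ℝ) ≤ ℓ := by exact_mod_cast mem_multiIdx.1 hk j
      have h6 : (0 : ℝ) ≤ k j * w := by positivity
      have h7 : (k j : ℝ) * w ≤ ℓ * w := by gcongr
      have heq : (site m δ (fun j => i j + k j * w) -
          site m δ (fun j => i j + (0 : Fin d → ℕ) j * w)) j =
          (k j * w + (δ (fun j => i j + k j * w) j -
            δ (fun j => i j + (0 : Fin d → ℕ) j * w) j)) / m := by
        simp only [site, PiLp.sub_apply]
        push_cast
        simp only [Pi.zero_apply, Nat.cast_zero, zero_mul, add_zero]
        ring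
      rw [PiLp.sub_apply] at heq
      rw [heq, abs_div, abs_of_pos hm', ← mul_div_assoc]
      gcongr
      rw [abs_le]
      constructor <;> nlinarith
  rw [meanDiff, ← sq_abs]
  have hsum : |∑ l, q.β l * ∑ k ∈ multiIdx d ℓ, a i k * f l (site m δ (fun j => i j + k j * w))| ≤
      p * (‖q.β‖ * (B * (|Cf| * (d * (((ℓ : ℝ) + 1) * (w / m))) ^ ℓ))) := by
    calc _ ≤ ∑ _l : Fin p, ‖q.β‖ * (B * (|Cf| * (d * (((ℓ : ℝ) + 1) * (w / m))) ^ ℓ)) := by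
          refine (Finset.abs_sum_le_sum_abs _ _).trans (Finset.sum_le_sum fun l _ => ?_)
          rw [abs_mul]
          exact mul_le_mul (abs_apply_le_norm _ _) (hterm l) (abs_nonneg _) (norm_nonneg _)
      _ = _ := by simp
  refine (pow_le_pow_left₀ (abs_nonneg _) hsum 2).trans (le_of_eq ?_)
  rw [← mul_assoc (d : ℝ), mul_pow (_ : ℝ) _ ℓ, pow_mul']
  ring

lemma card_gridIdx_le : ((gridIdx d ℓ w m).card : ℝ) ≤ m ^ d := by
  rw [gridIdx, Fintype.card_piFinset_const, Nat.card_Icc]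
  norm_cast
  exact Nat.pow_le_pow_left (by omega) d

lemma IsRegular.annihilates_scaledSite (h : IsRegular d ℓ w m δ a cLim B η) {i : Fin d → ℕ}
    (hi : i ∈ gridIdx d ℓ w m) :
    Annihilates ℓ (multiIdx d ℓ) (a i) (fun k => scaledSite w δ i k) := by
  have hh : ((w : ℝ) / m) ≠ 0 := by
    have := h.pos_left
    have := h.pos_lag
    positivity
  have := (h.ann i hi).affine ((w : ℝ) / m)⁻¹ 0
  convert! this using 3 with k j
  rw [site_eq_smul_scaledSite h.pos_left h.pos_lag, PiLp.smul_apply, smul_eq_mul,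
    inv_mul_cancel_left₀ hh, Pi.zero_apply, add_zero]

/-- Bounds on the rescaled Matérn covariances of the differences which are uniform in the inverse
range parameter: they are bounded, and their squares are summable over the rescaled grid. -/
lemma exists_sum_sq_maternDiff_le (hν : 0 < ν) (hd : 0 < d) (hℓ : ν + (d : ℝ) / 2 ≤ ℓ) (B : ℝ) :
    ∃ C : ℝ, 0 < C ∧ ∀ {w m δ a cLim η}, IsRegular d ℓ w m δ a cLim B η → ∀ α, 0 < α →
      (∀ i ∈ gridIdx d ℓ w m, |maternDiff ν α (multiIdx d ℓ) (a i) (a i)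
        (scaledSite w δ i) (scaledSite w δ i)| ≤ C) ∧
      ∑ i ∈ gridIdx d ℓ w m, ∑ i' ∈ gridIdx d ℓ w m, maternDiff ν α (multiIdx d ℓ) (a i) (a i')
        (scaledSite w δ i) (scaledSite w δ i') ^ 2 ≤ C * (m ^ d * w ^ d) := by
  have hR : (1 : ℝ) ≤ d * (ℓ + 1) := by
    have h1 : (1 : ℝ) ≤ d := by exact_mod_cast hd
    have h2 : (0 : ℝ) ≤ ℓ := by positivity
    nlinarith
  obtain ⟨C, hC, hle⟩ := exists_abs_maternDiff_le (κ := Fin d → ℕ) hν hℓ hd B (d * (ℓ + 1)) hR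
  refine ⟨C + C ^ 2 * 4 ^ d, by positivity, fun {w m δ a cLim η} h α hα => ?_⟩
  have hb : ∀ i ∈ gridIdx d ℓ w m, ∀ i' ∈ gridIdx d ℓ w m,
      |maternDiff ν α (multiIdx d ℓ) (a i) (a i') (scaledSite w δ i) (scaledSite w δ i')| ≤
        C * ∏ j, (1 + |scaledCorner w i j - scaledCorner w i' j|)⁻¹ := fun i hi i' hi' =>
    hle α hα _ _ _ _ _ (scaledCorner w i) (scaledCorner w i') (h.annihilates_scaledSite hi)
      (h.annihilates_scaledSite hi')
      (h.bound i hi) (h.bound i' hi')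
      (fun k hk => norm_scaledSite_sub_scaledCorner_le h.design h.pos_lag i hk)
      (fun k hk => norm_scaledSite_sub_scaledCorner_le h.design h.pos_lag i' hk)
  constructor
  · intro i hi
    have := hb i hi i hi
    simp only [sub_self, abs_zero, add_zero, inv_one, Finset.prod_const_one, mul_one] at this
    have h2 : 0 ≤ C ^ 2 * 4 ^ d := by positivity
    linarith
  · calc _ ≤ ∑ i ∈ gridIdx d ℓ w m, C ^ 2 * (4 * w : ℝ) ^ d := by
          refine Finset.sum_le_sum fun i hi => ?_
          refine le_trans ?_ (mul_le_mul_of_nonneg_left (sum_prod_decay_le h.two_le hi)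
            (sq_nonneg C))
          rw [Finset.mul_sum]
          refine Finset.sum_le_sum fun i' hi' => ?_
          rw [← mul_pow, ← sq_abs]
          exact pow_le_pow_left₀ (abs_nonneg _) (hb i hi i' hi') 2
      _ = (gridIdx d ℓ w m).card * (C ^ 2 * (4 * w : ℝ) ^ d) := by simp
      _ ≤ m ^ d * (C ^ 2 * (4 * w : ℝ) ^ d) := by
          gcongr
          exact card_gridIdx_le
      _ = C ^ 2 * 4 ^ d * (m ^ d * w ^ d) := by rw [mul_pow]; ring
      _ ≤ (C + C ^ 2 * 4 ^ d) * (m ^ d * w ^ d) := by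
          gcongr
          linarith

end Moments

/-! ### Concentration of the quadratic variations -/

section Concentration

variable {d p ℓ w m u : ℕ} [NeZero d] {δ : (Fin d → ℕ) → Fin d → ℝ}
  {a : (Fin d → ℕ) → (Fin d → ℕ) → ℝ} {cLim : (Fin d → ℕ) → ℝ} {B η ν : ℝ}
  {f : Fin p → Loc d → ℝ} {q : Param p} {Ω : Type*} [MeasurableSpace Ω] {P : Measure Ω}
  {Y : Loc d → Ω → ℝ}

lemma mem_Xi {i : Fin d → ℕ} : i ∈ Xi d ℓ w m u ↔
    (∀ j, 1 ≤ i j ∧ i j ≤ m - 2 * ℓ * w) ∧ i 0 + u ≤ m - 2 * ℓ * w := by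
  simp [Xi, Fintype.mem_piFinset]

lemma mem_gridIdx_of_mem_Xi {i : Fin d → ℕ} (hi : i ∈ Xi d ℓ w m u) : i ∈ gridIdx d ℓ w m := by
  refine mem_gridIdx.2 fun j => ?_
  have h1 := (mem_Xi.1 hi).1 j
  have h2 : 2 * ℓ * w = 2 * (ℓ * w) := by ring
  omega

lemma add_single_mem_gridIdx {i : Fin d → ℕ} (hi : i ∈ Xi d ℓ w m u) :
    i + Pi.single 0 u ∈ gridIdx d ℓ w m := by
  refine mem_gridIdx.2 fun j => ?_
  obtain ⟨h1, h3⟩ := mem_Xi.1 hi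
  have h1 := h1 j
  have h2 : 2 * ℓ * w = 2 * (ℓ * w) := by ring
  rcases eq_or_ne j 0 with rfl | hj
  · simp only [Pi.add_apply, Pi.single_eq_same]; omega
  · simp only [Pi.add_apply, Pi.single_eq_of_ne hj]; omega

/-- The expectation of the quadratic variation with lag `u`. -/
def meanQuadVar (ν : ℝ) (f : Fin p → Loc d → ℝ) (q : Param p) (ℓ w m u : ℕ)
    (δ : (Fin d → ℕ) → Fin d → ℝ) (a : (Fin d → ℕ) → (Fin d → ℕ) → ℝ) : ℝ :=
  ∑ i ∈ Xi d ℓ w m u, (covDiff ν q ℓ w m δ a i (i + Pi.single 0 u) +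
    meanDiff f q ℓ w m δ a i * meanDiff f q ℓ w m δ a (i + Pi.single 0 u))

theorem IsModel.measure_abs_quadVar_sub_le (hM : IsModel ν f q P Y)
    (h : IsRegular d ℓ w m δ a cLim B η) (hα : 0 < q.α) {F s : ℝ} (hF : 0 ≤ F) (hs : 0 < s)
    (hcov : ∑ i ∈ gridIdx d ℓ w m, ∑ i' ∈ gridIdx d ℓ w m, covDiff ν q ℓ w m δ a i i' ^ 2 ≤ F ^ 2)
    (hFs : F ≤ s)
    (hmean : (∑ i ∈ gridIdx d ℓ w m, meanDiff f q ℓ w m δ a i ^ 2) * F ≤ s ^ 2) (t : ℝ) :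
    P.real {o | t ≤ |quadVar ℓ w m u a (fun i => Y (site m δ i) o) -
      meanQuadVar ν f q ℓ w m u δ a|} ≤ 8 * Real.exp (-(t / (16 * s))) := by
  have hG := hM.hasGaussianLaw_nabla h
  set X : gridIdx d ℓ w m → Ω → ℝ :=
    fun i o => nabla ℓ w a (fun i => Y (site m δ i) o) i.1 with hX
  let σ₁ : Xi d ℓ w m u → gridIdx d ℓ w m := fun i => ⟨i.1, mem_gridIdx_of_mem_Xi i.2⟩
  let σ₂ : Xi d ℓ w m u → gridIdx d ℓ w m := fun i =>
    ⟨i.1 + Pi.single 0 u, add_single_mem_gridIdx i.2⟩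
  have hσ₁ : Function.Injective σ₁ := fun i i' hii =>
    Subtype.ext (congrArg (fun z : gridIdx d ℓ w m => z.1) hii)
  have hσ₂ : Function.Injective σ₂ := fun i i' hii =>
    Subtype.ext (add_right_cancel (congrArg (fun z : gridIdx d ℓ w m => z.1) hii))
  have hc : ∀ i i', cov[X i, X i'; P] = covDiff ν q ℓ w m δ a i.1 i'.1 :=
    fun i i' => hM.covariance_nabla h hα i.2 i'.2
  have hm : ∀ i, ∫ o, X i o ∂P = meanDiff f q ℓ w m δ a i.1 := fun i => hM.integral_nabla h i.2
  have e1 : ∀ o, quadVar ℓ w m u a (fun i => Y (site m δ i) o) =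
      ∑ i, X (σ₁ i) o * X (σ₂ i) o := by
    intro o
    rw [quadVar, ← Finset.sum_coe_sort]
  have e2 : meanQuadVar ν f q ℓ w m u δ a = ∑ i, (cov[X (σ₁ i), X (σ₂ i); P] +
      (∫ o, X (σ₁ i) o ∂P) * ∫ o, X (σ₂ i) o ∂P) := by
    rw [meanQuadVar, ← Finset.sum_coe_sort]
    exact Finset.sum_congr rfl fun i _ => by rw [hc, hm, hm]
  simp only [e1, e2]
  refine measure_abs_sum_mul_sub_le (X := X) hG hσ₁ hσ₂ hF hs ?_ hFs ?_ t
  · simp only [hc]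
    refine le_trans (le_of_eq ?_) hcov
    rw [← Finset.sum_coe_sort (gridIdx d ℓ w m)]
    exact Finset.sum_congr rfl fun i _ =>
      Finset.sum_coe_sort (gridIdx d ℓ w m) (fun i' => covDiff ν q ℓ w m δ a i.1 i' ^ 2)
  · simp only [hm]
    refine le_trans (le_of_eq ?_) hmean
    rw [← Finset.sum_coe_sort (gridIdx d ℓ w m)]

/-- Relative error of a quadratic variation, when `A` approximates its expectation. -/
theorem IsModel.measure_abs_quadVar_div_sub_one_le (hM : IsModel ν f q P Y)
    (h : IsRegular d ℓ w m δ a cLim B η) (hα : 0 < q.α) {F s A ε : ℝ} (hF : 0 ≤ F) (hs : 0 < s)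
    (hcov : ∑ i ∈ gridIdx d ℓ w m, ∑ i' ∈ gridIdx d ℓ w m, covDiff ν q ℓ w m δ a i i' ^ 2 ≤ F ^ 2)
    (hFs : F ≤ s)
    (hmean : (∑ i ∈ gridIdx d ℓ w m, meanDiff f q ℓ w m δ a i ^ 2) * F ≤ s ^ 2) (hA : 0 < A)
    (hbias : |meanQuadVar ν f q ℓ w m u δ a - A| ≤ ε * A / 6) :
    P.real {o | ε / 3 ≤ |quadVar ℓ w m u a (fun i => Y (site m δ i) o) / A - 1|} ≤
      8 * Real.exp (-(ε * A / 6 / (16 * s))) := by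
  have hP := hM.gaussian.isProbabilityMeasure
  refine le_trans (measureReal_mono fun o ho => ?_)
    (hM.measure_abs_quadVar_sub_le (u := u) h hα hF hs hcov hFs hmean (ε * A / 6))
  have ho : ε / 3 ≤ |quadVar ℓ w m u a (fun i => Y (site m δ i) o) / A - 1| := ho
  rw [div_sub_one hA.ne', abs_div, abs_of_pos hA, le_div_iff₀ hA] at ho
  have := abs_sub_le (quadVar ℓ w m u a (fun i => Y (site m δ i) o))
    (meanQuadVar ν f q ℓ w m u δ a) A
  change ε * A / 6 ≤ _
  linarith

end Concentration

/-! ### Size of the moments -/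

section Sizes

variable {d p ℓ w m u : ℕ} {δ : (Fin d → ℕ) → Fin d → ℝ}
  {a : (Fin d → ℕ) → (Fin d → ℕ) → ℝ} {cLim : (Fin d → ℕ) → ℝ} {B η ν : ℝ}
  {f : Fin p → Loc d → ℝ} {q : Param p}

/-- The Frobenius norm of the covariance matrix of the differences: the Matérn part sees
correlations over blocks of `w^d` indices, the nugget only over boundedly many. -/
lemma exists_sum_sq_covDiff_le (hν : 0 < ν) (hd : 0 < d) (hℓ : ν + (d : ℝ) / 2 ≤ ℓ) (B : ℝ) :
    ∃ C : ℝ, 0 < C ∧ ∀ {w m δ a cLim η}, IsRegular d ℓ w m δ a cLim B η → ∀ {p} (q : Param p),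
      0 < q.θ → 0 < q.α → 0 < q.τ →
      ∑ i ∈ gridIdx d ℓ w m, ∑ i' ∈ gridIdx d ℓ w m, covDiff ν q ℓ w m δ a i i' ^ 2 ≤
        (C * (Real.sqrt ((m : ℝ) ^ d) * (q.θ * ((w : ℝ) / m) ^ (2 * ν) *
          Real.sqrt ((w : ℝ) ^ d) + q.τ))) ^ 2 := by
  obtain ⟨C, hC, hle⟩ := exists_sum_sq_maternDiff_le hν hd hℓ B
  set C' : ℝ := (multiIdx d ℓ).card * B ^ 4 with hC'
  have hC'0 : 0 ≤ C' := by positivity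
  refine ⟨1 + 2 * C + 2 * C', by positivity, fun {w m δ a cLim η} h {p} q hθ hα hτ => ?_⟩
  have hm := h.pos_left
  have hw := h.pos_lag
  have hh : (0 : ℝ) < (w : ℝ) / m := by positivity
  have h1 := (hle h (q.α * (w / m)) (by positivity)).2
  have h2 : ∑ i ∈ gridIdx d ℓ w m, ∑ i' ∈ gridIdx d ℓ w m, overlap ℓ w a i i' ^ 2 ≤
      m ^ d * C' := by
    refine (Finset.sum_le_sum fun i hi => h.sum_sq_overlap_le hi).trans ?_
    rw [Finset.sum_const, nsmul_eq_mul]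
    exact mul_le_mul_of_nonneg_right card_gridIdx_le hC'0
  set x : ℝ := q.θ * ((w : ℝ) / m) ^ (2 * ν) with hx
  have hx0 : 0 ≤ x := by positivity
  have hN : Real.sqrt ((m : ℝ) ^ d) ^ 2 = (m : ℝ) ^ d := Real.sq_sqrt (by positivity)
  have hW : Real.sqrt ((w : ℝ) ^ d) ^ 2 = (w : ℝ) ^ d := Real.sq_sqrt (by positivity)
  calc _ ≤ ∑ i ∈ gridIdx d ℓ w m, ∑ i' ∈ gridIdx d ℓ w m, (2 * x ^ 2 *
        maternDiff ν (q.α * (w / m)) (multiIdx d ℓ) (a i) (a i') (scaledSite w δ i)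
          (scaledSite w δ i') ^ 2 + 2 * q.τ ^ 2 * overlap ℓ w a i i' ^ 2) := by
        refine Finset.sum_le_sum fun i _ => Finset.sum_le_sum fun i' _ => ?_
        rw [covDiff, ← hx]
        generalize maternDiff ν (q.α * (w / m)) (multiIdx d ℓ) (a i) (a i') (scaledSite w δ i)
          (scaledSite w δ i') = y
        nlinarith [sq_nonneg (x * y - q.τ * overlap ℓ w a i i')]
    _ ≤ 2 * x ^ 2 * (C * (m ^ d * w ^ d)) + 2 * q.τ ^ 2 * (m ^ d * C') := by
        simp only [Finset.sum_add_distrib, ← Finset.mul_sum]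
        gcongr
    _ = (m : ℝ) ^ d * (2 * C * (x ^ 2 * w ^ d) + 2 * C' * q.τ ^ 2) := by ring
    _ ≤ (m : ℝ) ^ d * ((1 + 2 * C + 2 * C') ^ 2 * (x * Real.sqrt ((w : ℝ) ^ d) + q.τ) ^ 2) := by
        refine mul_le_mul_of_nonneg_left ?_ (by positivity)
        have e1 : x ^ 2 * (w : ℝ) ^ d ≤ (x * Real.sqrt ((w : ℝ) ^ d) + q.τ) ^ 2 := by
          calc x ^ 2 * (w : ℝ) ^ d = (x * Real.sqrt ((w : ℝ) ^ d)) ^ 2 := by rw [mul_pow x, hW]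
            _ ≤ _ := pow_le_pow_left₀ (by positivity) (by linarith) 2
        have e2 : q.τ ^ 2 ≤ (x * Real.sqrt ((w : ℝ) ^ d) + q.τ) ^ 2 :=
          pow_le_pow_left₀ hτ.le (le_add_of_nonneg_left (by positivity)) 2
        calc _ ≤ 2 * C * (x * Real.sqrt ((w : ℝ) ^ d) + q.τ) ^ 2 +
              2 * C' * (x * Real.sqrt ((w : ℝ) ^ d) + q.τ) ^ 2 := by gcongr
          _ = (2 * C + 2 * C') * (x * Real.sqrt ((w : ℝ) ^ d) + q.τ) ^ 2 := by ring
          _ ≤ _ := by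
              refine mul_le_mul_of_nonneg_right ?_ (sq_nonneg _)
              nlinarith
    _ = _ := by
        rw [mul_pow, mul_pow, hN]
        ring

lemma IsRegular.sum_sq_meanDiff_le (h : IsRegular d ℓ w m δ a cLim B η) {Cf : ℝ}
    (hf : ∀ l, HasBoundedPartials ℓ Cf (f l)) :
    ∑ i ∈ gridIdx d ℓ w m, meanDiff f q ℓ w m δ a i ^ 2 ≤
      (p * (B * (|Cf| * (d * (ℓ + 1)) ^ ℓ))) ^ 2 *
        ((m : ℝ) ^ d * (‖q.β‖ ^ 2 * ((w : ℝ) / m) ^ (2 * ℓ))) := by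
  refine (Finset.sum_le_sum fun i hi => h.sq_meanDiff_le hf hi).trans ?_
  rw [Finset.sum_const, nsmul_eq_mul, mul_left_comm]
  gcongr
  exact card_gridIdx_le

variable [NeZero d]

lemma IsRegular.le_card_Xi (h : IsRegular d ℓ w m δ a cLim B η) (hu : u ≤ 1) :
    ((m : ℝ) / 2) ^ d ≤ (Xi d ℓ w m u).card := by
  have h2 : 2 * ℓ * w = 2 * (ℓ * w) := by ring
  have hroom := h.room
  have hsub : (Fintype.piFinset fun _ : Fin d => Finset.Icc 1 (m - 2 * ℓ * w - 1)) ⊆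
      Xi d ℓ w m u := by
    intro i hi
    have hi : ∀ j, 1 ≤ i j ∧ i j ≤ m - 2 * ℓ * w - 1 := fun j =>
      Finset.mem_Icc.1 (Fintype.mem_piFinset.1 hi j)
    refine mem_Xi.2 ⟨fun j => ?_, ?_⟩
    · have := hi j; omega
    · have := hi 0; omega
  have hcard := Finset.card_le_card hsub
  rw [Fintype.card_piFinset_const, Nat.card_Icc] at hcard
  calc ((m : ℝ) / 2) ^ d ≤ ((m - 2 * ℓ * w - 1 + 1 - 1 : ℕ) : ℝ) ^ d := by
        refine pow_le_pow_left₀ (by positivity) ?_ d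
        rw [div_le_iff₀ two_pos]
        norm_cast
        omega
    _ ≤ _ := by exact_mod_cast hcard

lemma card_Xi_le : ((Xi d ℓ w m u).card : ℝ) ≤ m ^ d := by
  refine le_trans ?_ (card_gridIdx_le (d := d) (ℓ := ℓ) (w := w) (m := m))
  exact_mod_cast Finset.card_le_card fun i hi => mem_gridIdx_of_mem_Xi hi

/-- The means contribute at most their total square to the expectation of a quadratic
variation. -/
lemma abs_sum_meanDiff_mul_le :
    |∑ i ∈ Xi d ℓ w m u, meanDiff f q ℓ w m δ a i * meanDiff f q ℓ w m δ a (i + Pi.single 0 u)| ≤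
      ∑ i ∈ gridIdx d ℓ w m, meanDiff f q ℓ w m δ a i ^ 2 := by
  set μ := meanDiff f q ℓ w m δ a
  have h1 : ∑ i ∈ Xi d ℓ w m u, μ i ^ 2 ≤ ∑ i ∈ gridIdx d ℓ w m, μ i ^ 2 :=
    Finset.sum_le_sum_of_subset_of_nonneg (fun i hi => mem_gridIdx_of_mem_Xi hi)
      fun _ _ _ => sq_nonneg _
  have h2 : ∑ i ∈ Xi d ℓ w m u, μ (i + Pi.single 0 u) ^ 2 ≤ ∑ i ∈ gridIdx d ℓ w m, μ i ^ 2 := by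
    have hinj : Set.InjOn (fun i : Fin d → ℕ => i + Pi.single 0 u) (Xi d ℓ w m u) :=
      fun x _ y _ hxy => add_right_cancel hxy
    rw [← Finset.sum_image (f := fun i => μ i ^ 2) hinj]
    refine Finset.sum_le_sum_of_subset_of_nonneg (fun i hi => ?_) fun _ _ _ => sq_nonneg _
    obtain ⟨i', hi', rfl⟩ := Finset.mem_image.1 hi
    exact add_single_mem_gridIdx hi'
  calc _ ≤ ∑ i ∈ Xi d ℓ w m u, (μ i ^ 2 / 2 + μ (i + Pi.single 0 u) ^ 2 / 2) := by
        refine (Finset.abs_sum_le_sum_abs _ _).trans (Finset.sum_le_sum fun i _ => ?_)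
        rw [abs_le]
        constructor
        · nlinarith [sq_nonneg (μ i + μ (i + Pi.single 0 u))]
        · nlinarith [sq_nonneg (μ i - μ (i + Pi.single 0 u))]
    _ ≤ _ := by
        rw [Finset.sum_add_distrib, ← Finset.sum_div, ← Finset.sum_div]
        linarith

/-- At lag one the nugget cancels, and the Matérn part of the covariance converges, uniformly in
the index and the design. -/
lemma exists_abs_maternDiff_lag_sub_lt (hν : 0 < ν) (hℓ : ν < ℓ) (cLim : (Fin d → ℕ) → ℝ) {ε : ℝ}
    (hε : 0 < ε) : ∃ η : ℝ, 0 < η ∧ ∀ {w m δ a B}, IsRegular d ℓ w m δ a cLim B η →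
      ∀ α, 0 < α → α < η → ∀ i ∈ Xi d ℓ w m 1,
        |maternDiff ν α (multiIdx d ℓ) (a i) (a (i + Pi.single 0 1)) (scaledSite w δ i)
          (scaledSite w δ (i + Pi.single 0 1)) -
          mixtureDiff ν 0 (multiIdx d ℓ) cLim cLim latticePoint latticePoint| < ε := by
  obtain ⟨η, hη, hlt⟩ := exists_abs_maternDiff_sub_lt hν hℓ (multiIdx d ℓ) cLim
    (latticePoint (d := d)) hε
  refine ⟨η, hη, fun {w m δ a B} h α hα hαη i hi => ?_⟩
  have hi0 := mem_gridIdx_of_mem_Xi hi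
  have hi1 := add_single_mem_gridIdx hi
  have hwpos : (0 : ℝ) < w := by exact_mod_cast h.pos_lag
  have hsmall : 2 * (d : ℝ) / w < η := by
    rw [div_lt_iff₀ hwpos]; exact h.small
  have := hlt α (a i) (a (i + Pi.single 0 1)) (fun k => scaledSite w δ i k - scaledCorner w i)
    (fun k => scaledSite w δ (i + Pi.single 0 1) k - scaledCorner w i)
    ((h.annihilates_scaledSite hi0).sub _) ((h.annihilates_scaledSite hi1).sub _) hα hαη
    (h.close i hi0) (h.close _ hi1) (fun k _ => ?_) (fun k _ => ?_)
  · simpa only [maternDiff, sub_sub_sub_cancel_right] using this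
  · refine lt_of_le_of_lt ?_ hsmall
    simpa using norm_scaledSite_sub_latticePoint_le h.design h.pos_lag i 0 k (by simp)
  · refine lt_of_le_of_lt (norm_scaledSite_sub_latticePoint_le h.design h.pos_lag i _ k
      fun j => ?_) hsmall
    rcases eq_or_ne j 0 with rfl | hj <;> simp [*]

lemma IsRegular.le_CV0 (h : IsRegular d ℓ w m δ a cLim B η) {k : Fin d → ℕ}
    (hk : k ∈ multiIdx d ℓ) (hη : η ≤ |cLim k| / 2) :
    ((m : ℝ) / 2) ^ d * (|cLim k| / 2) ^ 2 ≤ CV0 ℓ w m a := by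
  calc _ ≤ (Xi d ℓ w m 0).card * (|cLim k| / 2) ^ 2 := by
        gcongr
        exact h.le_card_Xi zero_le_one
    _ = ∑ _i ∈ Xi d ℓ w m 0, (|cLim k| / 2) ^ 2 := by simp
    _ ≤ CV0 ℓ w m a := by
        refine Finset.sum_le_sum fun i hi => ?_
        refine le_trans ?_ (Finset.single_le_sum (f := fun k => a i k ^ 2)
          (fun _ _ => sq_nonneg _) hk)
        have h1 := h.close i (mem_gridIdx_of_mem_Xi hi) k hk
        have h2 := abs_sub_abs_le_abs_sub (cLim k) (a i k)
        rw [abs_sub_comm] at h2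
        rw [← sq_abs (a i k)]
        exact pow_le_pow_left₀ (by positivity) (by linarith) 2

end Sizes

/-! ### Orders of magnitude -/

section Orders

/-- The mesh size and the lag in powers of the sample size `N = m^d`. -/
lemma omega_bounds {d m : ℕ} {γ : ℝ} (hd : 0 < d) (hγ : 0 < γ) (hm : 0 < m) :
    (omega γ m : ℝ) / m ≤ ((m : ℝ) ^ d) ^ (-((1 - γ) / d)) ∧
    ((m : ℝ) ^ d) ^ (-((1 - γ) / d)) / 2 ≤ (omega γ m : ℝ) / m ∧
    (omega γ m : ℝ) ^ d ≤ ((m : ℝ) ^ d) ^ γ := by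
  have hm' : (0 : ℝ) < m := by exact_mod_cast hm
  have hd' : (d : ℝ) ≠ 0 := by positivity
  have h1 : ((m : ℝ) ^ d) ^ (-((1 - γ) / d)) = (m : ℝ) ^ γ / m := by
    rw [← Real.rpow_natCast_mul hm'.le, ← Real.rpow_sub_one hm'.ne']
    congr 1
    field_simp
    ring
  have h2 : (omega γ m : ℝ) ≤ (m : ℝ) ^ γ := Nat.floor_le (by positivity)
  have h3 : (1 : ℝ) ≤ (m : ℝ) ^ γ := Real.one_le_rpow (by exact_mod_cast hm) hγ.le
  have h4 : (m : ℝ) ^ γ < omega γ m + 1 := Nat.lt_floor_add_one _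
  have h5 : (1 : ℝ) ≤ omega γ m := by
    have : 1 ≤ omega γ m := Nat.le_floor (by simpa using h3)
    exact_mod_cast this
  rw [h1]
  refine ⟨by gcongr, ?_, ?_⟩
  · rw [div_right_comm]
    gcongr
    linarith
  · rw [← Real.rpow_natCast_mul hm'.le, mul_comm, Real.rpow_mul_natCast hm'.le]
    gcongr

variable {N h W θ τ β σ g γ ν e₁ e₂ e b ρ : ℝ} {ℓ : ℕ}

lemma mean_order (hN : 1 ≤ N) (hσ : 0 < σ) (hh : 0 < h) (hhN : h ≤ N ^ (-g)) (hθσ : θ ≤ σ * N ^ e₁)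
    (hβ : β ≤ θ * N ^ ρ) :
    N * (β * h ^ (2 * ℓ)) ≤ σ * N ^ (1 + e₁ + ρ - 2 * ℓ * g) := by
  have hN0 : 0 < N := by linarith
  have hpow : h ^ (2 * ℓ) ≤ N ^ (-(2 * ℓ * g)) := by
    refine (pow_le_pow_left₀ hh.le hhN (2 * ℓ)).trans (le_of_eq ?_)
    rw [← Real.rpow_mul_natCast hN0.le]
    congr 1
    push_cast
    ring
  have hβ' : β ≤ σ * N ^ (e₁ + ρ) := by
    rw [Real.rpow_add hN0, ← mul_assoc]
    exact hβ.trans (by gcongr)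
  have hσ0 : β * h ^ (2 * ℓ) ≤ σ * N ^ (e₁ + ρ) * h ^ (2 * ℓ) :=
    mul_le_mul_of_nonneg_right hβ' (by positivity)
  calc _ ≤ N * (σ * N ^ (e₁ + ρ) * N ^ (-(2 * ℓ * g))) := by
        refine mul_le_mul_of_nonneg_left (hσ0.trans ?_) hN0.le
        gcongr
    _ = σ * N ^ (1 + e₁ + ρ - 2 * ℓ * g) := by
        rw [show 1 + e₁ + ρ - 2 * ℓ * g = 1 + (e₁ + ρ) + (-(2 * ℓ * g)) by ring,
          Real.rpow_add hN0 (1 + (e₁ + ρ)), Real.rpow_add hN0 1, Real.rpow_one]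
        ring

/-- The exponent conditions under which `s` dominates the Frobenius norm of the covariances and
its interaction with the means. -/
lemma scale_le {C C' : ℝ} (hC : 0 ≤ C) (hC' : 0 ≤ C') (hN : 1 ≤ N) (hh : 0 < h)
    (hhN : h ≤ N ^ (-g)) (hWN : W ≤ N ^ γ) (hσ : 0 < σ) (hθ : 0 < θ) (hτ : 0 < τ)
    (hθσ : θ ≤ σ * N ^ e₁) (hτσ : τ ≤ σ * N ^ e₂) (hβ : β ≤ θ * N ^ ρ) (hν : 0 < ν)
    (h₁ : 1 / 2 - 2 * ν * g + γ / 2 + e₁ ≤ 1 + e - b) (h₂ : 1 / 2 + e₂ ≤ 1 + e - b)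
    (h₃ : 1 + e₁ + ρ - 2 * ℓ * g + (1 / 2 - 2 * ν * g + γ / 2 + e₁) ≤ 2 * (1 + e - b))
    (h₄ : 1 + e₁ + ρ - 2 * ℓ * g + (1 / 2 + e₂) ≤ 2 * (1 + e - b)) :
    C * (Real.sqrt N * (θ * h ^ (2 * ν) * Real.sqrt W + τ)) ≤
        (2 * C + C') * (σ * N ^ (1 + e - b)) ∧
      (C' * (N * (β * h ^ (2 * ℓ)))) * (C * (Real.sqrt N * (θ * h ^ (2 * ν) * Real.sqrt W + τ))) ≤
        ((2 * C + C') * (σ * N ^ (1 + e - b))) ^ 2 := by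
  have hN0 : 0 < N := by linarith
  have hsN : Real.sqrt N = N ^ (1 / 2 : ℝ) := Real.sqrt_eq_rpow N
  have hsW : Real.sqrt W ≤ N ^ (γ / 2) := by
    rw [Real.sqrt_le_left (by positivity), ← Real.rpow_mul_natCast hN0.le]
    simpa using hWN
  have hh2 : h ^ (2 * ν) ≤ N ^ (-(2 * ν * g)) := by
    refine (Real.rpow_le_rpow hh.le hhN (by positivity)).trans (le_of_eq ?_)
    rw [← Real.rpow_mul hN0.le]
    congr 1
    ring
  have hF : Real.sqrt N * (θ * h ^ (2 * ν) * Real.sqrt W + τ) ≤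
      σ * (N ^ (1 / 2 - 2 * ν * g + γ / 2 + e₁) + N ^ (1 / 2 + e₂)) := by
    calc _ ≤ N ^ (1 / 2 : ℝ) * (σ * N ^ e₁ * N ^ (-(2 * ν * g)) * N ^ (γ / 2) + σ * N ^ e₂) := by
          rw [hsN]
          gcongr
      _ = _ := by
          rw [show 1 / 2 - 2 * ν * g + γ / 2 + e₁ = 1 / 2 + (e₁ + (-(2 * ν * g)) + γ / 2) by ring,
            Real.rpow_add hN0 (1 / 2), Real.rpow_add hN0 (1 / 2), Real.rpow_add hN0 _ (γ / 2),
            Real.rpow_add hN0 e₁]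
          ring
  have hF0 : 0 ≤ Real.sqrt N * (θ * h ^ (2 * ν) * Real.sqrt W + τ) := by positivity
  set F := Real.sqrt N * (θ * h ^ (2 * ν) * Real.sqrt W + τ)
  set x := σ * N ^ (1 + e - b) with hx
  have hx0 : 0 < x := by positivity
  constructor
  · have : F ≤ 2 * x := by
      refine hF.trans ?_
      have e1 : N ^ (1 / 2 - 2 * ν * g + γ / 2 + e₁) ≤ N ^ (1 + e - b) :=
        Real.rpow_le_rpow_of_exponent_le hN h₁
      have e2 : N ^ (1 / 2 + e₂) ≤ N ^ (1 + e - b) := Real.rpow_le_rpow_of_exponent_le hN h₂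
      rw [hx]
      nlinarith
    calc C * F ≤ C * (2 * x) := by gcongr
      _ ≤ (2 * C + C') * x := by nlinarith
  · have hM := mean_order (ℓ := ℓ) hN hσ hh hhN hθσ hβ
    have hMF : N * (β * h ^ (2 * ℓ)) * F ≤ 2 * x ^ 2 := by
      calc _ ≤ (σ * N ^ (1 + e₁ + ρ - 2 * ℓ * g)) *
            (σ * (N ^ (1 / 2 - 2 * ν * g + γ / 2 + e₁) + N ^ (1 / 2 + e₂))) := by
            gcongr
        _ = σ ^ 2 * (N ^ (1 + e₁ + ρ - 2 * ℓ * g + (1 / 2 - 2 * ν * g + γ / 2 + e₁)) +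
              N ^ (1 + e₁ + ρ - 2 * ℓ * g + (1 / 2 + e₂))) := by
            rw [Real.rpow_add hN0 (1 + e₁ + ρ - 2 * ℓ * g),
              Real.rpow_add hN0 (1 + e₁ + ρ - 2 * ℓ * g)]
            ring
        _ ≤ σ ^ 2 * (N ^ (2 * (1 + e - b)) + N ^ (2 * (1 + e - b))) := by
            gcongr
        _ = 2 * x ^ 2 := by
            rw [hx, mul_pow, ← Real.rpow_mul_natCast hN0.le]
            push_cast
            rw [mul_comm (2 : ℝ) (1 + e - b)]
            ring
    calc _ = C' * C * (N * (β * h ^ (2 * ℓ)) * F) := by ring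
      _ ≤ C' * C * (2 * x ^ 2) := by gcongr
      _ ≤ ((2 * C + C') * x) ^ 2 := by
          rw [mul_pow]
          have : 0 ≤ C' * C := by positivity
          have h5 : C' * C * 2 ≤ (2 * C + C') ^ 2 := by nlinarith [sq_nonneg C, sq_nonneg C']
          nlinarith [sq_nonneg x]

end Orders

/-! ### Uniform concentration over the sieve -/

section Sieve

variable {d p : ℕ} [NeZero d] {ν γ : ℝ} {f : Fin p → Loc d → ℝ} {Cf : ℝ}
  {c : ℕ → ((Fin d → ℕ) → Fin d → ℝ) → (Fin d → ℕ) → (Fin d → ℕ) → ℝ} {cLim : (Fin d → ℕ) → ℝ}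
  {ρ₁ ρ₂₁ ρ₂₂ ρ₃₁ ρ₃₂ : ℝ}

/-- The moments of the differences ensure that the quadratic variation with lag `u` is within the
factor `1 ± ε / 3` of `A`, except for an event of probability `8 exp(-x)`. -/
def IsControlled (ν : ℝ) (f : Fin p → Loc d → ℝ) (q : Param p) (ℓ w m u : ℕ)
    (δ : (Fin d → ℕ) → Fin d → ℝ) (a : (Fin d → ℕ) → (Fin d → ℕ) → ℝ) (A ε x : ℝ) : Prop :=
  ∃ (cLim : (Fin d → ℕ) → ℝ) (B η F s : ℝ), IsRegular d ℓ w m δ a cLim B η ∧ 0 < q.α ∧ 0 ≤ F ∧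
    0 < s ∧
    ∑ i ∈ gridIdx d ℓ w m, ∑ i' ∈ gridIdx d ℓ w m, covDiff ν q ℓ w m δ a i i' ^ 2 ≤ F ^ 2 ∧
    F ≤ s ∧ (∑ i ∈ gridIdx d ℓ w m, meanDiff f q ℓ w m δ a i ^ 2) * F ≤ s ^ 2 ∧ 0 < A ∧
    |meanQuadVar ν f q ℓ w m u δ a - A| ≤ ε * A / 6 ∧ x ≤ ε * A / 6 / (16 * s)

lemma IsControlled.measure_le {q : Param p} {ℓ w m u : ℕ} {δ : (Fin d → ℕ) → Fin d → ℝ}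
    {a : (Fin d → ℕ) → (Fin d → ℕ) → ℝ} {κ D ε x : ℝ}
    (hc : IsControlled ν f q ℓ w m u δ a (κ * D) ε (2 * x)) (hx : Real.log 8 ≤ x)
    {Ω : Type*} [MeasurableSpace Ω] {P : Measure Ω} {Y : Loc d → Ω → ℝ}
    (hM : IsModel ν f q P Y) :
    P.real {o | ε / 3 ≤ |quadVar ℓ w m u a (fun i => Y (site m δ i) o) / D / κ - 1|} ≤
      Real.exp (-x) := by
  obtain ⟨cLim, B, η, F, s, h, hα, hF, hs, hcov, hFs, hmean, hA, hbias, hxs⟩ := hc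
  have := hM.measure_abs_quadVar_div_sub_one_le h hα hF hs hcov hFs hmean hA hbias
  simp only [div_div, mul_comm D κ] at this ⊢
  refine this.trans ?_
  calc 8 * Real.exp (-(ε * (κ * D) / (6 * (16 * s)))) ≤ Real.exp (Real.log 8) *
        Real.exp (-(2 * x)) := by
        rw [Real.exp_log (by norm_num)]
        gcongr
        rwa [div_div] at hxs
    _ ≤ Real.exp (-x) := by
        rw [← Real.exp_add]
        exact Real.exp_le_exp.2 (by linarith)

lemma tendsto_natCast_pow_atTop (d : ℕ) [NeZero d] :
    Filter.Tendsto (fun m : ℕ => ((m : ℝ) ^ d)) Filter.atTop Filter.atTop :=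
  (Filter.tendsto_pow_atTop (NeZero.ne d)).comp tendsto_natCast_atTop_atTop

lemma eventually_mul_rpow_le {x y C D : ℝ} (hxy : x < y) (hD : 0 < D) :
    ∀ᶠ m : ℕ in Filter.atTop, C * ((m : ℝ) ^ d) ^ x ≤ D * ((m : ℝ) ^ d) ^ y := by
  have h := ((tendsto_rpow_neg_atTop (sub_pos.2 hxy)).comp
    (tendsto_natCast_pow_atTop d)).const_mul C
  rw [mul_zero] at h
  filter_upwards [h.eventually (gt_mem_nhds hD), Filter.eventually_gt_atTop 0] with m hm hm0
  have hN : (0 : ℝ) < (m : ℝ) ^ d := by positivity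
  simp only [Function.comp] at hm
  rw [show x = -(y - x) + y by ring, Real.rpow_add hN, ← mul_assoc]
  gcongr

/-- Control of a quadratic variation, uniformly over the sieve and the designs. Here `σ` is the
parameter under estimation, `σ D` approximates the expectation, `D` is of order `N^(1 + e)`, and
`θ` and `τ` exceed `σ` by at most the factors `N^e₁` and `N^e₂`. -/
theorem exists_eventually_isControlled (hν : 0 < ν) (hγ : 0 < γ) (hγ1 : γ < 1)
    (hf : ∀ l, HasBoundedPartials (ellStar d ν) Cf (f l))
    (hc : IsDifferencing d (ellStar d ν) γ c cLim) {u : ℕ}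
    {σ : Param p → ℝ} {D : ℕ → ((Fin d → ℕ) → Fin d → ℝ) → ℝ} {e₁ e₂ e b κ : ℝ} (hκ : 0 < κ)
    (hσ : ∀ m : ℕ, 0 < m → ∀ q ∈ sieve p ρ₁ ρ₂₁ ρ₂₂ ρ₃₁ ρ₃₂ (m ^ d), 0 < σ q ∧
      q.θ ≤ σ q * ((m : ℝ) ^ d) ^ e₁ ∧ q.τ ≤ σ q * ((m : ℝ) ^ d) ^ e₂)
    (hD : ∀ᶠ m : ℕ in Filter.atTop, ∀ δ, IsDesign δ → κ * ((m : ℝ) ^ d) ^ (1 + e) ≤ D m δ)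
    (hbias : ∀ ε > 0, ∀ᶠ m : ℕ in Filter.atTop, ∀ δ, IsDesign δ →
      ∀ q ∈ sieve p ρ₁ ρ₂₁ ρ₂₂ ρ₃₁ ρ₃₂ (m ^ d),
        |∑ i ∈ Xi d (ellStar d ν) (omega γ m) m u, covDiff ν q (ellStar d ν) (omega γ m) m δ
          (c m δ) i (i + Pi.single 0 u) - σ q * D m δ| ≤ ε * (σ q * D m δ))
    (h₀ : 1 + e₁ + ρ₁ - 2 * ellStar d ν * ((1 - γ) / d) < 1 + e)
    (h₁ : 1 / 2 - 2 * ν * ((1 - γ) / d) + γ / 2 + e₁ ≤ 1 + e - b) (h₂ : 1 / 2 + e₂ ≤ 1 + e - b)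
    (h₃ : 1 + e₁ + ρ₁ - 2 * ellStar d ν * ((1 - γ) / d) +
      (1 / 2 - 2 * ν * ((1 - γ) / d) + γ / 2 + e₁) ≤ 2 * (1 + e - b))
    (h₄ : 1 + e₁ + ρ₁ - 2 * ellStar d ν * ((1 - γ) / d) + (1 / 2 + e₂) ≤ 2 * (1 + e - b)) :
    ∃ c₀ : ℝ, 0 < c₀ ∧ ∀ ε > 0, ∀ᶠ m : ℕ in Filter.atTop, ∀ δ, IsDesign δ →
      ∀ q ∈ sieve p ρ₁ ρ₂₁ ρ₂₂ ρ₃₁ ρ₃₂ (m ^ d),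
        IsControlled ν f q (ellStar d ν) (omega γ m) m u δ (c m δ) (σ q * D m δ) ε
          (2 * (c₀ * (((m : ℝ) ^ d) ^ b * ε))) := by
  have hd : 0 < d := NeZero.pos d
  obtain ⟨B, hB, hreg⟩ := hc.eventually_isRegular hγ hγ1
  obtain ⟨C, hC, hfrob⟩ := exists_sum_sq_covDiff_le hν hd (Nat.le_ceil _ :
    ν + (d : ℝ) / 2 ≤ ellStar d ν) B
  set C' : ℝ := (p * (B * (|Cf| * (d * ((ellStar d ν : ℝ) + 1)) ^ ellStar d ν))) ^ 2 with hC'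
  have hC'0 : 0 ≤ C' := sq_nonneg _
  refine ⟨κ / (192 * (2 * C + C')), by positivity, fun ε hε => ?_⟩
  filter_upwards [hreg 1 one_pos, hD, hbias (ε / 12) (by positivity), Filter.eventually_gt_atTop 0,
    eventually_mul_rpow_le (d := d) (C := C') h₀ (by positivity : 0 < ε / 12 * κ)]
    with m hm hDm hbm hm0 hmean δ hδ q hq
  obtain ⟨hσ0, hθσ, hτσ⟩ := hσ m hm0 q hq
  have hb := hbm δ hδ q hq
  obtain ⟨hθ, hα, hτ, hβ, -, -⟩ := hq
  have hR := hm δ hδ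
  have hDm := hDm δ hδ
  have hN : (1 : ℝ) ≤ (m : ℝ) ^ d := one_le_pow₀ (by exact_mod_cast hm0)
  obtain ⟨hh1, -, hW⟩ := omega_bounds (γ := γ) hd hγ hm0
  have hhpos : (0 : ℝ) < (omega γ m : ℝ) / m := by
    have := hR.pos_lag
    positivity
  rw [div_le_iff₀ hθ, Nat.cast_pow] at hβ
  have hβ : ‖q.β‖ ^ 2 ≤ q.θ * ((m : ℝ) ^ d) ^ ρ₁ := by linarith
  set N : ℝ := (m : ℝ) ^ d with hNdef
  have hN0 : 0 < N := by linarith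
  obtain ⟨hs1, hs2⟩ := scale_le (ℓ := ellStar d ν) hC.le hC'0 hN hhpos hh1
    hW hσ0 hθ hτ hθσ hτσ hβ hν
    h₁ h₂ h₃ h₄
  have hMu := hR.sum_sq_meanDiff_le (q := q) hf
  have hMo := mean_order (ℓ := ellStar d ν) hN hσ0 hhpos hh1 hθσ hβ
  have hA : 0 < σ q * D m δ := mul_pos hσ0 (lt_of_lt_of_le (by positivity) hDm)
  refine ⟨cLim, B, 1, _, _, hR, hα, ?_, ?_, hfrob hR q hθ hα hτ, hs1, ?_, hA, ?_, ?_⟩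
  · positivity
  · positivity
  · refine le_trans (mul_le_mul_of_nonneg_right hMu (by positivity)) hs2
  · have h2 := (abs_sum_meanDiff_mul_le (u := u) (f := f) (q := q) (ℓ := ellStar d ν)
      (w := omega γ m) (m := m) (δ := δ) (a := c m δ)).trans hMu
    have h3 : C' * (N * (‖q.β‖ ^ 2 * ((omega γ m : ℝ) / m) ^ (2 * ellStar d ν))) ≤
        ε / 12 * (σ q * D m δ) := by
      calc _ ≤ C' * (σ q * N ^ (1 + e₁ + ρ₁ - 2 * ellStar d ν * ((1 - γ) / d))) := by gcongr
        _ = σ q * (C' * N ^ (1 + e₁ + ρ₁ - 2 * ellStar d ν * ((1 - γ) / d))) := by ring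
        _ ≤ σ q * (ε / 12 * κ * N ^ (1 + e)) := by gcongr
        _ = ε / 12 * (σ q * (κ * N ^ (1 + e))) := by ring
        _ ≤ _ := by gcongr
    rw [meanQuadVar, Finset.sum_add_distrib, add_sub_right_comm]
    refine (abs_add_le _ _).trans ?_
    linarith
  · rw [le_div_iff₀ (by positivity)]
    have hsplit : N ^ (1 + e) = N ^ (1 + e - b) * N ^ b := by
      rw [← Real.rpow_add hN0]; congr 1; ring
    calc 2 * (κ / (192 * (2 * C + C')) * (N ^ b * ε)) *
          (16 * ((2 * C + C') * (σ q * N ^ (1 + e - b)))) =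
          ε / 6 * (σ q * (κ * (N ^ (1 + e - b) * N ^ b))) := by
          field_simp
          ring
      _ ≤ ε / 6 * (σ q * D m δ) := by
          rw [← hsplit]
          gcongr
      _ = _ := by ring

end Sieve

/-! ### The two estimators -/

lemma norm_latticePoint_sub {d : ℕ} (k k' : Fin d → ℕ) :
    ‖latticePoint k - latticePoint k'‖ = Real.sqrt (∑ j, ((k j : ℝ) - (k' j : ℝ)) ^ 2) := by
  rw [EuclideanSpace.norm_eq]
  simp [latticePoint]

lemma exists_nat_of_eventually {d : ℕ} {Q : ℕ → Prop} (h : ∀ᶠ m in Filter.atTop, Q m) :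
    ∃ n₀ : ℕ, ∀ m, n₀ < m ^ d → Q m := by
  obtain ⟨m₀, hm₀⟩ := Filter.eventually_atTop.1 h
  exact ⟨m₀ ^ d, fun m hm => hm₀ m (lt_of_pow_lt_pow_left₀ d (Nat.zero_le _) hm).le⟩

section Estimators

variable {d p : ℕ} [NeZero d] {ν γ : ℝ} {f : Fin p → Loc d → ℝ} {Cf : ℝ}
  {c : ℕ → ((Fin d → ℕ) → Fin d → ℝ) → (Fin d → ℕ) → (Fin d → ℕ) → ℝ} {cLim : (Fin d → ℕ) → ℝ}
  {ρ₁ ρ₂₁ ρ₂₂ ρ₃₁ ρ₃₂ b : ℝ}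

lemma annihilates_latticePoint {ℓ : ℕ} (hγ : 0 < γ) (hγ1 : γ < 1)
    (hc : IsDifferencing d ℓ γ c cLim) :
    Annihilates ℓ (multiIdx d ℓ) cLim (fun k => latticePoint k) :=
  (hc.sum_cLim hγ hγ1).2

lemma mixtureDiff_latticePoint {ℓ : ℕ} (hν : 0 < ν) (hℓ : ν < ℓ) (hγ : 0 < γ) (hγ1 : γ < 1)
    (hc : IsDifferencing d ℓ γ c cLim) :
    mixtureDiff ν 0 (multiIdx d ℓ) cLim cLim latticePoint latticePoint =
      xiStar ν * H ℓ ν cLim := by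
  rw [mixtureDiff_zero_eq_sum hν hℓ (annihilates_latticePoint hγ hγ1 hc), H]
  simp only [norm_latticePoint_sub]

/-- The constant `ξ* H` normalising `θ̂` is positive, as a nondegenerate variance. -/
lemma xiStar_mul_H_pos {ℓ : ℕ} (hν : 0 < ν) (hℓ : ν < ℓ) (hγ : 0 < γ) (hγ1 : γ < 1)
    (hc : IsDifferencing d ℓ γ c cLim) : 0 < xiStar ν * H ℓ ν cLim := by
  rw [← mixtureDiff_latticePoint hν hℓ hγ hγ1 hc]
  refine mixtureDiff_zero_pos hν hℓ (annihilates_latticePoint hγ hγ1 hc) ?_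
    (hc.exists_cLim_ne_zero hγ hγ1)
  intro k _ k' _ h
  ext j
  have := congrArg (fun x : Loc d => x j) h
  simpa [latticePoint] using this

lemma lt_ellStar : ν < ellStar d ν := by
  have h1 : ν + (d : ℝ) / 2 ≤ ellStar d ν := Nat.le_ceil _
  have h2 : (0 : ℝ) < d := by exact_mod_cast NeZero.pos d
  linarith

theorem exists_eventually_isControlled_theta (hν : 0 < ν) (hγ : 0 < γ) (hγ1 : γ < 1)
    (hf : ∀ l, HasBoundedPartials (ellStar d ν) Cf (f l))
    (hc : IsDifferencing d (ellStar d ν) γ c cLim) (hρ₁ : ρ₁ < 1 - γ) (hρ₃₂ : ρ₃₂ < (1 - γ) / d)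
    (h₁ : b ≤ (1 - γ) / 2) (h₂ : b ≤ 1 / 2 - 2 * ν * ((1 - γ) / d) - ρ₂₂)
    (h₃ : b ≤ (1 - γ) / 4 + (ellStar d ν - ν) * ((1 - γ) / d) - ρ₁ / 2)
    (h₄ : b ≤ 1 / 4 + (ellStar d ν - 2 * ν) * ((1 - γ) / d) - (ρ₁ + ρ₂₂) / 2) :
    ∃ c₀ : ℝ, 0 < c₀ ∧ ∀ ε > 0, ∀ᶠ m : ℕ in Filter.atTop, ∀ δ, IsDesign δ →
      ∀ q ∈ sieve p ρ₁ ρ₂₁ ρ₂₂ ρ₃₁ ρ₃₂ (m ^ d),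
        IsControlled ν f q (ellStar d ν) (omega γ m) m 1 δ (c m δ)
          (q.θ * gNorm (ellStar d ν) (omega γ m) m ν cLim) ε
          (2 * (c₀ * (((m : ℝ) ^ d) ^ b * ε))) := by
  have hd : 0 < d := NeZero.pos d
  have hd' : (0 : ℝ) < d := by exact_mod_cast hd
  have hℓ : ν + (d : ℝ) / 2 ≤ ellStar d ν := Nat.le_ceil _
  set ℓ := ellStar d ν with hℓdef
  set g : ℝ := (1 - γ) / d with hg
  have hgd : g * d = 1 - γ := by rw [hg]; field_simp
  have hg0 : 0 < g := div_pos (by linarith) hd'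
  have hℓg : g * ν + (1 - γ) / 2 ≤ ℓ * g := by nlinarith
  obtain ⟨B, hB, hreg⟩ := hc.eventually_isRegular hγ hγ1
  set L := xiStar ν * H ℓ ν cLim with hL
  have hL0 : 0 < L := xiStar_mul_H_pos hν lt_ellStar hγ hγ1 hc
  have hgN : ∀ m, gNorm ℓ (omega γ m) m ν cLim =
      ((omega γ m : ℝ) / m) ^ (2 * ν) * ((Xi d ℓ (omega γ m) m 1).card * L) := fun m => by
    rw [gNorm, hL]; ring
  refine exists_eventually_isControlled (σ := Param.θ)
    (D := fun m _ => gNorm ℓ (omega γ m) m ν cLim) (e₁ := 0) (e₂ := ρ₂₂) (e := -(2 * ν * g))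
    (κ := (1 / 2) ^ (2 * ν) * (1 / 2) ^ d * L) hν hγ hγ1 hf hc (by positivity) ?_ ?_ ?_ ?_ ?_ ?_ ?_
    ?_
  · rintro m - q ⟨hθ, -, -, -, ⟨-, hτ⟩, -⟩
    rw [div_le_iff₀ hθ, Nat.cast_pow] at hτ
    refine ⟨hθ, by simp, by linarith⟩
  · filter_upwards [hreg 1 one_pos, Filter.eventually_gt_atTop 0] with m hm hm0 δ hδ
    obtain ⟨-, h2, -⟩ := omega_bounds (γ := γ) hd hγ hm0
    have hN : (0 : ℝ) < (m : ℝ) ^ d := by positivity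
    have hcard := (hm δ hδ).le_card_Xi (u := 1) le_rfl
    rw [hgN]
    calc _ = (((m : ℝ) ^ d) ^ (-g) / 2) ^ (2 * ν) * (((m : ℝ) / 2) ^ d * L) := by
          have e1 : (((m : ℝ) ^ d) ^ (-g) / 2) ^ (2 * ν) =
              ((m : ℝ) ^ d) ^ (-(2 * ν * g)) * (1 / 2) ^ (2 * ν) := by
            rw [div_eq_mul_one_div, Real.mul_rpow (by positivity) (by norm_num),
              ← Real.rpow_mul hN.le, show -g * (2 * ν) = -(2 * ν * g) by ring]
          have e2 : ((m : ℝ) / 2) ^ d = (m : ℝ) ^ d * (1 / 2) ^ d := by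
            rw [div_eq_mul_one_div, mul_pow]
          rw [e1, e2, Real.rpow_add hN, Real.rpow_one]
          ring
      _ ≤ _ := by gcongr
  · intro ε hε
    obtain ⟨η, hη, hlim⟩ := exists_abs_maternDiff_lag_sub_lt hν
      (lt_ellStar : ν < ellStar d ν) cLim (mul_pos hε hL0)
    rw [mixtureDiff_latticePoint hν lt_ellStar hγ hγ1 hc] at hlim
    filter_upwards [hreg η hη, Filter.eventually_gt_atTop 0,
      eventually_mul_rpow_le (d := d) (C := 1) (D := η / 2) (sub_neg.2 hρ₃₂) (by positivity)]
      with m hm hm0 hsmall δ hδ q hq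
    obtain ⟨hθ, hα, hτ, -, -, ⟨-, hα2⟩⟩ := hq
    have hR := hm δ hδ
    obtain ⟨h1, -, -⟩ := omega_bounds (γ := γ) hd hγ hm0
    have hN : (0 : ℝ) < (m : ℝ) ^ d := by positivity
    have hw := hR.pos_lag
    have hhpos : (0 : ℝ) < (omega γ m : ℝ) / m := by positivity
    have hαη : q.α * (omega γ m / m) < η := by
      rw [Nat.cast_pow] at hα2
      calc q.α * (omega γ m / m) ≤ ((m : ℝ) ^ d) ^ ρ₃₂ * ((m : ℝ) ^ d) ^ (-g) := by gcongr
        _ = 1 * ((m : ℝ) ^ d) ^ (ρ₃₂ - g) := by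
            rw [← Real.rpow_add hN, one_mul, sub_eq_add_neg]
        _ ≤ η / 2 * ((m : ℝ) ^ d) ^ (0 : ℝ) := hsmall
        _ < η := by rw [Real.rpow_zero]; linarith
    set x : ℝ := q.θ * ((omega γ m : ℝ) / m) ^ (2 * ν) with hx
    have hx0 : 0 < x := by positivity
    have hterm : ∀ i ∈ Xi d ℓ (omega γ m) m 1,
        |covDiff ν q ℓ (omega γ m) m δ (c m δ) i (i + Pi.single 0 1) - x * L| ≤ x * (ε * L) := by
      intro i hi
      rw [covDiff, overlap_add_single hR.two_le, mul_zero, add_zero, ← hx, ← mul_sub, abs_mul,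
        abs_of_pos hx0]
      exact mul_le_mul_of_nonneg_left (hlim hR _ (by positivity) hαη i hi).le hx0.le
    have hA : q.θ * gNorm ℓ (omega γ m) m ν cLim = ∑ _i ∈ Xi d ℓ (omega γ m) m 1, x * L := by
      rw [hgN, Finset.sum_const, nsmul_eq_mul, hx]; ring
    rw [hA, ← Finset.sum_sub_distrib]
    refine (Finset.abs_sum_le_sum_abs _ _).trans ((Finset.sum_le_sum hterm).trans (le_of_eq ?_))
    rw [Finset.mul_sum]
    exact Finset.sum_congr rfl fun _ _ => by ring
  · linarith
  · linarith
  · linarith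
  · linarith
  · linarith

theorem exists_eventually_isControlled_tau (hν : 0 < ν) (hγ : 0 < γ) (hγ1 : γ < 1)
    (hf : ∀ l, HasBoundedPartials (ellStar d ν) Cf (f l))
    (hc : IsDifferencing d (ellStar d ν) γ c cLim) (hρ₁ : ρ₁ < 1 - γ)
    (hρ₂₁ : ρ₂₁ < 2 * ν * ((1 - γ) / d))
    (h₁ : b ≤ 1 / 2) (h₂ : b ≤ 2 * ν * ((1 - γ) / d) + (1 - γ) / 2 - ρ₂₁)
    (h₃ : b ≤ 1 / 4 + ellStar d ν * ((1 - γ) / d) - (ρ₁ + ρ₂₁) / 2)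
    (h₄ : b ≤ (ν + ellStar d ν) * ((1 - γ) / d) + (1 - γ) / 4 - (ρ₁ + 2 * ρ₂₁) / 2) :
    ∃ c₀ : ℝ, 0 < c₀ ∧ ∀ ε > 0, ∀ᶠ m : ℕ in Filter.atTop, ∀ δ, IsDesign δ →
      ∀ q ∈ sieve p ρ₁ ρ₂₁ ρ₂₂ ρ₃₁ ρ₃₂ (m ^ d),
        IsControlled ν f q (ellStar d ν) (omega γ m) m 0 δ (c m δ)
          (q.τ * CV0 (ellStar d ν) (omega γ m) m (c m δ)) ε
          (2 * (c₀ * (((m : ℝ) ^ d) ^ b * ε))) := by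
  have hd : 0 < d := NeZero.pos d
  have hd' : (0 : ℝ) < d := by exact_mod_cast hd
  have hℓ : ν + (d : ℝ) / 2 ≤ ellStar d ν := Nat.le_ceil _
  set ℓ := ellStar d ν with hℓdef
  set g : ℝ := (1 - γ) / d with hg
  have hgd : g * d = 1 - γ := by rw [hg]; field_simp
  have hg0 : 0 < g := div_pos (by linarith) hd'
  have hℓg : g * ν + (1 - γ) / 2 ≤ ℓ * g := by nlinarith
  obtain ⟨B, hB, hreg⟩ := hc.eventually_isRegular hγ hγ1
  obtain ⟨k, hk, hk0⟩ := hc.exists_cLim_ne_zero hγ hγ1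
  have hk0 : 0 < |cLim k| := abs_pos.2 hk0
  set κ : ℝ := (1 / 2) ^ d * (|cLim k| / 2) ^ 2 with hκ
  have hD : ∀ᶠ m : ℕ in Filter.atTop, ∀ δ, IsDesign δ →
      κ * (m : ℝ) ^ d ≤ CV0 ℓ (omega γ m) m (c m δ) := by
    filter_upwards [hreg (|cLim k| / 2) (by positivity)] with m hm δ hδ
    refine le_trans (le_of_eq ?_) ((hm δ hδ).le_CV0 hk le_rfl)
    rw [hκ, div_eq_mul_one_div (m : ℝ) 2, mul_pow]
    ring
  refine exists_eventually_isControlled (σ := Param.τ)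
    (D := fun m δ => CV0 ℓ (omega γ m) m (c m δ)) (e₁ := ρ₂₁) (e₂ := 0) (e := 0)
    (κ := κ) hν hγ hγ1 hf hc (by positivity) ?_ ?_ ?_ ?_ ?_ ?_ ?_ ?_
  · rintro m hm0 q ⟨hθ, -, hτ, -, ⟨hτθ, -⟩, -⟩
    refine ⟨hτ, ?_, by simp⟩
    have hN : (0 : ℝ) < (m : ℝ) ^ d := by positivity
    rw [le_div_iff₀ hθ, Nat.cast_pow, Real.rpow_neg hN.le] at hτθ
    rwa [inv_mul_le_iff₀ (by positivity), mul_comm] at hτθ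
  · simpa using hD
  · intro ε hε
    obtain ⟨C, hC, hle⟩ := exists_sum_sq_maternDiff_le hν hd hℓ B
    filter_upwards [hreg 1 one_pos, hD, Filter.eventually_gt_atTop 0,
      eventually_mul_rpow_le (d := d) (C := C) (D := ε * κ) (sub_neg.2 hρ₂₁) (by positivity)]
      with m hm hDm hm0 hsmall δ hδ q hq
    obtain ⟨hθ, hα, hτ, -, ⟨hτθ, -⟩, -⟩ := hq
    have hR := hm δ hδ
    obtain ⟨h1, -, -⟩ := omega_bounds (γ := γ) hd hγ hm0
    have hN : (0 : ℝ) < (m : ℝ) ^ d := by positivity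
    have hw := hR.pos_lag
    have hhpos : (0 : ℝ) < (omega γ m : ℝ) / m := by positivity
    have hθτ : q.θ ≤ q.τ * ((m : ℝ) ^ d) ^ ρ₂₁ := by
      rw [le_div_iff₀ hθ, Nat.cast_pow, Real.rpow_neg hN.le] at hτθ
      rwa [inv_mul_le_iff₀ (by positivity), mul_comm] at hτθ
    have hh2 : ((omega γ m : ℝ) / m) ^ (2 * ν) ≤ ((m : ℝ) ^ d) ^ (-(2 * ν * g)) := by
      refine (Real.rpow_le_rpow hhpos.le h1 (by positivity)).trans (le_of_eq ?_)
      rw [← Real.rpow_mul hN.le]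
      congr 1
      ring
    set x : ℝ := q.θ * ((omega γ m : ℝ) / m) ^ (2 * ν) with hx
    have hx0 : 0 < x := by positivity
    have hxC : x * C ≤ q.τ * (ε * κ) := by
      calc x * C ≤ q.τ * ((m : ℝ) ^ d) ^ ρ₂₁ * ((m : ℝ) ^ d) ^ (-(2 * ν * g)) * C := by
            rw [hx]; gcongr
        _ = q.τ * (C * ((m : ℝ) ^ d) ^ (ρ₂₁ - 2 * ν * g)) := by
            rw [sub_eq_add_neg, Real.rpow_add hN]; ring
        _ ≤ q.τ * (ε * κ * ((m : ℝ) ^ d) ^ (0 : ℝ)) := by gcongr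
        _ = _ := by rw [Real.rpow_zero, mul_one]
    have hA : q.τ * CV0 ℓ (omega γ m) m (c m δ) =
        ∑ i ∈ Xi d ℓ (omega γ m) m 0, q.τ * overlap ℓ (omega γ m) (c m δ) i i := by
      rw [CV0, Finset.mul_sum]
      exact Finset.sum_congr rfl fun i _ => by rw [overlap_self hw]
    have hterm : ∀ i ∈ Xi d ℓ (omega γ m) m 0,
        |covDiff ν q ℓ (omega γ m) m δ (c m δ) i (i + Pi.single 0 0) -
          q.τ * overlap ℓ (omega γ m) (c m δ) i i| ≤ q.τ * (ε * κ) := by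
      intro i hi
      rw [Pi.single_zero, add_zero, covDiff, add_sub_cancel_right, ← hx, abs_mul, abs_of_pos hx0]
      refine le_trans ?_ hxC
      exact mul_le_mul_of_nonneg_left ((hle hR _ (by positivity)).1 i (mem_gridIdx_of_mem_Xi hi))
        hx0.le
    calc _ = |∑ i ∈ Xi d ℓ (omega γ m) m 0, (covDiff ν q ℓ (omega γ m) m δ (c m δ) i
          (i + Pi.single 0 0) - q.τ * overlap ℓ (omega γ m) (c m δ) i i)| := by
          rw [hA, Finset.sum_sub_distrib]
      _ ≤ ∑ _i ∈ Xi d ℓ (omega γ m) m 0, q.τ * (ε * κ) :=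
          (Finset.abs_sum_le_sum_abs _ _).trans (Finset.sum_le_sum hterm)
      _ = (Xi d ℓ (omega γ m) m 0).card * (q.τ * (ε * κ)) := by simp
      _ ≤ (m : ℝ) ^ d * (q.τ * (ε * κ)) := by
          gcongr
          exact card_Xi_le
      _ = ε * (q.τ * (κ * (m : ℝ) ^ d)) := by ring
      _ ≤ _ := by
          gcongr
          exact hDm δ hδ
  · linarith
  · linarith
  · linarith
  · linarith
  · linarith

/-- A fixed parameter eventually belongs to the sieve. -/
lemma eventually_mem_sieve {q₀ : Param p} (hθ₀ : 0 < q₀.θ) (hα₀ : 0 < q₀.α) (hτ₀ : 0 < q₀.τ)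
    (hρ₁ : 0 < ρ₁) (hρ₂₁ : 0 < ρ₂₁) (hρ₂₂ : 0 < ρ₂₂) (hρ₃₁ : 0 < ρ₃₁) (hρ₃₂ : 0 < ρ₃₂) :
    ∀ᶠ m : ℕ in Filter.atTop, q₀ ∈ sieve p ρ₁ ρ₂₁ ρ₂₂ ρ₃₁ ρ₃₂ (m ^ d) := by
  have hup : ∀ {ρ : ℝ}, 0 < ρ → ∀ y : ℝ, ∀ᶠ m : ℕ in Filter.atTop, y ≤ ((m ^ d : ℕ) : ℝ) ^ ρ := by
    intro ρ hρ y
    have := ((tendsto_rpow_atTop hρ).comp (tendsto_natCast_pow_atTop d)).eventually_ge_atTop y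
    filter_upwards [this] with m hm
    rwa [Nat.cast_pow]
  have hlo : ∀ {ρ : ℝ}, 0 < ρ → ∀ y : ℝ, 0 < y →
      ∀ᶠ m : ℕ in Filter.atTop, ((m ^ d : ℕ) : ℝ) ^ (-ρ) ≤ y := by
    intro ρ hρ y hy
    have := ((tendsto_rpow_neg_atTop hρ).comp
      (tendsto_natCast_pow_atTop d)).eventually (ge_mem_nhds hy)
    filter_upwards [this] with m hm
    rwa [Nat.cast_pow]
  filter_upwards [hup hρ₁ (‖q₀.β‖ ^ 2 / q₀.θ), hlo hρ₂₁ (q₀.τ / q₀.θ) (by positivity),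
    hup hρ₂₂ (q₀.τ / q₀.θ), hlo hρ₃₁ q₀.α hα₀, hup hρ₃₂ q₀.α] with m h1 h2 h3 h4 h5
  exact ⟨hθ₀, hα₀, hτ₀, h1, ⟨h2, h3⟩, ⟨h4, h5⟩⟩

/-- An estimate close to `κ₀` in relative terms is far from any `κ` which is not close to `κ₀`. -/
lemma le_abs_div_sub_one {κ κ₀ x ε : ℝ} (hκ : 0 < κ) (hκ₀ : 0 < κ₀) (hε : 0 < ε)
    (hε2 : ε < 1 / 2) (h : ε ≤ |κ / κ₀ - 1|) (hx : |x / κ₀ - 1| ≤ ε / 2) :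
    ε / 3 ≤ |x / κ - 1| := by
  have hr : 0 < κ / κ₀ := div_pos hκ hκ₀
  have hxr : x / κ = (x / κ₀) / (κ / κ₀) := by field_simp
  rw [hxr, div_sub_one hr.ne', abs_div, abs_of_pos hr, le_div_iff₀ hr]
  set r := κ / κ₀
  set y := x / κ₀
  obtain ⟨hy1, hy2⟩ := abs_le.1 hx
  rcases le_abs.1 h with h | h
  · rw [abs_sub_comm]
    refine le_trans ?_ (le_abs_self _)
    nlinarith
  · refine le_trans ?_ (le_abs_self _)
    nlinarith

lemma IsControlled.tail_bounds {q : Param p} {ℓ w m u : ℕ} {δ : (Fin d → ℕ) → Fin d → ℝ}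
    {a : (Fin d → ℕ) → (Fin d → ℕ) → ℝ} {κ D ε c₀ y : ℝ}
    (hc : IsControlled ν f q ℓ w m u δ a (κ * D) ε (2 * (c₀ * y))) (hc₀ : 0 < c₀)
    (hx : Real.log 8 ≤ c₀ * y) (hκ : 0 < κ) (hε : 0 < ε)
    {Ω : Type*} [MeasurableSpace Ω] {P : Measure Ω} {Y : Loc d → Ω → ℝ} (hM : IsModel ν f q P Y) :
    P.real {o | ε / 2 ≤ |quadVar ℓ w m u a (fun i => Y (site m δ i) o) / D / κ - 1|} ≤
      Real.exp (-(c₀ * phi y)) ∧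
    ∀ κ₀ : ℝ, 0 < κ₀ → ε < 1 / 2 → ε ≤ |κ / κ₀ - 1| →
      P.real {o | |quadVar ℓ w m u a (fun i => Y (site m δ i) o) / D / κ₀ - 1| ≤ ε / 2} ≤
        Real.exp (-(c₀ * phi y)) := by
  have hP := hM.gaussian.isProbabilityMeasure
  have h := hc.measure_le hx hM
  have hphi : Real.exp (-(c₀ * y)) ≤ Real.exp (-(c₀ * phi y)) := by
    refine Real.exp_le_exp.2 (neg_le_neg ?_)
    exact mul_le_mul_of_nonneg_left (min_le_right _ _) hc₀.le
  refine ⟨(measureReal_mono fun o ho => ?_).trans (h.trans hphi),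
    fun κ₀ hκ₀ hε2 hκκ => (measureReal_mono fun o ho => ?_).trans (h.trans hphi)⟩
  · exact le_trans (by linarith) (show ε / 2 ≤ _ from ho)
  · exact le_abs_div_sub_one hκ hκ₀ hε hε2 hκκ ho

lemma eventually_log_le {c₀ ε : ℝ} (hb : 0 < b) (hc₀ : 0 < c₀) (hε : 0 < ε) :
    ∀ᶠ m : ℕ in Filter.atTop, Real.log 8 ≤ c₀ * (((m : ℝ) ^ d) ^ b * ε) := by
  have := ((tendsto_rpow_atTop hb).comp (tendsto_natCast_pow_atTop d)).eventually_ge_atTop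
    (Real.log 8 / (c₀ * ε))
  filter_upwards [this] with m hm
  rw [div_le_iff₀ (by positivity)] at hm
  simp only [Function.comp] at hm
  linarith

end Estimators

end MaternNugget

end

open MaternNugget in
theorem theorem3
    (d : ℕ) [NeZero d] (p : ℕ) (ν : ℝ) (hν : 0 < ν)
    (f : Fin p → Loc d → ℝ) (Cf : ℝ)
    (hf : ∀ l, HasBoundedPartials ⌈ν + (d : ℝ) / 2⌉₊ Cf (f l))
    (q₀ : Param p) (hθ₀ : 0 < q₀.θ) (hα₀ : 0 < q₀.α) (hτ₀ : 0 < q₀.τ)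
    (γ : ℝ) (hγ : max (1 - d / (4 * ν)) 0 < γ) (hγ1 : γ < 1)
    (ρ₁ ρ₂₁ ρ₂₂ ρ₃₁ ρ₃₂ : ℝ)
    (hρ₁ : 0 < ρ₁ ∧ ρ₁ < 1 - γ)
    (hρ₂₁ : 0 < ρ₂₁ ∧ ρ₂₁ < 2 * ν * (1 - γ) / d)
    (hρ₂₂ : 0 < ρ₂₂ ∧ ρ₂₂ < 1 / 2 - 2 * (1 - γ) * ν / d)
    (hρ₃₁ : 0 < ρ₃₁)
    (hρ₃₂ : 0 < ρ₃₂ ∧ ρ₃₂ < (1 - γ) / d) :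
    -- differencing constants exist
    (∃ c cLim, IsDifferencing d (ellStar d ν) γ c cLim) ∧
    ∃ ς₀ : ℝ, 0 < ς₀ ∧ ∀ ς : ℝ, 0 < ς → ς < ς₀ →
      0 < b₁ d ν γ ρ₁ ρ₂₂ ς ∧ 0 < b₂ d ν γ ρ₁ ρ₂₁ ς ∧
      ∀ c cLim, IsDifferencing d (ellStar d ν) γ c cLim →
        -- part (i): the estimator of the microergodic parameter
        (∃ c₁ : ℝ, 0 < c₁ ∧ ∀ ε₁ : ℝ, 0 < ε₁ → ε₁ < 1 / 2 →
          ∃ n₀ : ℕ, ∀ m : ℕ, n₀ < m ^ d → Even (omega γ m) → ∀ δ, IsDesign δ →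
            (∀ (Ω : Type*) [MeasurableSpace Ω] (P : Measure Ω) [IsProbabilityMeasure P]
              (Y : Loc d → Ω → ℝ), IsModel ν f q₀ P Y →
              P.real {o | ε₁ / 2 ≤
                  |thetaHat ν γ m (c m δ) cLim (fun i => Y (site m δ i) o) / q₀.θ - 1|}
                ≤ Real.exp (-(c₁ * phi (((m ^ d : ℕ) : ℝ) ^ b₁ d ν γ ρ₁ ρ₂₂ ς * ε₁)))) ∧
            (∀ q ∈ sieve p ρ₁ ρ₂₁ ρ₂₂ ρ₃₁ ρ₃₂ (m ^ d), ε₁ ≤ |q.θ / q₀.θ - 1| →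
              ∀ (Ω : Type*) [MeasurableSpace Ω] (P : Measure Ω) [IsProbabilityMeasure P]
              (Y : Loc d → Ω → ℝ), IsModel ν f q P Y →
              P.real {o |
                  |thetaHat ν γ m (c m δ) cLim (fun i => Y (site m δ i) o) / q₀.θ - 1|
                    ≤ ε₁ / 2}
                ≤ Real.exp (-(c₁ * phi (((m ^ d : ℕ) : ℝ) ^ b₁ d ν γ ρ₁ ρ₂₂ ς * ε₁))))) ∧
        -- part (ii): the estimator of the nugget parameter
        (∃ c₂ : ℝ, 0 < c₂ ∧ ∀ ε₂ : ℝ, 0 < ε₂ → ε₂ < 1 / 2 →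
          ∃ n₀ : ℕ, ∀ m : ℕ, n₀ < m ^ d → Even (omega γ m) → ∀ δ, IsDesign δ →
            (∀ (Ω : Type*) [MeasurableSpace Ω] (P : Measure Ω) [IsProbabilityMeasure P]
              (Y : Loc d → Ω → ℝ), IsModel ν f q₀ P Y →
              P.real {o | ε₂ / 2 ≤
                  |tauHat ν γ m (c m δ) (fun i => Y (site m δ i) o) / q₀.τ - 1|}
                ≤ Real.exp (-(c₂ * phi (((m ^ d : ℕ) : ℝ) ^ b₂ d ν γ ρ₁ ρ₂₁ ς * ε₂)))) ∧
            (∀ q ∈ sieve p ρ₁ ρ₂₁ ρ₂₂ ρ₃₁ ρ₃₂ (m ^ d), ε₂ ≤ |q.τ / q₀.τ - 1| →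
              ∀ (Ω : Type*) [MeasurableSpace Ω] (P : Measure Ω) [IsProbabilityMeasure P]
              (Y : Loc d → Ω → ℝ), IsModel ν f q P Y →
              P.real {o |
                  |tauHat ν γ m (c m δ) (fun i => Y (site m δ i) o) / q₀.τ - 1| ≤ ε₂ / 2}
                ≤ Real.exp (-(c₂ * phi (((m ^ d : ℕ) : ℝ) ^ b₂ d ν γ ρ₁ ρ₂₁ ς * ε₂))))) := by
  have hd : (0 : ℝ) < d := by exact_mod_cast NeZero.pos d
  have hγ0 : 0 < γ := lt_of_le_of_lt (le_max_right _ _) hγ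
  have hℓ : ν + (d : ℝ) / 2 ≤ ellStar d ν := Nat.le_ceil _
  set ℓ := ellStar d ν with hℓdef
  obtain ⟨g, hg⟩ : ∃ g : ℝ, g = (1 - γ) / d := ⟨_, rfl⟩
  have hgd : g * d = 1 - γ := by rw [hg]; field_simp
  have hg0 : 0 < g := hg ▸ div_pos (by linarith) hd
  have hℓg : g * ν + (1 - γ) / 2 ≤ g * ℓ := by nlinarith
  have hgν : 0 < g * ν := by positivity
  -- the exponents in terms of `g`, the decay rate of the mesh size in the sample size
  have hρ₂₁g : ρ₂₁ < 2 * (g * ν) := by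
    have : 2 * ν * (1 - γ) / d = 2 * (g * ν) := by rw [hg]; ring
    linarith [hρ₂₁.2]
  have hρ₂₂g : ρ₂₂ < 1 / 2 - 2 * (g * ν) := by
    have : 2 * (1 - γ) * ν / d = 2 * (g * ν) := by rw [hg]; ring
    linarith [hρ₂₂.2]
  have hb₁ : ∀ ς, b₁ d ν γ ρ₁ ρ₂₂ ς =
      min (min (1 / 2 - 2 * (g * ν) - ρ₂₂) ((1 - γ) / 2 - ς))
        (min (1 / 4 + (g * ℓ - 2 * (g * ν)) - (ρ₁ + ρ₂₂) / 2)
          ((1 - γ) / 4 + (g * ℓ - g * ν) - ρ₁ / 2 - ς)) := by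
    intro ς
    have e1 : 2 * (1 - γ) * ν / d = 2 * (g * ν) := by rw [hg]; ring
    have e2 : (1 - γ) * ((ellStar d ν : ℝ) - 2 * ν) / d = g * ℓ - 2 * (g * ν) := by rw [hg]; ring
    have e3 : (1 - γ) * ((ellStar d ν : ℝ) - ν) / d = g * ℓ - g * ν := by rw [hg]; ring
    rw [b₁, e1, e2, e3]
  have hb₂ : ∀ ς, b₂ d ν γ ρ₁ ρ₂₁ ς =
      min (min (1 / 2) (2 * (g * ν) + (1 - γ) / 2 - ρ₂₁ - ς))
        (min (1 / 4 + g * ℓ - (ρ₁ + ρ₂₁) / 2)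
          (g * ν + (1 - γ) / 4 + g * ℓ - (ρ₁ + 2 * ρ₂₁) / 2 - ς)) := by
    intro ς
    have e1 : (1 - γ) * (4 * ν + d) / (2 * d) = 2 * (g * ν) + (1 - γ) / 2 := by
      rw [hg]; field_simp; ring
    have e2 : (1 - γ) * (ellStar d ν : ℝ) / d = g * ℓ := by rw [hg]; ring
    have e3 : (1 - γ) * (4 * ν + d + 4 * (ellStar d ν : ℝ)) / (4 * d) =
        g * ν + (1 - γ) / 4 + g * ℓ := by
      rw [hg, hℓdef]; field_simp
    rw [b₂, e1, e2, e3]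
  refine ⟨exists_isDifferencing d ℓ hγ0, min (min ((1 - γ) / 2)
    ((1 - γ) / 4 + (g * ℓ - g * ν) - ρ₁ / 2)) (min (2 * (g * ν) + (1 - γ) / 2 - ρ₂₁)
    (g * ν + (1 - γ) / 4 + g * ℓ - (ρ₁ + 2 * ρ₂₁) / 2)), ?_, fun ς hς hςlt => ?_⟩
  · refine lt_min (lt_min ?_ ?_) (lt_min ?_ ?_) <;> linarith
  simp only [lt_min_iff] at hςlt
  obtain ⟨⟨hς1, hς2⟩, hς3, hς4⟩ := hςlt
  have hb₁0 : 0 < b₁ d ν γ ρ₁ ρ₂₂ ς := by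
    rw [hb₁]
    refine lt_min (lt_min ?_ ?_) (lt_min ?_ ?_) <;> linarith
  have hb₂0 : 0 < b₂ d ν γ ρ₁ ρ₂₁ ς := by
    rw [hb₂]
    refine lt_min (lt_min ?_ ?_) (lt_min ?_ ?_) <;> linarith
  refine ⟨hb₁0, hb₂0, fun c cLim hc => ⟨?_, ?_⟩⟩
  · have hle := (hb₁ ς).le
    simp only [le_min_iff] at hle
    obtain ⟨⟨hle1, hle2⟩, hle3, hle4⟩ := hle
    obtain ⟨c₁, hc₁, hctrl⟩ := exists_eventually_isControlled_theta (p := p) (f := f)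
      (ρ₁ := ρ₁) (ρ₂₁ := ρ₂₁) (ρ₂₂ := ρ₂₂) (ρ₃₁ := ρ₃₁) (ρ₃₂ := ρ₃₂)
      (b := b₁ d ν γ ρ₁ ρ₂₂ ς) hν hγ0 hγ1 hf hc hρ₁.2 hρ₃₂.2 (by linarith)
      (by rw [← hg]; linarith) (by rw [← hg]; linarith) (by rw [← hg]; linarith)
    refine ⟨c₁, hc₁, fun ε hε hε2 => ?_⟩
    obtain ⟨n₀, hn₀⟩ := exists_nat_of_eventually (d := d) ((hctrl ε hε).and
      ((eventually_log_le (d := d) hb₁0 hc₁ hε).and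
        (eventually_mem_sieve (d := d) hθ₀ hα₀ hτ₀ hρ₁.1 hρ₂₁.1 hρ₂₂.1 hρ₃₁ hρ₃₂.1)))
    refine ⟨n₀, fun m hm _ δ hδ => ?_⟩
    obtain ⟨hC, hlog, hq₀⟩ := hn₀ m hm
    rw [Nat.cast_pow]
    exact ⟨fun Ω _ P _ Y hM => ((hC δ hδ q₀ hq₀).tail_bounds hc₁ hlog hθ₀ hε hM).1,
      fun q hq hqε Ω _ P _ Y hM =>
        ((hC δ hδ q hq).tail_bounds hc₁ hlog hq.1 hε hM).2 q₀.θ hθ₀ hε2 hqε⟩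
  · have hle := (hb₂ ς).le
    simp only [le_min_iff] at hle
    obtain ⟨⟨hle1, hle2⟩, hle3, hle4⟩ := hle
    obtain ⟨c₂, hc₂, hctrl⟩ := exists_eventually_isControlled_tau (p := p) (f := f)
      (ρ₁ := ρ₁) (ρ₂₁ := ρ₂₁) (ρ₂₂ := ρ₂₂) (ρ₃₁ := ρ₃₁) (ρ₃₂ := ρ₃₂)
      (b := b₂ d ν γ ρ₁ ρ₂₁ ς) hν hγ0 hγ1 hf hc hρ₁.2 (by rw [← hg]; linarith) (by linarith)
      (by rw [← hg]; linarith) (by rw [← hg]; linarith) (by rw [← hg]; linarith)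
    refine ⟨c₂, hc₂, fun ε hε hε2 => ?_⟩
    obtain ⟨n₀, hn₀⟩ := exists_nat_of_eventually (d := d) ((hctrl ε hε).and
      ((eventually_log_le (d := d) hb₂0 hc₂ hε).and
        (eventually_mem_sieve (d := d) hθ₀ hα₀ hτ₀ hρ₁.1 hρ₂₁.1 hρ₂₂.1 hρ₃₁ hρ₃₂.1)))
    refine ⟨n₀, fun m hm _ δ hδ => ?_⟩
    obtain ⟨hC, hlog, hq₀⟩ := hn₀ m hm
    rw [Nat.cast_pow]
    exact ⟨fun Ω _ P _ Y hM => ((hC δ hδ q₀ hq₀).tail_bounds hc₂ hlog hτ₀ hε hM).1,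
      fun q hq hqε Ω _ P _ Y hM =>
        ((hC δ hδ q hq).tail_bounds hc₂ hlog hq.2.2.1 hε hM).2 q₀.τ hτ₀ hε2 hqε⟩
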